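/- Let $M$ be a smooth 3-manifold with a pair $(\xi,\tilde\xi)$ of transverse smooth contact distributions, $A=\xi\cap\tilde\xi$ its axis, and $m\in M$. On an open neighbourhood $U$ of $m$ let $\alpha,\tilde\alpha$ be balanced contact forms ($\ker\alpha=\xi$, $\ker\tilde\alpha=\tilde\xi$, $\alpha\wedge d\alpha=\pm\,\tilde\alpha\wedge d\tilde\alpha$ with a fixed sign $\pm$ on $U$), let $X$ be the normalized vector field spanning $A$, $i_X(\alpha\wedge d\alpha)=\alpha\wedge\tilde\alpha$, let $f'=Xf$ denote the derivative of a function along $X$, and let $$I=\frac{\alpha\wedge d\tilde\alpha+\tilde\alpha\wedge d\alpha}{\alpha\wedge d\alpha}$$ be the generating invariant. Let $\mathcal S$ be the Schwarzian invariant: the section of $(A^*)^2$ whose value at a point is the Schwarzian derivative between the two projective structures that $\xi$ and $\tilde\xi$ induce on the integral curve of $A$ through this point. Suppose that on $U$: $\mathcal S\neq 0$ and $I'\ne 0$ everywhere, and $I'=F(I)$ is a function of $I$. Put $\beta=dI/I'$. (a) If the pair admits an infinitesimal symmetry around $m$ (a smooth vector field on a neighbourhood of $m$, not vanishing identically near $m$,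 whose local flow preserves $\xi$ and $\tilde\xi$), then there are smooth local coordinates $(x,y,p)$ around $m$ in which either - (III$_2$) $\xi=\{dy=p\,dx\}$, $\tilde\xi=\{dy=f(p)\,dx\}$ for some smooth function $f$, or - (III$_1$) $\displaystyle \xi=\Big\{dy=\frac{p+a(y)}{p+b(y)}\,dx\Big\}$, $\displaystyle \tilde\xi=\Big\{dy=\frac{f(p)+a(y)}{f(p)+b(y)}\,dx\Big\}$ for some smooth functions $a,b,f$ (with non-zero denominators). (b) There are a 1-form $\nu$ and a function $\Lambda$ on $U$ satisfying the structure equations $$d\alpha=\nu\wedge\alpha+\tilde\alpha\wedge\beta,\qquad d\tilde\alpha=\nu\wedge\tilde\alpha+I\,\tilde\alpha\wedge\beta\pm\beta\wedge\alpha,\qquad d\nu=\Lambda\,\alpha\wedge\tilde\alpha$$ (they are then unique on $U$; $\Lambda$ is rescaled by $\lambda^{-2}$ when $\alpha,\tilde\alpha$ are rescaled by $\lambda$). The pair has the form III$_2$ in some smooth local coordinates around $m$ if and only if $\Lambda\equiv0$ in a neighbourhood of $m$. In particular a pair with a symmetry around $m$ and $\Lambda\not\equiv 0$ near $m$ has the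 form III$_1$. (c) If $\Lambda(m)\ne0$, then the local symmetry algebra of the pair around $m$ (the germs at $m$ of infinitesimal symmetries) has dimension at most $1$. -/

import Mathlib

open Set Filter Topology
open scoped Manifold ContDiff

noncomputable section

namespace ContactPairs

/-- The model space of 3-manifolds. -/
abbrev E3 : Type := EuclideanSpace ℝ (Fin 3)

section Basic

variable {M : Type*} [TopologicalSpace M] [ChartedSpace E3 M] [IsManifold 𝓘(ℝ, E3) ∞ M]

variable (M) in
/-- Vector fields on a 3-manifold (no regularity). -/
abbrev VField : Type _ := (x : M) → TangentSpace 𝓘(ℝ, E3) x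

variable (M) in
/-- Differential 1-forms on a 3-manifold (no regularity). -/
abbrev OneForm : Type _ := (x : M) → TangentSpace 𝓘(ℝ, E3) x →L[ℝ] ℝ

variable (M) in
/-- Fields of linear subspaces of the tangent spaces (no regularity). -/
abbrev PlaneField : Type _ := (x : M) → Submodule ℝ (TangentSpace 𝓘(ℝ, E3) x)

/-- `X` is a smooth vector field on `U`. -/
def VField.SmoothOn (X : VField M) (U : Set M) : Prop :=
  ContMDiffOn 𝓘(ℝ, E3) 𝓘(ℝ, E3).tangent ∞
    (fun x => (⟨x, X x⟩ : TangentBundle 𝓘(ℝ, E3) M)) U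

/-- The coordinate expression of a 1-form in the preferred chart at `x₀`: its pullback under the
inverse of the chart. -/
def OneForm.inChart (α : OneForm M) (x₀ : M) (y : E3) : E3 →L[ℝ] ℝ :=
  (α ((extChartAt 𝓘(ℝ, E3) x₀).symm y)).comp
    (mfderiv 𝓘(ℝ, E3) 𝓘(ℝ, E3) (extChartAt 𝓘(ℝ, E3) x₀).symm y)

/-- `α` is a smooth 1-form on (the open set) `U`. -/
def OneForm.SmoothOn (α : OneForm M) (U : Set M) : Prop :=
  ∀ x ∈ U, ContDiffAt ℝ ∞ (α.inChart x) (extChartAt 𝓘(ℝ, E3) x x)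

/-- The exterior derivative `dα` of a 1-form at `x`, as a function of two tangent vectors. It is
computed in the preferred chart at `x`, whose differential at `x` is the identification of
`TangentSpace 𝓘(ℝ, E3) x` with `E3`. -/
def OneForm.d (α : OneForm M) (x : M) (u v : TangentSpace 𝓘(ℝ, E3) x) : ℝ :=
  (fderiv ℝ (α.inChart x) (extChartAt 𝓘(ℝ, E3) x x) (u : E3)) (v : E3) -
    (fderiv ℝ (α.inChart x) (extChartAt 𝓘(ℝ, E3) x x) (v : E3)) (u : E3)

/-- The differential `df` of a function. -/
def dfun (f : M → ℝ) : OneForm M := fun x => mfderiv 𝓘(ℝ, E3) 𝓘(ℝ, ℝ) f x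

/-- The derivative `X f` of a function along a vector field. -/
def VField.deriv (X : VField M) (f : M → ℝ) (x : M) : ℝ := dfun f x (X x)

/-- The value `(α ∧ β)(u, v)` at `x`. -/
def wedge (α β : OneForm M) (x : M) (u v : TangentSpace 𝓘(ℝ, E3) x) : ℝ :=
  α x u * β x v - α x v * β x u

/-- The value `(α ∧ dβ)(u, v, w)` at `x`. -/
def wedged (α β : OneForm M) (x : M) (u v w : TangentSpace 𝓘(ℝ, E3) x) : ℝ :=
  α x u * β.d x v w - α x v * β.d x u w + α x w * β.d x u v

/-- `ξ` is a (smooth) contact distribution: locally `ξ = ker α` for a smooth 1-form `α` with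
`α ∧ dα` nowhere zero. -/
def IsContact (ξ : PlaneField M) : Prop :=
  ∀ m : M, ∃ U : Set M, IsOpen U ∧ m ∈ U ∧ ∃ α : OneForm M, α.SmoothOn U ∧
    ∀ x ∈ U, (∀ v, v ∈ ξ x ↔ α x v = 0) ∧ ∃ u v w, wedged α α x u v w ≠ 0

/-- `Φ` is a smooth local flow of the vector field `Y` (defined on `W`), for times `|t| < δ` and
initial points in `V`. -/
structure IsLocalFlow (Y : VField M) (W : Set M) (δ : ℝ) (V : Set M) (Φ : ℝ → M → M) : Prop where
  pos : 0 < δ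
  isOpen : IsOpen V
  smooth : ContMDiffOn (𝓘(ℝ, ℝ).prod 𝓘(ℝ, E3)) 𝓘(ℝ, E3) ∞ (fun q : ℝ × M => Φ q.1 q.2)
    (Ioo (-δ) δ ×ˢ V)
  mapsTo : ∀ t ∈ Ioo (-δ) δ, ∀ x ∈ V, Φ t x ∈ W
  zero : ∀ x ∈ V, Φ 0 x = x
  integral : ∀ x ∈ V, IsMIntegralCurveOn (fun t => Φ t x) Y (Ioo (-δ) δ)

end Basic

/-- A pair `(M, ξ, ξ')` of transverse contact distributions. -/
structure ContactPair (M : Type*) [TopologicalSpace M] [ChartedSpace E3 M]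
    [IsManifold 𝓘(ℝ, E3) ∞ M] where
  ξ : PlaneField M
  ξ' : PlaneField M
  contact : IsContact ξ
  contact' : IsContact ξ'
  transverse : ∀ x, ξ x ⊔ ξ' x = ⊤

section Pair

variable {M : Type*} [TopologicalSpace M] [ChartedSpace E3 M] [IsManifold 𝓘(ℝ, E3) ∞ M]
  (P : ContactPair M)

/-- The axis `A = ξ ∩ ξ'`. -/
def ContactPair.axis : PlaneField M := fun x => P.ξ x ⊓ P.ξ' x

/-- `Y` is an infinitesimal symmetry of the pair on the open set `W`: a smooth vector field on `W`
whose (local) flow maps `ξ` to `ξ` and `ξ'` to `ξ'`. -/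
structure ContactPair.IsInfinitesimalSymmetryOn (Y : VField M) (W : Set M) : Prop where
  smooth : Y.SmoothOn W
  flow : ∀ x₀ ∈ W, ∃ (δ : ℝ) (V : Set M) (Φ : ℝ → M → M), x₀ ∈ V ∧ IsLocalFlow Y W δ V Φ ∧
    ∀ t ∈ Ioo (-δ) δ, ∀ x ∈ V,
      (P.ξ x).map (mfderiv 𝓘(ℝ, E3) 𝓘(ℝ, E3) (Φ t) x).toLinearMap = P.ξ (Φ t x) ∧
      (P.ξ' x).map (mfderiv 𝓘(ℝ, E3) 𝓘(ℝ, E3) (Φ t) x).toLinearMap = P.ξ' (Φ t x)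

/-- The pair admits an infinitesimal symmetry around `m`: one that is defined on a neighbourhood of
`m` and has non-zero germ at `m`. -/
def ContactPair.AdmitsSymmetryAt (m : M) : Prop :=
  ∃ (W : Set M) (Y : VField M), IsOpen W ∧ m ∈ W ∧ P.IsInfinitesimalSymmetryOn Y W ∧
    ¬ ∀ᶠ x in 𝓝 m, Y x = 0

/-- The local symmetry algebra around `m` (germs at `m` of infinitesimal symmetries) has dimension
at most one: any two of its elements are linearly dependent over `ℝ`. -/
def ContactPair.SymmetryDimLEOneAt (m : M) : Prop :=
  ∀ (W : Set M) (Y₁ Y₂ : VField M), IsOpen W → m ∈ W →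
    P.IsInfinitesimalSymmetryOn Y₁ W → P.IsInfinitesimalSymmetryOn Y₂ W →
    ∃ a b : ℝ, (a ≠ 0 ∨ b ≠ 0) ∧ ∀ᶠ x in 𝓝 m, a • Y₁ x + b • Y₂ x = 0

/-- The Schwarzian derivative `(g''/g')' - (g''/g')²/2` of a function of one variable. -/
def schwarzian (g : ℝ → ℝ) (t : ℝ) : ℝ :=
  deriv (fun y => deriv (deriv g) y / deriv g y) t - (deriv (deriv g) t / deriv g t) ^ 2 / 2

/-- `s = 𝒮_m(v)` is the value of the Schwarzian invariant at `v ∈ A_m`, `v ≠ 0`. Here `X` is a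
vector field spanning the axis with `X m = v` and flow `Φ`; the curves
`t ↦ (Φ_t)^* ξ_{Φ_t(m)}` and `t ↦ (Φ_t)^* ξ'_{Φ_t(m)}` in the projective line `ℙ(T_m M / A_m)` are
written as `u` and `u'` in the affine coordinate given by linear coordinates `a, b` on
`T_m M / A_m`, and `s` is the Schwarzian derivative of the transition map `g` from `u` to `u'`,
pulled back by `u`. -/
def ContactPair.HasSchwarzianAt (m : M) (v : TangentSpace 𝓘(ℝ, E3) m) (s : ℝ) : Prop :=
  ∃ (W : Set M) (X : VField M) (δ : ℝ) (V : Set M) (Φ : ℝ → M → M)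
    (a b : TangentSpace 𝓘(ℝ, E3) m →L[ℝ] ℝ) (u u' g : ℝ → ℝ),
    IsOpen W ∧ m ∈ V ∧ V ⊆ W ∧ X.SmoothOn W ∧ (∀ x ∈ W, X x ≠ 0 ∧ X x ∈ P.axis x) ∧ X m = v ∧
    IsLocalFlow X W δ V Φ ∧
    (∀ w, w ∈ P.axis m ↔ a w = 0 ∧ b w = 0) ∧
    ContDiffAt ℝ ∞ u 0 ∧ ContDiffAt ℝ ∞ u' 0 ∧ ContDiffAt ℝ ∞ g (u 0) ∧
    (∀ᶠ t in 𝓝 (0 : ℝ), ∀ w,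
      (mfderiv 𝓘(ℝ, E3) 𝓘(ℝ, E3) (Φ t) m w ∈ P.ξ (Φ t m) ↔ b w = u t * a w) ∧
      (mfderiv 𝓘(ℝ, E3) 𝓘(ℝ, E3) (Φ t) m w ∈ P.ξ' (Φ t m) ↔ b w = u' t * a w) ∧
      g (u t) = u' t) ∧
    s = schwarzian g (u 0) * (deriv u 0) ^ 2

/-- The Schwarzian invariant, a quadratic form on the line `A_m`, is not zero at `m`. -/
def ContactPair.SchwarzianNeZeroAt (m : M) : Prop :=
  ∃ (v : TangentSpace 𝓘(ℝ, E3) m) (s : ℝ), P.HasSchwarzianAt m v s ∧ s ≠ 0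

/-- On `U`, the 1-forms `α, α'` are balanced contact forms for the pair, with sign `ε = ±1`
(`α ∧ dα = ε α' ∧ dα'`), and `X` is the normalized vector field along the axis
(`i_X (α ∧ dα) = α ∧ α'`). -/
structure ContactPair.IsBalancedOn (U : Set M) (ε : ℝ) (α α' : OneForm M) (X : VField M) :
    Prop where
  sign : ε = 1 ∨ ε = -1
  smooth : α.SmoothOn U
  smooth' : α'.SmoothOn U
  ker : ∀ x ∈ U, ∀ v, v ∈ P.ξ x ↔ α x v = 0
  ker' : ∀ x ∈ U, ∀ v, v ∈ P.ξ' x ↔ α' x v = 0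
  balanced : ∀ x ∈ U, ∀ u v w, wedged α α x u v w = ε * wedged α' α' x u v w
  normalized : ∀ x ∈ U, ∀ v w, wedged α α x (X x) v w = wedge α α' x v w

/-- `I` is the generating invariant `(α ∧ dα' + α' ∧ dα) / (α ∧ dα)` on `U`, where `α, α'` are
balanced contact forms. -/
def IsGeneratingInvariantOn (U : Set M) (α α' : OneForm M) (I : M → ℝ) : Prop :=
  ∀ x ∈ U, ∀ u v w,
    I x * wedged α α x u v w = wedged α α' x u v w + wedged α' α x u v w

/-- The invariant `Λ` along the local section `(α, α', β)`, `β = dI / I'`, of the `ℝˣ`-bundle `B` of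
coframes made of balanced contact forms and `β`. The pullback `ν` to `U`, by this section, of the
canonical connection form of `B` is the unique 1-form satisfying the first two structure equations
`dα = ν ∧ α + α' ∧ β` and `dα' = ν ∧ α' + I α' ∧ β + ε β ∧ α`; and `Λ` is given by
`dν = Λ α ∧ α'`. Rescaling `α, α'` by a function `l` rescales `Λ` by `l⁻²`. -/
structure IsLambdaOn (U : Set M) (ε : ℝ) (α α' : OneForm M) (X : VField M) (I : M → ℝ)
    (ν : OneForm M) (Λ : M → ℝ) : Prop where
  smooth : ν.SmoothOn U
  d_form : ∀ x ∈ U, ∀ u v, α.d x u v =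
    wedge ν α x u v + wedge α' (fun y => (X.deriv I y)⁻¹ • dfun I y) x u v
  d_form' : ∀ x ∈ U, ∀ u v, α'.d x u v =
    wedge ν α' x u v + I x * wedge α' (fun y => (X.deriv I y)⁻¹ • dfun I y) x u v +
      ε * wedge (fun y => (X.deriv I y)⁻¹ • dfun I y) α x u v
  d_conn : ∀ x ∈ U, ∀ u v, ν.d x u v = Λ x * wedge α α' x u v

/-- The differential of the `i`-th coordinate function of a chart `e`. -/
def dcoord (e : OpenPartialHomeomorph M E3) (i : Fin 3) : OneForm M := dfun (fun q => e q i)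

/-- In some smooth local coordinates `(x, y, p)` around `m`, for some smooth function `f`,
`ξ = {dy = p dx}` and `ξ' = {dy = f(p) dx}`. -/
def ContactPair.HasTypeIII₂At (m : M) : Prop :=
  ∃ e ∈ IsManifold.maximalAtlas 𝓘(ℝ, E3) ∞ M, m ∈ e.source ∧ ∃ f : ℝ → ℝ,
    ∀ q ∈ e.source,
      ContDiffAt ℝ ∞ f (e q 2) ∧
      (∀ v, v ∈ P.ξ q ↔ dcoord e 1 q v = e q 2 * dcoord e 0 q v) ∧
      (∀ v, v ∈ P.ξ' q ↔ dcoord e 1 q v = f (e q 2) * dcoord e 0 q v)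

/-- In some smooth local coordinates `(x, y, p)` around `m`, for some smooth functions `a, b, f`,
`ξ = {dy = (p + a(y)) / (p + b(y)) dx}` and `ξ' = {dy = (f(p) + a(y)) / (f(p) + b(y)) dx}`, with
non-zero denominators. -/
def ContactPair.HasTypeIII₁At (m : M) : Prop :=
  ∃ e ∈ IsManifold.maximalAtlas 𝓘(ℝ, E3) ∞ M, m ∈ e.source ∧ ∃ a b f : ℝ → ℝ,
    ∀ q ∈ e.source,
      ContDiffAt ℝ ∞ a (e q 1) ∧ ContDiffAt ℝ ∞ b (e q 1) ∧ ContDiffAt ℝ ∞ f (e q 2) ∧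
      e q 2 + b (e q 1) ≠ 0 ∧ f (e q 2) + b (e q 1) ≠ 0 ∧
      (∀ v, v ∈ P.ξ q ↔ dcoord e 1 q v =
        (e q 2 + a (e q 1)) / (e q 2 + b (e q 1)) * dcoord e 0 q v) ∧
      (∀ v, v ∈ P.ξ' q ↔ dcoord e 1 q v =
        (f (e q 2) + a (e q 1)) / (f (e q 2) + b (e q 1)) * dcoord e 0 q v)

end Pair

end ContactPairs

end

set_option linter.unusedSectionVars false

/-! The method is Cartan's: everything is read off from the coframe (α, α', β). Since dI = J β with
J = I' a function of I, the form β is closed (`BalancedCoframe.dβ`). The first two structure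
equations can be solved for ν, and applying d to them leaves dν ∧ α = dν ∧ α' = 0, so dν is a
multiple Λ of α ∧ α' (`exists_connection`, `fd_connection`).

For a symmetry Y put a = α(Y), b = α'(Y). Differentiating the equations for da and db forces β(Y) =
0 and closes the system to da = κα + aν - bβ, db = κα' + bν - (Ib - εa)β, dκ = Λ(aα' - bα)
(`FlatSymmetry.exists_system`). Hence a symmetry whose data (a, b, κ) vanish at one point is trivial
near it, and d(dκ) = 0 reads (dΛ + 2Λν - IΛβ) ∧ (aα' - bα) = -2Λκ α ∧ α'. If two symmetries are
independent at a point where Λ ≠ 0, then with Δ = a₁b₂ - a₂b₁ this gives d(2 log|Δ| + log|Λ|) = 2ν -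
Iβ; another d yields Λ = 0, a contradiction (`eq_zero_of_two_systems`). So when Λ(m) ≠ 0 two
symmetries have a combination with a = b = 0 at m, hence κ(m) = 0, and this combination vanishes
near m. In the form III₂ the fields ∂/∂x and ∂/∂y are independent symmetries, so Λ = 0 there.

The normal forms come from forms A = gα + kα' with g, k functions of I chosen so that dA = ν ∧ A;
two independent such forms A, B exist by solving a linear ODE in I (`exists_rows`). The ratios p =
-k_A/k_B and f = -g_A/g_B describe ξ = {A + pB = 0} and ξ̃ = {A + fB = 0}, and f is a function of p.
If Λ = 0, then ν = dσ, the forms exp(-σ)A and exp(-σ)B are exact, and they supply the coordinates of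
III₂. If Y is a symmetry with (a, b) ≠ (0, 0) at m, after a choice making B(Y) ≠ 0, the ratio R =
A(Y)/B(Y) satisfies dR = κ(A - RB)/B(Y), and B/B(Y) = dx₁, (A - RB)/B(Y) = dw are closed; R is a
function of w, and a linear change of (x₁, w) gives III₁.

There remains a nontrivial symmetry with Y(m) = 0. Then κ(m) ≠ 0, (a, b, I) are coordinates, and Y
is a multiple of the radial field of the (a, b)-planes. Integrability makes s²Λ constant along rays
issuing from the curve a = b = 0, so Λ = 0 near m and the form is III₂
(`eventually_eq_zero_of_fixed_point`). -/

namespace ContactPairs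

/-! ### Exterior calculus and coframes in a normed space. -/

section Flat

variable {E : Type*} [NormedAddCommGroup E] [NormedSpace ℝ E]

/-- The exterior derivative of a 1-form on a normed space. -/
noncomputable def fd (θ : E → E →L[ℝ] ℝ) (x u v : E) : ℝ := fderiv ℝ θ x u v - fderiv ℝ θ x v u

lemma fd_congr {θ η : E → E →L[ℝ] ℝ} {x : E} (h : θ =ᶠ[𝓝 x] η) (u v : E) :
    fd θ x u v = fd η x u v := by
  simp only [fd, h.fderiv_eq]

lemma fd_add {θ η : E → E →L[ℝ] ℝ} {x : E} (hθ : DifferentiableAt ℝ θ x)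
    (hη : DifferentiableAt ℝ η x) (u v : E) :
    fd (fun y => θ y + η y) x u v = fd θ x u v + fd η x u v := by
  simp only [fd, fderiv_fun_add hθ hη, add_apply]; ring

lemma fd_sub {θ η : E → E →L[ℝ] ℝ} {x : E} (hθ : DifferentiableAt ℝ θ x)
    (hη : DifferentiableAt ℝ η x) (u v : E) :
    fd (fun y => θ y - η y) x u v = fd θ x u v - fd η x u v := by
  simp only [fd, fderiv_fun_sub hθ hη, sub_apply]; ring

lemma fd_smul {f : E → ℝ} {θ : E → E →L[ℝ] ℝ} {x : E} (hf : DifferentiableAt ℝ f x)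
    (hθ : DifferentiableAt ℝ θ x) (u v : E) :
    fd (fun y => f y • θ y) x u v =
      fderiv ℝ f x u * θ x v - fderiv ℝ f x v * θ x u + f x * fd θ x u v := by
  simp only [fd, fderiv_fun_smul hf hθ, add_apply,
    smul_apply, ContinuousLinearMap.smulRight_apply, smul_eq_mul]; ring

lemma two_le_infty : (2 : WithTop ℕ∞) ≤ ∞ := ENat.LEInfty.out

lemma fd_fderiv_eq_zero {f : E → ℝ} {η : E → E →L[ℝ] ℝ} {x : E} (hf : ContDiffAt ℝ ∞ f x)
    (h : ∀ᶠ y in 𝓝 x, fderiv ℝ f y = η y) (u v : E) : fd η x u v = 0 := by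
  have h1 : fderiv ℝ f =ᶠ[𝓝 x] η := h
  have h2 : IsSymmSndFDerivAt ℝ f x := hf.isSymmSndFDerivAt (by simpa using two_le_infty)
  rw [← fd_congr h1, fd, h2.eq, sub_self]

lemma fd_self (θ : E → E →L[ℝ] ℝ) (x u : E) : fd θ x u u = 0 := by simp [fd]

lemma fd_swap (θ : E → E →L[ℝ] ℝ) (x u v : E) : fd θ x u v = -fd θ x v u := by simp [fd]

lemma contDiffAt_fd {θ : E → E →L[ℝ] ℝ} {x : E} (hθ : ContDiffAt ℝ ∞ θ x) (u v : E) :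
    ContDiffAt ℝ ∞ (fun y => fd θ y u v) x := by
  have h : ContDiffAt ℝ ∞ (fderiv ℝ θ) x := hθ.fderiv_right (by simp)
  have h2 : ∀ u v : E, ContDiffAt ℝ ∞ (fun y => fderiv ℝ θ y u v) x := fun u v =>
    (h.clm_apply contDiffAt_const).clm_apply contDiffAt_const
  exact (h2 u v).sub (h2 v u)

/-- Coefficients such as Λ and κ are obtained pointwise by choice, with no continuity built in; this
recovers their smoothness by writing them as quotients of smooth functions. -/
lemma contDiffAt_of_mul_eq {κ d g : E → ℝ} {x : E} (hd : ContDiffAt ℝ ∞ d x)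
    (hg : ContDiffAt ℝ ∞ g x) (h0 : d x ≠ 0) (h : ∀ᶠ y in 𝓝 x, κ y * d y = g y) :
    ContDiffAt ℝ ∞ κ x := by
  refine (hg.div hd h0).congr_of_eventuallyEq ?_
  filter_upwards [h, hd.continuousAt.eventually_ne h0] with y hy hy0
  rw [Pi.div_apply, ← hy, mul_div_cancel_right₀ _ hy0]

/-- `e₁, e₂, e₃` is the basis dual to the coframe `a, b, c`. -/
structure IsDualFrame (a b c : E →L[ℝ] ℝ) (e₁ e₂ e₃ : E) : Prop where
  a₁ : a e₁ = 1
  a₂ : a e₂ = 0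
  a₃ : a e₃ = 0
  b₁ : b e₁ = 0
  b₂ : b e₂ = 1
  b₃ : b e₃ = 0
  c₁ : c e₁ = 0
  c₂ : c e₂ = 0
  c₃ : c e₃ = 1
  span : ∀ u, u = a u • e₁ + b u • e₂ + c u • e₃

lemma IsDualFrame.ext {a b c : E →L[ℝ] ℝ} {e₁ e₂ e₃ : E} (h : IsDualFrame a b c e₁ e₂ e₃)
    {f g : E →L[ℝ] ℝ} (h₁ : f e₁ = g e₁) (h₂ : f e₂ = g e₂) (h₃ : f e₃ = g e₃) : f = g := by
  ext u
  rw [h.span u]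
  simp only [map_add, map_smul, h₁, h₂, h₃]

lemma IsDualFrame.apply {a b c : E →L[ℝ] ℝ} {e₁ e₂ e₃ : E} (h : IsDualFrame a b c e₁ e₂ e₃)
    (f : E →L[ℝ] ℝ) (u : E) : f u = a u * f e₁ + b u * f e₂ + c u * f e₃ := by
  conv_lhs => rw [h.span u]
  simp only [map_add, map_smul, smul_eq_mul]

/-- A 2-form is determined by its values on a basis. -/
lemma IsDualFrame.fd_apply {a b c : E →L[ℝ] ℝ} {e₁ e₂ e₃ : E} (h : IsDualFrame a b c e₁ e₂ e₃)
    (θ : E → E →L[ℝ] ℝ) (x u v : E) :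
    fd θ x u v = fd θ x e₁ e₂ * (a u * b v - a v * b u) + fd θ x e₂ e₃ * (b u * c v - b v * c u) +
      fd θ x e₃ e₁ * (c u * a v - c v * a u) := by
  conv_lhs => rw [h.span u, h.span v]
  simp only [fd, map_add, map_smul, smul_eq_mul, add_apply,
    smul_apply]
  ring

/-- The local data of a pair of balanced contact forms with `I' = F(I)`, in coordinates. -/
structure BalancedCoframe (V : Set E) (ε : ℝ) (α α' β : E → E →L[ℝ] ℝ) (I J : E → ℝ) : Prop where
  isOpen : IsOpen V
  sign : ε ≠ 0
  smooth_α : ∀ x ∈ V, ContDiffAt ℝ ∞ α x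
  smooth_α' : ∀ x ∈ V, ContDiffAt ℝ ∞ α' x
  smooth_β : ∀ x ∈ V, ContDiffAt ℝ ∞ β x
  smooth_I : ∀ x ∈ V, ContDiffAt ℝ ∞ I x
  smooth_J : ∀ x ∈ V, ContDiffAt ℝ ∞ J x
  J_ne : ∀ x ∈ V, J x ≠ 0
  dI : ∀ x ∈ V, fderiv ℝ I x = J x • β x
  dep : ∃ F : ℝ → ℝ, ∀ x ∈ V, J x = F (I x)
  frame : ∀ x ∈ V, ∃ e₁ e₂ e₃, IsDualFrame (α x) (α' x) (β x) e₁ e₂ e₃ ∧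
    fd α x e₂ e₃ = 1 ∧ fd α' x e₃ e₁ = ε ∧ I x = fd α' x e₂ e₃ + fd α x e₃ e₁

/-- The structure equations satisfied by the connection form `ν`, in coordinates. -/
structure ConnectionForm (V : Set E) (ε : ℝ) (α α' β : E → E →L[ℝ] ℝ) (I : E → ℝ)
    (ν : E → E →L[ℝ] ℝ) (Λ : E → ℝ) : Prop where
  smooth : ∀ x ∈ V, ContDiffAt ℝ ∞ ν x
  dα : ∀ x ∈ V, ∀ u v, fd α x u v =
    ν x u * α x v - ν x v * α x u + (α' x u * β x v - α' x v * β x u)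
  dα' : ∀ x ∈ V, ∀ u v, fd α' x u v =
    ν x u * α' x v - ν x v * α' x u + I x * (α' x u * β x v - α' x v * β x u) +
      ε * (β x u * α x v - β x v * α x u)
  dν : ∀ x ∈ V, ∀ u v, fd ν x u v = Λ x * (α x u * α' x v - α x v * α' x u)

/-- An infinitesimal symmetry of the pair `(ker α, ker α')`, in coordinates. -/
structure FlatSymmetry (V : Set E) (α α' : E → E →L[ℝ] ℝ) (Y : E → E) : Prop where
  smooth : ∀ x ∈ V, ContDiffAt ℝ ∞ Y x
  lie : ∀ x ∈ V, ∀ w, α x w = 0 → fderiv ℝ α x (Y x) w + α x (fderiv ℝ Y x w) = 0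
  lie' : ∀ x ∈ V, ∀ w, α' x w = 0 → fderiv ℝ α' x (Y x) w + α' x (fderiv ℝ Y x w) = 0

variable {V : Set E} {ε : ℝ} {α α' β ν : E → E →L[ℝ] ℝ} {I J Λ : E → ℝ}

end Flat

/-! ### Smooth functions of `I`, and the exterior derivative of 2-forms. -/

section Flat

variable {E : Type*} [NormedAddCommGroup E] [NormedSpace ℝ E]
variable {V : Set E} {ε : ℝ} {α α' β ν : E → E →L[ℝ] ℝ} {I J Λ : E → ℝ}

lemma _root_.ContDiffAt.diff {F : Type*} [NormedAddCommGroup F] [NormedSpace ℝ F] {f : E → F}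
    {x : E} (h : ContDiffAt ℝ ∞ f x) : DifferentiableAt ℝ f x :=
  h.differentiableAt (by simp)

/-- If `J` is a function of `I`, both being smooth, then it is a smooth function of `I` wherever the
differential of `I` does not vanish. -/
lemma contDiffAt_of_comp_eq {F : ℝ → ℝ} {x u : E} (hI : ContDiffAt ℝ ∞ I x)
    (hJ : ContDiffAt ℝ ∞ J x) (hu : fderiv ℝ I x u ≠ 0) (h : ∀ᶠ y in 𝓝 x, J y = F (I y)) :
    ContDiffAt ℝ ∞ F (I x) := by
  -- On the line through x in direction u, `I` has nonzero derivative and so a smooth local inverse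
  -- σ; near I(x) the function F is J ∘ l ∘ σ.
  set l : ℝ → E := fun t => x + t • u with hl
  have hls : ContDiff ℝ ∞ l := by fun_prop
  have hl0 : l 0 = x := by simp [hl]
  have hl' : HasDerivAt l u 0 := by
    have := ((hasDerivAt_id (0 : ℝ)).smul_const u).const_add x
    rwa [one_smul] at this
  have hf : ContDiffAt ℝ ∞ (I ∘ l) 0 := ContDiffAt.comp 0 (by rwa [hl0]) hls.contDiffAt
  have hf' : HasDerivAt (I ∘ l) (fderiv ℝ I x u) 0 := by
    have := hI.diff.hasFDerivAt
    rw [← hl0] at this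
    simpa [hl0] using this.comp_hasDerivAt 0 hl'
  have hf'' : HasFDerivAt (I ∘ l)
      (ContinuousLinearEquiv.unitsEquivAut ℝ (Units.mk0 _ hu) : ℝ →L[ℝ] ℝ) 0 := by
    have h1 : (ContinuousLinearEquiv.unitsEquivAut ℝ (Units.mk0 _ hu) : ℝ →L[ℝ] ℝ) =
        ContinuousLinearMap.toSpanSingleton ℝ (fderiv ℝ I x u) := by ext; simp
    rw [h1]
    exact hf'.hasFDerivAt
  set σ := hf.localInverse hf'' (by simp) with hσ
  have hσs : ContDiffAt ℝ ∞ σ ((I ∘ l) 0) := hf.to_localInverse hf'' (by simp)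
  have hσ0 : σ ((I ∘ l) 0) = 0 := hf.localInverse_apply_image hf'' (by simp)
  have hr : ∀ᶠ s in 𝓝 ((I ∘ l) 0), (I ∘ l) (σ s) = s :=
    (hf.hasStrictFDerivAt' hf'' (by simp)).eventually_right_inverse
  have h0 : (I ∘ l) 0 = I x := by simp [hl0]
  rw [h0] at hσs hr hσ0
  have hls' : ContDiffAt ℝ ∞ (l ∘ σ) (I x) := hls.contDiffAt.comp _ hσs
  have hx : (l ∘ σ) (I x) = x := by simp [hσ0, hl0]
  have key : ContDiffAt ℝ ∞ (J ∘ (l ∘ σ)) (I x) := ContDiffAt.comp _ (by rwa [hx]) hls'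
  refine key.congr_of_eventuallyEq ?_
  have ht : Tendsto (l ∘ σ) (𝓝 (I x)) (𝓝 x) := by
    have := hls'.continuousAt.tendsto; rwa [hx] at this
  filter_upwards [hr, ht.eventually h] with s hs h2
  simp only [Function.comp_apply] at hs h2 ⊢
  rw [h2, hs]

/-- The exterior derivative of a 2-form on a normed space. -/
noncomputable def fd₂ (T : E → E → E → ℝ) (x u v w : E) : ℝ :=
  fderiv ℝ (fun y => T y v w) x u + fderiv ℝ (fun y => T y w u) x v + fderiv ℝ (fun y => T y u v) x w

/-- The wedge product of two 1-forms on a normed space. -/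
def fwedge (θ η : E → E →L[ℝ] ℝ) (x u v : E) : ℝ := θ x u * η x v - θ x v * η x u

lemma fd₂_congr {T S : E → E → E → ℝ} {x : E} (h : ∀ᶠ y in 𝓝 x, ∀ u v, T y u v = S y u v)
    (u v w : E) : fd₂ T x u v w = fd₂ S x u v w := by
  have h1 : ∀ u v, fderiv ℝ (fun y => T y u v) x = fderiv ℝ (fun y => S y u v) x := fun u v =>
    Filter.EventuallyEq.fderiv_eq (by filter_upwards [h] with y hy using hy u v)
  simp only [fd₂, h1]

lemma fd₂_fd {θ : E → E →L[ℝ] ℝ} {x : E} (h : ContDiffAt ℝ ∞ θ x) (u v w : E) :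
    fd₂ (fd θ) x u v w = 0 := by
  have h1 : DifferentiableAt ℝ (fderiv ℝ θ) x :=
    (h.fderiv_right (m := ∞) (by simp)).diff
  have h2 : ∀ a b : E, HasFDerivAt (fun y => fderiv ℝ θ y a b)
      (((fderiv ℝ (fderiv ℝ θ) x).flip a).flip b) x := fun a b => by
    have := (h1.hasFDerivAt.clm_apply (hasFDerivAt_const a x)).clm_apply (hasFDerivAt_const b x)
    simpa using this
  have h3 : ∀ a b c : E, fderiv ℝ (fun y => fd θ y a b) x c =
      fderiv ℝ (fderiv ℝ θ) x c a b - fderiv ℝ (fderiv ℝ θ) x c b a := by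
    intro a b c
    have := ((h2 a b).sub (h2 b a)).fderiv
    simp only [fd]
    exact (DFunLike.congr_fun this c).trans (by simp)
  have h4 : IsSymmSndFDerivAt ℝ θ x := h.isSymmSndFDerivAt (by simpa using two_le_infty)
  rw [fd₂, h3, h3, h3, h4.eq u v, h4.eq u w, h4.eq v w]
  ring

lemma fd₂_fwedge {θ η : E → E →L[ℝ] ℝ} {x : E} (hθ : DifferentiableAt ℝ θ x)
    (hη : DifferentiableAt ℝ η x) (u v w : E) : fd₂ (fwedge θ η) x u v w =
      fd θ x u v * η x w + fd θ x v w * η x u + fd θ x w u * η x v -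
        (θ x u * fd η x v w + θ x v * fd η x w u + θ x w * fd η x u v) := by
  have h1 : ∀ {θ : E → E →L[ℝ] ℝ} (_ : DifferentiableAt ℝ θ x) (a : E),
      HasFDerivAt (fun y => θ y a) ((ContinuousLinearMap.apply ℝ ℝ a).comp (fderiv ℝ θ x)) x :=
    fun h a => (ContinuousLinearMap.apply ℝ ℝ a).hasFDerivAt.comp x h.hasFDerivAt
  have h2 : ∀ a b c : E, fderiv ℝ (fun y => fwedge θ η y a b) x c =
      fderiv ℝ θ x c a * η x b + θ x a * fderiv ℝ η x c b -
        (fderiv ℝ θ x c b * η x a + θ x b * fderiv ℝ η x c a) := by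
    intro a b c
    have := (((h1 hθ a).mul (h1 hη b)).sub ((h1 hθ b).mul (h1 hη a))).fderiv
    simp only [fwedge]
    refine (DFunLike.congr_fun this c).trans ?_
    simp only [sub_apply, add_apply, smul_apply, ContinuousLinearMap.comp_apply,
      ContinuousLinearMap.apply_apply, smul_eq_mul]
    ring
  rw [fd₂, h2, h2, h2]
  simp only [fd]
  ring

lemma differentiableAt_fwedge {θ η : E → E →L[ℝ] ℝ} {x : E} (hθ : DifferentiableAt ℝ θ x)
    (hη : DifferentiableAt ℝ η x) (u v : E) : DifferentiableAt ℝ (fun y => fwedge θ η y u v) x := by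
  simp only [fwedge]; fun_prop

lemma fd₂_add {T S : E → E → E → ℝ} {x : E} (hT : ∀ u v, DifferentiableAt ℝ (fun y => T y u v) x)
    (hS : ∀ u v, DifferentiableAt ℝ (fun y => S y u v) x) (u v w : E) :
    fd₂ (fun y a b => T y a b + S y a b) x u v w = fd₂ T x u v w + fd₂ S x u v w := by
  simp only [fd₂, fderiv_fun_add (hT _ _) (hS _ _), add_apply]
  ring

lemma fd₂_smul {f : E → ℝ} {T : E → E → E → ℝ} {x : E} (hf : DifferentiableAt ℝ f x)
    (hT : ∀ u v, DifferentiableAt ℝ (fun y => T y u v) x) (u v w : E) :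
    fd₂ (fun y a b => f y * T y a b) x u v w =
      fderiv ℝ f x u * T x v w + fderiv ℝ f x v * T x w u + fderiv ℝ f x w * T x u v +
        f x * fd₂ T x u v w := by
  simp only [fd₂, fderiv_fun_mul hf (hT _ _), add_apply, smul_apply, smul_eq_mul]
  ring

/-! ### The connection form ν and the function Λ. -/

namespace BalancedCoframe

lemma nhds_mem (h : BalancedCoframe V ε α α' β I J) {x : E} (hx : x ∈ V) : ∀ᶠ y in 𝓝 x, y ∈ V :=
  h.isOpen.mem_nhds hx

lemma exists_contDiffAt_comp (h : BalancedCoframe V ε α α' β I J) : ∃ F : ℝ → ℝ, ∀ x ∈ V,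
    J x = F (I x) ∧ ContDiffAt ℝ ∞ F (I x) := by
  obtain ⟨F, hF⟩ := h.dep
  refine ⟨F, fun x hx => ⟨hF x hx, ?_⟩⟩
  obtain ⟨e₁, e₂, e₃, he, -⟩ := h.frame x hx
  refine contDiffAt_of_comp_eq (u := e₃) (h.smooth_I x hx) (h.smooth_J x hx) ?_ ?_
  · simp [h.dI x hx, he.c₃, h.J_ne x hx]
  · filter_upwards [h.nhds_mem hx] with y hy using hF y hy

/-- From 0 = d(dI) = dJ ∧ β + J dβ: the first term vanishes because dJ = F'(I) dI is proportional to
β, and J ≠ 0. -/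
lemma dβ (h : BalancedCoframe V ε α α' β I J) {x : E} (hx : x ∈ V) (u v : E) :
    fd β x u v = 0 := by
  obtain ⟨F, hF⟩ := h.exists_contDiffAt_comp
  have h1 : J =ᶠ[𝓝 x] F ∘ I := by
    filter_upwards [h.nhds_mem hx] with y hy using (hF y hy).1
  have h2 : fderiv ℝ J x = deriv F (I x) • fderiv ℝ I x := by
    rw [h1.fderiv_eq]
    exact ((hF x hx).2.diff.hasDerivAt.comp_hasFDerivAt x (h.smooth_I x hx).diff.hasFDerivAt).fderiv
  have h3 : fd (fun y => J y • β y) x u v = 0 := fd_fderiv_eq_zero (h.smooth_I x hx)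
    (by filter_upwards [h.nhds_mem hx] with y hy using h.dI y hy) u v
  rw [fd_smul (h.smooth_J x hx).diff (h.smooth_β x hx).diff, h2, h.dI x hx] at h3
  simp only [smul_apply, smul_eq_mul] at h3
  have h4 : J x * fd β x u v = 0 := by linear_combination h3
  exact (mul_eq_zero.1 h4).resolve_left (h.J_ne x hx)

/-- The determinant of a coframe is smooth. -/
lemma contDiffAt_det (h : BalancedCoframe V ε α α' β I J) {x : E} (hx : x ∈ V) (u v w : E) :
    ContDiffAt ℝ ∞ (fun y => α y u * (α' y v * β y w - α' y w * β y v) +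
      α y v * (α' y w * β y u - α' y u * β y w) + α y w * (α' y u * β y v - α' y v * β y u)) x := by
  have h1 := h.smooth_α x hx
  have h2 := h.smooth_α' x hx
  have h3 := h.smooth_β x hx
  fun_prop

/-- Expanding dα and dα' in the coframe leaves the coefficients p, q of dα', dα on α ∧ α' and r of
dα on β ∧ α; the normalizations fix all others in terms of I, ε and r. The form ν = pα - qα' + rβ
absorbs them. -/
lemma exists_connection (h : BalancedCoframe V ε α α' β I J) : ∃ ν : E → E →L[ℝ] ℝ,
    (∀ x ∈ V, ContDiffAt ℝ ∞ ν x) ∧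
    (∀ x ∈ V, ∀ u v, fd α x u v =
      ν x u * α x v - ν x v * α x u + (α' x u * β x v - α' x v * β x u)) ∧
    (∀ x ∈ V, ∀ u v, fd α' x u v =
      ν x u * α' x v - ν x v * α' x u + I x * (α' x u * β x v - α' x v * β x u) +
        ε * (β x u * α x v - β x v * α x u)) := by
  classical
  have hfr : ∀ x, ∃ e : E × E × E, x ∈ V → IsDualFrame (α x) (α' x) (β x) e.1 e.2.1 e.2.2 ∧
      fd α x e.2.1 e.2.2 = 1 ∧ fd α' x e.2.2 e.1 = ε ∧
      I x = fd α' x e.2.1 e.2.2 + fd α x e.2.2 e.1 := by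
    intro x
    by_cases hx : x ∈ V
    · obtain ⟨e₁, e₂, e₃, he⟩ := h.frame x hx
      exact ⟨(e₁, e₂, e₃), fun _ => he⟩
    · exact ⟨0, fun h => absurd h hx⟩
  choose e he using hfr
  set p : E → ℝ := fun x => fd α' x (e x).1 (e x).2.1
  set q : E → ℝ := fun x => fd α x (e x).1 (e x).2.1
  set r : E → ℝ := fun x => fd α x (e x).2.2 (e x).1
  -- The frames are chosen point by point, but p, q, r are the ratios of dα' ∧ β, dα ∧ β, dα ∧ α' to
  -- the volume form α ∧ α' ∧ β, and these can be evaluated on the vectors frozen at x.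
  have hsm : ∀ x ∈ V, ContDiffAt ℝ ∞ p x ∧ ContDiffAt ℝ ∞ q x ∧ ContDiffAt ℝ ∞ r x := by
    intro x hx
    obtain ⟨hf, -⟩ := he x hx
    have h1 := h.smooth_α x hx
    have h2 := h.smooth_α' x hx
    have h3 := h.smooth_β x hx
    have k1 := contDiffAt_fd h1
    have k2 := contDiffAt_fd h2
    have hdet := h.contDiffAt_det hx (e x).1 (e x).2.1 (e x).2.2
    have hd0 : α x (e x).1 * (α' x (e x).2.1 * β x (e x).2.2 - α' x (e x).2.2 * β x (e x).2.1) +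
      α x (e x).2.1 * (α' x (e x).2.2 * β x (e x).1 - α' x (e x).1 * β x (e x).2.2) +
      α x (e x).2.2 * (α' x (e x).1 * β x (e x).2.1 - α' x (e x).2.1 * β x (e x).1) ≠ 0 := by
      rw [hf.a₁, hf.a₂, hf.a₃, hf.b₁, hf.b₂, hf.b₃, hf.c₁, hf.c₂, hf.c₃]; norm_num
    have gen : ∀ (θ η : E → E →L[ℝ] ℝ), ContDiffAt ℝ ∞ θ x → ContDiffAt ℝ ∞ η x →
        ContDiffAt ℝ ∞ (fun y => fd θ y (e x).1 (e x).2.1 * η y (e x).2.2 +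
          fd θ y (e x).2.1 (e x).2.2 * η y (e x).1 + fd θ y (e x).2.2 (e x).1 * η y (e x).2.1) x := by
      intro θ η hθ hη
      have k := contDiffAt_fd hθ
      have k1 := k (e x).1 (e x).2.1
      have k2 := k (e x).2.1 (e x).2.2
      have k3 := k (e x).2.2 (e x).1
      fun_prop
    refine ⟨contDiffAt_of_mul_eq hdet (gen α' β h2 h3) hd0 ?_,
      contDiffAt_of_mul_eq hdet (gen α β h1 h3) hd0 ?_,
      contDiffAt_of_mul_eq hdet (gen α α' h1 h2) hd0 ?_⟩ <;>
    · filter_upwards [h.nhds_mem hx] with y hy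
      have hy' := (he y hy).1
      have := hy'.fd_apply
      simp only [p, q, r]
      rw [this _ y (e x).1, this _ y (e x).2.1, this _ y (e x).2.2]
      ring
  refine ⟨fun x => p x • α x - q x • α' x + r x • β x, fun x hx => ?_, fun x hx u v => ?_,
    fun x hx u v => ?_⟩
  · obtain ⟨hp, hq, hr⟩ := hsm x hx
    exact ((hp.smul (h.smooth_α x hx)).sub (hq.smul (h.smooth_α' x hx))).add
      (hr.smul (h.smooth_β x hx))
  · obtain ⟨hf, h1, h2, h3⟩ := he x hx
    rw [hf.fd_apply, h1]
    simp only [add_apply, sub_apply, smul_apply, smul_eq_mul, p, q, r]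
    ring
  · obtain ⟨hf, h1, h2, h3⟩ := he x hx
    rw [hf.fd_apply, h2, h3]
    simp only [add_apply, sub_apply, smul_apply, smul_eq_mul, p, q, r]
    ring

/-- Taking d of the two structure equations and using dβ = 0 and dI ∧ β = 0, everything cancels
except dν ∧ α = 0 and dν ∧ α' = 0; only the α ∧ α' coefficient of dν survives. -/
lemma fd_connection (h : BalancedCoframe V ε α α' β I J)
    (hν : ∀ x ∈ V, ContDiffAt ℝ ∞ ν x)
    (hα : ∀ x ∈ V, ∀ u v, fd α x u v =
      ν x u * α x v - ν x v * α x u + (α' x u * β x v - α' x v * β x u))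
    (hα' : ∀ x ∈ V, ∀ u v, fd α' x u v =
      ν x u * α' x v - ν x v * α' x u + I x * (α' x u * β x v - α' x v * β x u) +
        ε * (β x u * α x v - β x v * α x u)) {x : E} (hx : x ∈ V) :
    ∃ l : ℝ, ∀ u v, fd ν x u v = l * (α x u * α' x v - α x v * α' x u) := by
  obtain ⟨e₁, e₂, e₃, he, -⟩ := h.frame x hx
  have sα := (h.smooth_α x hx).diff
  have sα' := (h.smooth_α' x hx).diff
  have sβ := (h.smooth_β x hx).diff
  have sν := (hν x hx).diff
  have sI := (h.smooth_I x hx).diff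
  have k1 := differentiableAt_fwedge sν sα
  have k2 := differentiableAt_fwedge sν sα'
  have k3 := differentiableAt_fwedge sα' sβ
  have k4 := differentiableAt_fwedge sβ sα
  have h1 : fd₂ (fd α) x e₁ e₂ e₃ = fd₂ (fun y a b => fwedge ν α y a b + fwedge α' β y a b)
      x e₁ e₂ e₃ :=
    fd₂_congr (by filter_upwards [h.nhds_mem hx] with y hy using hα y hy) _ _ _
  have h2 : fd₂ (fd α') x e₁ e₂ e₃ = fd₂ (fun y a b => fwedge ν α' y a b +
      I y * fwedge α' β y a b + ε * fwedge β α y a b) x e₁ e₂ e₃ :=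
    fd₂_congr (by filter_upwards [h.nhds_mem hx] with y hy using hα' y hy) _ _ _
  rw [fd₂_fd (h.smooth_α x hx), fd₂_add k1 k3, fd₂_fwedge sν sα, fd₂_fwedge sα' sβ] at h1
  rw [fd₂_fd (h.smooth_α' x hx), fd₂_add (T := fun y a b => fwedge ν α' y a b +
      I y * fwedge α' β y a b) (S := fun y a b => ε * fwedge β α y a b)
      (fun a b => (k2 a b).add (sI.mul (k3 a b))) (fun a b => (k4 a b).const_mul ε),
    fd₂_add (S := fun y a b => I y * fwedge α' β y a b) k2 (fun a b => sI.mul (k3 a b)), fd₂_smul sI k3,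
    fd₂_smul (f := fun _ => ε) (differentiableAt_const _) k4, fd₂_fwedge sν sα',
    fd₂_fwedge sα' sβ, fd₂_fwedge sβ sα] at h2
  simp only [hα x hx, hα' x hx, h.dβ hx, h.dI x hx, fwedge, he.a₁, he.a₂, he.a₃, he.b₁, he.b₂,
    he.b₃, he.c₁, he.c₂, he.c₃, smul_apply, smul_eq_mul, fderiv_const_apply, zero_apply] at h1 h2
  have h3 : fd ν x e₂ e₃ = 0 := by linear_combination -h1
  have h4 : fd ν x e₃ e₁ = 0 := by linear_combination -h2
  refine ⟨fd ν x e₁ e₂, fun u v => ?_⟩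
  rw [he.fd_apply, h3, h4]
  ring

end BalancedCoframe

end Flat

/-! ### Infinitesimal symmetries as solutions of a total differential system. -/

section Flat

variable {E : Type*} [NormedAddCommGroup E] [NormedSpace ℝ E]
variable {V : Set E} {ε : ℝ} {α α' β ν : E → E →L[ℝ] ℝ} {I J Λ : E → ℝ}

lemma ConnectionForm.smooth_Λ (hc : ConnectionForm V ε α α' β I ν Λ)
    (h : BalancedCoframe V ε α α' β I J) {x : E} (hx : x ∈ V) : ContDiffAt ℝ ∞ Λ x := by
  obtain ⟨e₁, e₂, e₃, he, -⟩ := h.frame x hx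
  have h1 := h.smooth_α x hx
  have h2 := h.smooth_α' x hx
  refine contDiffAt_of_mul_eq (d := fun y => α y e₁ * α' y e₂ - α y e₂ * α' y e₁) (by fun_prop)
    (contDiffAt_fd (hc.smooth x hx) e₁ e₂) (by simp [he.a₁, he.a₂, he.b₁, he.b₂]) ?_
  filter_upwards [h.nhds_mem hx] with y hy using (hc.dν y hy e₁ e₂).symm

/-- The linear total differential system satisfied by the components `a = α(Y)`, `b = α'(Y)` of an
infinitesimal symmetry `Y`. -/
structure SymmetrySystem (V : Set E) (ε : ℝ) (α α' β : E → E →L[ℝ] ℝ) (I : E → ℝ)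
    (ν : E → E →L[ℝ] ℝ) (Λ : E → ℝ) (a b κ : E → ℝ) : Prop where
  smooth_a : ∀ x ∈ V, ContDiffAt ℝ ∞ a x
  smooth_b : ∀ x ∈ V, ContDiffAt ℝ ∞ b x
  smooth_κ : ∀ x ∈ V, ContDiffAt ℝ ∞ κ x
  da : ∀ x ∈ V, fderiv ℝ a x = κ x • α x + a x • ν x - b x • β x
  db : ∀ x ∈ V, fderiv ℝ b x = κ x • α' x + b x • ν x - (I x * b x - ε * a x) • β x
  dκ : ∀ x ∈ V, fderiv ℝ κ x = (Λ x * a x) • α' x - (Λ x * b x) • α x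

/-- Cartan's formula d(i_Y θ) = L_Y θ - i_Y dθ, the Lie derivative being written out in coordinates.
-/
lemma fderiv_clm_apply_eq {θ : E → E →L[ℝ] ℝ} {Y : E → E} {x : E} (hθ : DifferentiableAt ℝ θ x)
    (hY : DifferentiableAt ℝ Y x) (v : E) : fderiv ℝ (fun y => θ y (Y y)) x v =
      fderiv ℝ θ x (Y x) v + θ x (fderiv ℝ Y x v) - fd θ x (Y x) v := by
  rw [fderiv_clm_apply hθ hY, fd]
  simp only [add_apply, ContinuousLinearMap.comp_apply, ContinuousLinearMap.flip_apply]
  ring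

/-- The differential of the component `θ(Y)` if the flow of `Y` preserves `ker θ`. -/
lemma exists_fderiv_component {θ : E → E →L[ℝ] ℝ} {Y : E → E} {x e : E}
    (hθ : DifferentiableAt ℝ θ x) (hY : DifferentiableAt ℝ Y x) (he : θ x e = 1)
    (h : ∀ w, θ x w = 0 → fderiv ℝ θ x (Y x) w + θ x (fderiv ℝ Y x w) = 0) :
    ∃ k, ∀ v, fderiv ℝ (fun y => θ y (Y y)) x v = k * θ x v - fd θ x (Y x) v := by
  refine ⟨fderiv ℝ θ x (Y x) e + θ x (fderiv ℝ Y x e), fun v => ?_⟩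
  have := h (v - θ x v • e) (by simp [he])
  rw [fderiv_clm_apply_eq hθ hY]
  simp only [map_sub, map_smul, smul_eq_mul] at this
  linear_combination this

/-- Cartan's formula gives da and db with two unknown multipliers κ, κ' and extra terms in c = β(Y).
The conditions d(da) = d(db) = 0, read on the dual frame, identify κ with κ', kill c, and yield dκ.
Geometrically c = 0 because a symmetry preserves the invariant I, while Y(I) = Jc. -/
lemma FlatSymmetry.exists_system {Y : E → E} (h : BalancedCoframe V ε α α' β I J)
    (hc : ConnectionForm V ε α α' β I ν Λ) (hY : FlatSymmetry V α α' Y) :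
    (∀ x ∈ V, β x (Y x) = 0) ∧ ∃ κ : E → ℝ,
      SymmetrySystem V ε α α' β I ν Λ (fun x => α x (Y x)) (fun x => α' x (Y x)) κ := by
  set a : E → ℝ := fun x => α x (Y x) with ha
  set b : E → ℝ := fun x => α' x (Y x) with hb
  set c : E → ℝ := fun x => β x (Y x) with hcdef
  have sa : ∀ x ∈ V, ContDiffAt ℝ ∞ a x := fun x hx => (h.smooth_α x hx).clm_apply (hY.smooth x hx)
  have sb : ∀ x ∈ V, ContDiffAt ℝ ∞ b x := fun x hx => (h.smooth_α' x hx).clm_apply (hY.smooth x hx)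
  have sc : ∀ x ∈ V, ContDiffAt ℝ ∞ c x := fun x hx => (h.smooth_β x hx).clm_apply (hY.smooth x hx)
  have e1 : ∀ x, ∃ k : ℝ, x ∈ V → fderiv ℝ a x =
      k • α x + a x • ν x - b x • β x + c x • α' x := by
    intro x
    by_cases hx : x ∈ V
    · obtain ⟨e₁, e₂, e₃, he, -⟩ := h.frame x hx
      obtain ⟨k, hk⟩ := exists_fderiv_component (h.smooth_α x hx).diff (hY.smooth x hx).diff he.a₁
        (hY.lie x hx)
      refine ⟨k - ν x (Y x), fun _ => ?_⟩
      ext v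
      rw [hk, hc.dα x hx]
      simp only [add_apply, sub_apply, smul_apply, smul_eq_mul, a, b, c]
      ring
    · exact ⟨0, fun h => absurd h hx⟩
  have e2 : ∀ x, ∃ k : ℝ, x ∈ V → fderiv ℝ b x =
      k • α' x + b x • ν x - (I x * b x - ε * a x) • β x + (c x * I x) • α' x - (c x * ε) • α x := by
    intro x
    by_cases hx : x ∈ V
    · obtain ⟨e₁, e₂, e₃, he, -⟩ := h.frame x hx
      obtain ⟨k, hk⟩ := exists_fderiv_component (h.smooth_α' x hx).diff (hY.smooth x hx).diff he.b₂
        (hY.lie' x hx)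
      refine ⟨k - ν x (Y x), fun _ => ?_⟩
      ext v
      rw [hk, hc.dα' x hx]
      simp only [add_apply, sub_apply, smul_apply, smul_eq_mul, a, b, c]
      ring
    · exact ⟨0, fun h => absurd h hx⟩
  choose κ hκ using e1
  choose κ' hκ' using e2
  have sκ : ∀ x ∈ V, ContDiffAt ℝ ∞ κ x := by
    intro x hx
    obtain ⟨e₁, e₂, e₃, he, -⟩ := h.frame x hx
    have h1 := h.smooth_α x hx
    have h2 := h.smooth_α' x hx
    have h3 := h.smooth_β x hx
    have h4 := hc.smooth x hx
    have h5 := sa x hx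
    have h6 := sb x hx
    have h7 := sc x hx
    have h8 : ContDiffAt ℝ ∞ (fderiv ℝ a) x := h5.fderiv_right (by simp)
    refine contDiffAt_of_mul_eq (d := fun y => α y e₁)
      (g := fun y => fderiv ℝ a y e₁ - (a y * ν y e₁ - b y * β y e₁ + c y * α' y e₁)) (by fun_prop)
      (by fun_prop) (by simp [he.a₁]) ?_
    filter_upwards [h.nhds_mem hx] with y hy
    rw [hκ y hy]
    simp only [add_apply, sub_apply, smul_apply, smul_eq_mul]
    ring
  have sκ' : ∀ x ∈ V, ContDiffAt ℝ ∞ κ' x := by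
    intro x hx
    obtain ⟨e₁, e₂, e₃, he, -⟩ := h.frame x hx
    have h1 := h.smooth_α x hx
    have h2 := h.smooth_α' x hx
    have h3 := h.smooth_β x hx
    have h4 := hc.smooth x hx
    have h5 := sa x hx
    have h6 := sb x hx
    have h7 := sc x hx
    have h9 := h.smooth_I x hx
    have h8 : ContDiffAt ℝ ∞ (fderiv ℝ b) x := h6.fderiv_right (by simp)
    refine contDiffAt_of_mul_eq (d := fun y => α' y e₂)
      (g := fun y => fderiv ℝ b y e₂ - (b y * ν y e₂ - (I y * b y - ε * a y) * β y e₂ +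
        (c y * I y) * α' y e₂ - (c y * ε) * α y e₂)) (by fun_prop)
      (by fun_prop) (by simp [he.b₂]) ?_
    filter_upwards [h.nhds_mem hx] with y hy
    rw [hκ' y hy]
    simp only [add_apply, sub_apply, smul_apply, smul_eq_mul]
    ring
  have key : ∀ x ∈ V, ∃ e₁ e₂ e₃, IsDualFrame (α x) (α' x) (β x) e₁ e₂ e₃ ∧ κ x = κ' x ∧
      fderiv ℝ c x e₃ = 0 ∧ fderiv ℝ κ x e₂ = a x * Λ x + fderiv ℝ c x e₁ ∧
      fderiv ℝ κ x e₃ = 0 ∧ c x * J x + I x * fderiv ℝ c x e₃ + fderiv ℝ κ' x e₃ = 0 ∧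
      b x * Λ x + I x * fderiv ℝ c x e₁ + ε * fderiv ℝ c x e₂ + fderiv ℝ κ' x e₁ = 0 := by
    intro x hx
    obtain ⟨e₁, e₂, e₃, he, -⟩ := h.frame x hx
    have tα := (h.smooth_α x hx).diff
    have tα' := (h.smooth_α' x hx).diff
    have tβ := (h.smooth_β x hx).diff
    have tν := (hc.smooth x hx).diff
    have tI := (h.smooth_I x hx).diff
    have ta := (sa x hx).diff
    have tb := (sb x hx).diff
    have tc := (sc x hx).diff
    have tκ := (sκ x hx).diff
    have tκ' := (sκ' x hx).diff
    have q1 : ∀ u v, fd (fun y => κ y • α y + a y • ν y - b y • β y + c y • α' y) x u v = 0 :=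
      fd_fderiv_eq_zero (sa x hx)
        (by filter_upwards [h.nhds_mem hx] with y hy using hκ y hy)
    have q2 : ∀ u v, fd (fun y => κ' y • α' y + b y • ν y - (I y * b y - ε * a y) • β y +
        (c y * I y) • α' y - (c y * ε) • α y) x u v = 0 :=
      fd_fderiv_eq_zero (sb x hx)
        (by filter_upwards [h.nhds_mem hx] with y hy using hκ' y hy)
    have dI := h.dI x hx
    have q1' : ∀ u v, fd (fun y => κ y • α y + a y • ν y - b y • β y + c y • α' y) x u v =
        fderiv ℝ κ x u * α x v - fderiv ℝ κ x v * α x u + κ x * fd α x u v +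
        (fderiv ℝ a x u * ν x v - fderiv ℝ a x v * ν x u + a x * fd ν x u v) -
        (fderiv ℝ b x u * β x v - fderiv ℝ b x v * β x u + b x * fd β x u v) +
        (fderiv ℝ c x u * α' x v - fderiv ℝ c x v * α' x u + c x * fd α' x u v) := by
      intro u v
      rw [fd_add (by fun_prop) (by fun_prop), fd_sub (by fun_prop) (by fun_prop),
        fd_add (by fun_prop) (by fun_prop), fd_smul tκ tα, fd_smul ta tν, fd_smul tb tβ,
        fd_smul tc tα']
    have d1 : ∀ u, fderiv ℝ (fun y => I y * b y - ε * a y) x u =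
        fderiv ℝ I x u * b x + I x * fderiv ℝ b x u - ε * fderiv ℝ a x u := by
      intro u
      rw [fderiv_fun_sub (by fun_prop) (by fun_prop), fderiv_fun_mul tI tb,
        fderiv_const_mul ta]
      simp only [sub_apply, add_apply, smul_apply, smul_eq_mul]
      ring
    have d2 : ∀ u, fderiv ℝ (fun y => c y * I y) x u =
        fderiv ℝ c x u * I x + c x * fderiv ℝ I x u := by
      intro u
      rw [fderiv_fun_mul tc tI]
      simp only [add_apply, smul_apply, smul_eq_mul]
      ring
    have d3 : ∀ u, fderiv ℝ (fun y => c y * ε) x u = fderiv ℝ c x u * ε := by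
      intro u
      rw [fderiv_mul_const tc]
      simp only [smul_apply, smul_eq_mul]
      ring
    have q2' : ∀ u v, fd (fun y => κ' y • α' y + b y • ν y - (I y * b y - ε * a y) • β y +
        (c y * I y) • α' y - (c y * ε) • α y) x u v =
        fderiv ℝ κ' x u * α' x v - fderiv ℝ κ' x v * α' x u + κ' x * fd α' x u v +
        (fderiv ℝ b x u * ν x v - fderiv ℝ b x v * ν x u + b x * fd ν x u v) -
        ((fderiv ℝ I x u * b x + I x * fderiv ℝ b x u - ε * fderiv ℝ a x u) * β x v -
          (fderiv ℝ I x v * b x + I x * fderiv ℝ b x v - ε * fderiv ℝ a x v) * β x u +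
          (I x * b x - ε * a x) * fd β x u v) +
        ((fderiv ℝ c x u * I x + c x * fderiv ℝ I x u) * α' x v -
          (fderiv ℝ c x v * I x + c x * fderiv ℝ I x v) * α' x u + (c x * I x) * fd α' x u v) -
        (fderiv ℝ c x u * ε * α x v - fderiv ℝ c x v * ε * α x u + (c x * ε) * fd α x u v) := by
      intro u v
      rw [fd_sub (by fun_prop) (by fun_prop), fd_add (by fun_prop) (by fun_prop),
        fd_sub (by fun_prop) (by fun_prop),
        fd_add (by fun_prop) (by fun_prop), fd_smul tκ' tα', fd_smul tb tν,
        fd_smul (f := fun y => I y * b y - ε * a y) (by fun_prop) tβ,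
        fd_smul (f := fun y => c y * I y) (by fun_prop) tα',
        fd_smul (f := fun y => c y * ε) (by fun_prop) tα, d1, d1, d2, d2, d3, d3]
    have r1 := fun u v => (q1' u v).symm.trans (q1 u v)
    have r2 := fun u v => (q2' u v).symm.trans (q2 u v)
    clear q1 q2 q1' q2' d1 d2 d3
    have m12 := r1 e₁ e₂
    have m23 := r1 e₂ e₃
    have m31 := r1 e₃ e₁
    have n12 := r2 e₁ e₂
    have n23 := r2 e₂ e₃
    have n31 := r2 e₃ e₁
    simp only [hc.dα x hx, hc.dα' x hx, hc.dν x hx, h.dβ hx, hκ x hx, hκ' x hx, dI, add_apply,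
      sub_apply, smul_apply, smul_eq_mul, he.a₁, he.a₂, he.a₃, he.b₁, he.b₂, he.b₃, he.c₁, he.c₂,
      he.c₃] at m12 m23 m31 n12 n23 n31
    -- Both coefficients compare κ with κ' up to a multiple of the derivative of c along the axis;
    -- combining them separates the two and makes each vanish.
    have z1 : ε * fderiv ℝ c x e₃ = 0 := by linear_combination -(1 / 2) * n31 - ε / 2 * m23
    have z2 : fderiv ℝ c x e₃ = 0 := (mul_eq_zero.1 z1).resolve_left h.sign
    refine ⟨e₁, e₂, e₃, he, by linear_combination m23 + z2, z2, by linear_combination -m12,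
      by linear_combination m31, by linear_combination -n23, by linear_combination n12⟩
  have hκκ' : ∀ x ∈ V, fderiv ℝ κ x = fderiv ℝ κ' x := by
    intro x hx
    refine Filter.EventuallyEq.fderiv_eq ?_
    filter_upwards [h.nhds_mem hx] with y hy
    obtain ⟨e₁, e₂, e₃, -, h1, -⟩ := key y hy
    exact h1
  -- Since κ = κ' on an open set, their derivatives agree as well; the derivative of κ along the
  -- axis is zero, so the corresponding equation for κ' reduces to cJ = 0.
  have hc0 : ∀ x ∈ V, c x = 0 := by
    intro x hx
    obtain ⟨e₁, e₂, e₃, he, h1, h2, h3, h4, h5, h6⟩ := key x hx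
    rw [← hκκ' x hx, h2, h4] at h5
    have : c x * J x = 0 := by linear_combination h5
    exact (mul_eq_zero.1 this).resolve_right (h.J_ne x hx)
  refine ⟨hc0, κ, sa, sb, sκ, fun x hx => ?_, fun x hx => ?_, fun x hx => ?_⟩
  · rw [hκ x hx, hc0 x hx, zero_smul, add_zero]
  · obtain ⟨e₁, e₂, e₃, he, h1, -⟩ := key x hx
    rw [hκ' x hx, hc0 x hx, h1]
    simp
  · obtain ⟨e₁, e₂, e₃, he, h1, h2, h3, h4, h5, h6⟩ := key x hx
    have hdc : fderiv ℝ c x = 0 := by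
      have : c =ᶠ[𝓝 x] fun _ => 0 := by
        filter_upwards [h.nhds_mem hx] with y hy using hc0 y hy
      rw [this.fderiv_eq, fderiv_const_apply]
    rw [← hκκ' x hx] at h6
    simp only [hdc, zero_apply, mul_zero, add_zero] at h3 h6
    refine he.ext ?_ ?_ ?_ <;>
      simp only [sub_apply, smul_apply, smul_eq_mul, he.a₁, he.a₂, he.a₃, he.b₁, he.b₂, he.b₃]
    · linear_combination h6
    · linear_combination h3
    · linear_combination h4

/-- Grönwall's inequality along the segments issuing from x. It gives uniqueness for linear total
differential systems without any integrability assumption. -/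
lemma eventually_eq_zero_of_norm_fderiv_le {F : Type*} [NormedAddCommGroup F] [NormedSpace ℝ F]
    {f : E → F} {x : E} {K : ℝ}
    (h : ∀ᶠ y in 𝓝 x, DifferentiableAt ℝ f y ∧ ‖fderiv ℝ f y‖ ≤ K * ‖f y‖) (h0 : f x = 0) :
    ∀ᶠ y in 𝓝 x, f y = 0 := by
  obtain ⟨r, hr, hball⟩ := Metric.eventually_nhds_iff_ball.1 h
  filter_upwards [Metric.ball_mem_nhds x hr] with y hy
  have hmem : ∀ t ∈ Icc (0 : ℝ) 1, x + t • (y - x) ∈ Metric.ball x r := fun t ht =>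
    (convex_ball x r).add_smul_sub_mem (Metric.mem_ball_self hr) hy ht
  have hl : ∀ t : ℝ, HasDerivAt (fun t : ℝ => x + t • (y - x)) (y - x) t := fun t => by
    have := ((hasDerivAt_id t).smul_const (y - x)).const_add x
    rwa [one_smul] at this
  have hd : ∀ t ∈ Icc (0 : ℝ) 1, HasDerivAt (fun t : ℝ => f (x + t • (y - x)))
      (fderiv ℝ f (x + t • (y - x)) (y - x)) t := fun t ht =>
    (hball _ (hmem t ht)).1.hasFDerivAt.comp_hasDerivAt t (hl t)
  have := eq_zero_of_abs_deriv_le_mul_abs_self_of_eq_zero_right (a := 0) (b := 1)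
    (f := fun t : ℝ => f (x + t • (y - x))) (K := K * ‖y - x‖)
    (fun t ht => (hd t ht).continuousAt.continuousWithinAt)
    (fun t ht => (hd t (Ico_subset_Icc_self ht)).hasDerivWithinAt) (by simpa using h0) ?_ 1 (by simp)
  · simpa using this
  · intro t ht
    calc _ ≤ ‖fderiv ℝ f (x + t • (y - x))‖ * ‖y - x‖ := ContinuousLinearMap.le_opNorm _ _
      _ ≤ (K * ‖f (x + t • (y - x))‖) * ‖y - x‖ := by
        gcongr; exact (hball _ (hmem t (Ico_subset_Icc_self ht))).2
      _ = _ := by ring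

/-- The vector field of a solution that vanishes at a point vanishes near that point. -/
lemma SymmetrySystem.eventually_eq_zero {a b κ : E → ℝ} (h : BalancedCoframe V ε α α' β I J)
    (hc : ConnectionForm V ε α α' β I ν Λ) (hs : SymmetrySystem V ε α α' β I ν Λ a b κ) {x : E}
    (hx : x ∈ V) (ha : a x = 0) (hb : b x = 0) (hκ : κ x = 0) :
    ∀ᶠ y in 𝓝 x, a y = 0 ∧ b y = 0 := by
  have bdd : ∀ {G : Type _} [NormedAddCommGroup G] {g : E → G}, ContinuousAt g x →
      ∀ᶠ y in 𝓝 x, ‖g y‖ ≤ ‖g x‖ + 1 := fun hg => by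
    filter_upwards [hg.norm.eventually_lt_const (lt_add_one _)] with y hy using hy.le
  have bddR : ∀ {g : E → ℝ}, ContinuousAt g x → ∀ᶠ y in 𝓝 x, ‖g y‖ ≤ ‖g x‖ + 1 := fun hg => by
    filter_upwards [hg.norm.eventually_lt_const (lt_add_one _)] with y hy using hy.le
  set A := ‖α x‖ + 1
  set A' := ‖α' x‖ + 1
  set B := ‖β x‖ + 1
  set N := ‖ν x‖ + 1
  set C := ‖I x‖ + 1
  set L := ‖Λ x‖ + 1
  set f : E → ℝ × ℝ × ℝ := fun y => (a y, b y, κ y) with hf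
  have key : ∀ᶠ y in 𝓝 x, f y = 0 := by
    refine eventually_eq_zero_of_norm_fderiv_le
      (K := A + A' + 2 * N + B + (C + ‖ε‖) * B + L * A' + L * A) ?_ (by simp [hf, ha, hb, hκ])
    filter_upwards [h.nhds_mem hx, bdd (h.smooth_α x hx).continuousAt,
      bdd (h.smooth_α' x hx).continuousAt, bdd (h.smooth_β x hx).continuousAt,
      bdd (hc.smooth x hx).continuousAt, bddR (h.smooth_I x hx).continuousAt,
      bddR (hc.smooth_Λ h hx).continuousAt] with y hy h1 h2 h3 h4 h5 h6
    have da := (hs.smooth_a y hy).diff.hasFDerivAt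
    have db := (hs.smooth_b y hy).diff.hasFDerivAt
    have dκ := (hs.smooth_κ y hy).diff.hasFDerivAt
    have df : HasFDerivAt f _ y := da.prodMk (db.prodMk dκ)
    refine ⟨df.differentiableAt, ?_⟩
    have na : ‖a y‖ ≤ ‖f y‖ := norm_fst_le (f y)
    have nbκ : ‖(f y).2‖ ≤ ‖f y‖ := norm_snd_le (f y)
    have nb : ‖b y‖ ≤ ‖f y‖ := (norm_fst_le (f y).2).trans nbκ
    have nκ : ‖κ y‖ ≤ ‖f y‖ := (norm_snd_le (f y).2).trans nbκ
    rw [df.fderiv, ContinuousLinearMap.opNorm_prod, Prod.norm_def, ContinuousLinearMap.opNorm_prod,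
      Prod.norm_def, hs.da y hy, hs.db y hy, hs.dκ y hy]
    have nn := norm_nonneg (f y)
    have pA : 0 ≤ A := by positivity
    have pA' : 0 ≤ A' := by positivity
    have pB : 0 ≤ B := by positivity
    have pN : 0 ≤ N := by positivity
    have pC : 0 ≤ C := by positivity
    have pL : 0 ≤ L := by positivity
    have pε : 0 ≤ ‖ε‖ := norm_nonneg _
    refine max_le ?_ (max_le ?_ ?_)
    · calc ‖κ y • α y + a y • ν y - b y • β y‖ ≤ ‖κ y‖ * ‖α y‖ + ‖a y‖ * ‖ν y‖ + ‖b y‖ * ‖β y‖ := by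
            refine (norm_sub_le _ _).trans (add_le_add ((norm_add_le _ _).trans ?_) ?_) <;>
              simp only [norm_smul, le_refl]
        _ ≤ ‖f y‖ * A + ‖f y‖ * N + ‖f y‖ * B := by gcongr
        _ = (A + N + B) * ‖f y‖ := by ring
        _ ≤ _ := by
          have : 0 ≤ (C + ‖ε‖) * B + L * A' + L * A + A' + N := by positivity
          exact mul_le_mul_of_nonneg_right (by linarith) nn
    · calc ‖κ y • α' y + b y • ν y - (I y * b y - ε * a y) • β y‖ ≤
            ‖κ y‖ * ‖α' y‖ + ‖b y‖ * ‖ν y‖ + (‖I y‖ * ‖b y‖ + ‖ε‖ * ‖a y‖) * ‖β y‖ := by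
            refine (norm_sub_le _ _).trans (add_le_add ((norm_add_le _ _).trans ?_) ?_)
            · simp only [norm_smul, le_refl]
            · rw [norm_smul]
              gcongr
              refine (norm_sub_le _ _).trans ?_
              simp only [norm_mul, le_refl]
        _ ≤ ‖f y‖ * A' + ‖f y‖ * N + (C * ‖f y‖ + ‖ε‖ * ‖f y‖) * B := by gcongr
        _ = (A' + N + (C + ‖ε‖) * B) * ‖f y‖ := by ring
        _ ≤ _ := by
          have : 0 ≤ B + L * A' + L * A + A + N := by positivity
          exact mul_le_mul_of_nonneg_right (by linarith) nn
    · calc ‖(Λ y * a y) • α' y - (Λ y * b y) • α y‖ ≤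
            ‖Λ y‖ * ‖a y‖ * ‖α' y‖ + ‖Λ y‖ * ‖b y‖ * ‖α y‖ := by
            refine (norm_sub_le _ _).trans (add_le_add ?_ ?_) <;>
              simp only [norm_smul, norm_mul, le_refl]
        _ ≤ L * ‖f y‖ * A' + L * ‖f y‖ * A := by gcongr
        _ = (L * A' + L * A) * ‖f y‖ := by ring
        _ ≤ _ := by
          have : 0 ≤ A + A' + 2 * N + B + (C + ‖ε‖) * B := by positivity
          exact mul_le_mul_of_nonneg_right (by linarith) nn
  filter_upwards [key] with y hy
  exact ⟨congrArg (fun z => z.1) hy, congrArg (fun z => z.2.1) hy⟩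

/-- The integrability condition of the symmetry system. -/
lemma SymmetrySystem.integrability {a b κ : E → ℝ} (h : BalancedCoframe V ε α α' β I J)
    (hc : ConnectionForm V ε α α' β I ν Λ) (hs : SymmetrySystem V ε α α' β I ν Λ a b κ) {x : E}
    (hx : x ∈ V) (u v : E) :
    (fderiv ℝ Λ x u + 2 * Λ x * ν x u - I x * Λ x * β x u) * (a x * α' x v - b x * α x v) -
      (fderiv ℝ Λ x v + 2 * Λ x * ν x v - I x * Λ x * β x v) * (a x * α' x u - b x * α x u) =
      - 2 * Λ x * κ x * (α x u * α' x v - α x v * α' x u) := by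
  have tα := (h.smooth_α x hx).diff
  have tα' := (h.smooth_α' x hx).diff
  have ta := (hs.smooth_a x hx).diff
  have tb := (hs.smooth_b x hx).diff
  have tΛ := (hc.smooth_Λ h hx).diff
  -- The right-hand side of the equation for dκ is closed; substituting da, db, dα, dα' turns this
  -- into a condition on dΛ.
  have q : fd (fun y => (Λ y * a y) • α' y - (Λ y * b y) • α y) x u v = 0 :=
    fd_fderiv_eq_zero (hs.smooth_κ x hx)
      (by filter_upwards [h.nhds_mem hx] with y hy using hs.dκ y hy) u v
  rw [fd_sub (by fun_prop) (by fun_prop), fd_smul (f := fun y => Λ y * a y) (by fun_prop) tα',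
    fd_smul (f := fun y => Λ y * b y) (by fun_prop) tα, fderiv_fun_mul tΛ ta,
    fderiv_fun_mul tΛ tb, hs.da x hx, hs.db x hx, hc.dα x hx, hc.dα' x hx] at q
  simp only [add_apply, sub_apply, smul_apply, smul_eq_mul] at q
  linear_combination q

end Flat

/-! ### Building coordinates from functions. -/

section Coordinates

lemma contDiffAt_toE3 {f : Fin 3 → E3 → ℝ} {y : E3} (hf : ∀ i, ContDiffAt ℝ ∞ (f i) y) :
    ContDiffAt ℝ ∞ (fun z => (WithLp.toLp 2 (fun i => f i z) : E3)) y := by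
  rw [contDiffAt_piLp]
  exact hf

lemma fderiv_toE3_apply {f : Fin 3 → E3 → ℝ} {y : E3} (hf : ∀ i, DifferentiableAt ℝ (f i) y)
    (v : E3) (i : Fin 3) :
    fderiv ℝ (fun z => (WithLp.toLp 2 (fun i => f i z) : E3)) y v i = fderiv ℝ (f i) y v := by
  have h1 : DifferentiableAt ℝ (fun z => (WithLp.toLp 2 (fun i => f i z) : E3)) y :=
    (differentiableAt_piLp 2).2 hf
  have h2 := (EuclideanSpace.proj (𝕜 := ℝ) i).hasFDerivAt.comp y h1.hasFDerivAt
  have h3 : f i = (EuclideanSpace.proj (𝕜 := ℝ) i) ∘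
      (fun z => (WithLp.toLp 2 (fun i => f i z) : E3)) := by
    ext z; simp
  rw [h3, h2.fderiv]
  simp

/-- Three smooth functions with independent differentials are coordinates. -/
lemma exists_chart {f : Fin 3 → E3 → ℝ} {m : E3} {S : Set E3} (hS : S ∈ 𝓝 m)
    (hf : ∀ i, ∀ᶠ y in 𝓝 m, ContDiffAt ℝ ∞ (f i) y)
    (hinj : ∀ᶠ y in 𝓝 m, ∀ v, (∀ i, fderiv ℝ (f i) y v = 0) → v = 0) :
    ∃ (ψ : OpenPartialHomeomorph E3 E3) (r : ℝ), m ∈ ψ.source ∧ ψ.source ⊆ S ∧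
      ψ.target = Metric.ball (ψ m) r ∧ (∀ y i, ψ y i = f i y) ∧
      (∀ y ∈ ψ.source, ContDiffAt ℝ ∞ ψ y) ∧ (∀ z ∈ ψ.target, ContDiffAt ℝ ∞ ψ.symm z) := by
  set g : E3 → E3 := fun z => WithLp.toLp 2 (fun i => f i z) with hg
  obtain ⟨S', hS', hS'o, hmS'⟩ : ∃ S' ⊆ {y | y ∈ S ∧ (∀ i, ContDiffAt ℝ ∞ (f i) y) ∧
      ∀ v, (∀ i, fderiv ℝ (f i) y v = 0) → v = 0}, IsOpen S' ∧ m ∈ S' := by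
    rw [← mem_nhds_iff]
    filter_upwards [hS, eventually_all.2 hf, hinj] with y h1 h2 h3 using ⟨h1, h2, h3⟩
  have hgs : ∀ y ∈ S', ContDiffAt ℝ ∞ g y := fun y hy => contDiffAt_toE3 (hS' hy).2.1
  have hequiv : ∀ y ∈ S', ∃ L : E3 ≃L[ℝ] E3, HasFDerivAt g (L : E3 →L[ℝ] E3) y := by
    intro y hy
    have hi : Function.Injective (fderiv ℝ g y : E3 →ₗ[ℝ] E3) := by
      rw [← LinearMap.ker_eq_bot, LinearMap.ker_eq_bot']
      intro v hv
      refine (hS' hy).2.2 v fun i => ?_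
      rw [← fderiv_toE3_apply (fun i => ((hS' hy).2.1 i).diff)]
      exact congrArg (fun w : E3 => w i) hv
    refine ⟨(LinearEquiv.ofInjectiveEndo _ hi).toContinuousLinearEquiv, ?_⟩
    have h1 : ((LinearEquiv.ofInjectiveEndo _ hi).toContinuousLinearEquiv : E3 →L[ℝ] E3) =
        fderiv ℝ g y := by ext v : 1; rfl
    rw [h1]
    exact (hgs y hy).diff.hasFDerivAt
  obtain ⟨L, hL⟩ := hequiv m hmS'
  set ψ₀ := (hgs m hmS').toOpenPartialHomeomorph g hL (by simp) with hψ₀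
  have hm₀ : m ∈ ψ₀.source := (hgs m hmS').mem_toOpenPartialHomeomorph_source hL (by simp)
  have hψ₀g : ∀ y, ψ₀ y = g y := fun y =>
    congrFun ((hgs m hmS').toOpenPartialHomeomorph_coe hL (by simp)) y
  set ψ₁ := ψ₀.restrOpen S' hS'o with hψ₁
  have hm₁ : m ∈ ψ₁.source := ⟨hm₀, hmS'⟩
  obtain ⟨r, hr, hball⟩ := Metric.isOpen_iff.1 ψ₁.open_target _ (ψ₁.map_source hm₁)
  -- The image is shrunk to a ball so that the slices on which one coordinate is constant are
  -- convex; this is what lets a function be expressed through a single coordinate.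
  set ψ := (ψ₁.symm.restrOpen (Metric.ball (ψ₁ m) r) Metric.isOpen_ball).symm with hψ
  have hψg : ∀ y, ψ y = g y := hψ₀g
  have hsrc : ψ.source ⊆ S' := by
    intro y hy
    have : ψ y ∈ ψ.target := ψ.map_source hy
    have h2 : ψ.symm (ψ y) ∈ ψ₁.source := ψ₁.map_target this.1
    rw [ψ.left_inv hy] at h2
    exact h2.2
  have hmψ : m ∈ ψ.source := by
    have : ψ₁ m ∈ ψ.target := ⟨ψ₁.map_source hm₁, Metric.mem_ball_self hr⟩
    have h2 : ψ.symm (ψ₁ m) ∈ ψ.source := ψ.map_target this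
    have h3 : ψ.symm (ψ₁ m) = m := ψ₁.left_inv hm₁
    rwa [h3] at h2
  refine ⟨ψ, r, hmψ, fun y hy => (hS' (hsrc hy)).1, ?_, fun y i => ?_, fun y hy => ?_,
    fun z hz => ?_⟩
  · exact Set.inter_eq_right.2 hball
  · rw [hψg]
  · exact (hgs y (hsrc hy)).congr_of_eventuallyEq (.of_forall hψg)
  · have hy := hsrc (ψ.map_target hz)
    obtain ⟨L', hL'⟩ := hequiv _ hy
    exact ψ.contDiffAt_symm hz (hL'.congr_of_eventuallyEq (.of_forall hψg))
      ((hgs _ hy).congr_of_eventuallyEq (.of_forall hψg))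

/-- A function whose differential is proportional to that of a coordinate is a function of this
coordinate. -/
lemma exists_comp_coordinate {f : Fin 3 → E3 → ℝ} {m : E3} {ψ : OpenPartialHomeomorph E3 E3}
    {r : ℝ} (hm : m ∈ ψ.source) (ht : ψ.target = Metric.ball (ψ m) r)
    (hψf : ∀ y i, ψ y i = f i y) (hψ : ∀ y ∈ ψ.source, ContDiffAt ℝ ∞ ψ y)
    (hψ' : ∀ z ∈ ψ.target, ContDiffAt ℝ ∞ ψ.symm z) {g : E3 → ℝ}
    (hg : ∀ y ∈ ψ.source, ContDiffAt ℝ ∞ g y) (i : Fin 3)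
    (hgi : ∀ y ∈ ψ.source, ∃ n : ℝ, fderiv ℝ g y = n • fderiv ℝ (f i) y) :
    ∃ a : ℝ → ℝ, ∀ y ∈ ψ.source, g y = a (f i y) ∧ ContDiffAt ℝ ∞ a (f i y) := by
  have hr : 0 < r := by
    have := ψ.map_source hm
    rw [ht] at this
    exact Metric.pos_of_mem_ball this
  set c := ψ m with hc
  -- The line through the centre parallel to the i-th axis. For z in the ball, l(z i) is also in the
  -- ball, and on the segment joining them the i-th coordinate is fixed, so g is constant there.
  set l : ℝ → E3 := fun t => c + (t - c i) • EuclideanSpace.single i (1 : ℝ) with hl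
  have hli : ∀ t, l t i = t := fun t => by simp [hl]
  have hlb : ∀ z ∈ ψ.target, l (z i) ∈ ψ.target := by
    intro z hz
    rw [ht, Metric.mem_ball, dist_eq_norm] at hz ⊢
    refine lt_of_le_of_lt ?_ hz
    have h1 : l (z i) - c = (z i - c i) • EuclideanSpace.single i (1 : ℝ) := by simp [hl]
    rw [h1, norm_smul, PiLp.norm_single, norm_one, mul_one]
    exact PiLp.norm_apply_le (z - c) i
  have hl' : ContDiff ℝ ∞ l := by fun_prop
  have hG : ∀ z ∈ ψ.target, ContDiffAt ℝ ∞ (g ∘ ψ.symm) z := fun z hz =>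
    (hg _ (ψ.map_target hz)).comp z (hψ' z hz)
  have hdG : ∀ z ∈ ψ.target, ∀ v : E3, v i = 0 → fderiv ℝ (g ∘ ψ.symm) z v = 0 := by
    intro z hz v hv
    have hy := ψ.map_target hz
    have h1 := (hg _ hy).diff.hasFDerivAt.comp z (hψ' z hz).diff.hasFDerivAt
    obtain ⟨n, hn⟩ := hgi _ hy
    rw [h1.fderiv, hn]
    have h2 : f i ∘ ψ.symm =ᶠ[𝓝 z] EuclideanSpace.proj (𝕜 := ℝ) i := by
      filter_upwards [ψ.open_target.mem_nhds hz] with w hw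
      simp only [Function.comp_apply, ← hψf, ψ.right_inv hw]
      rfl
    have h3 : DifferentiableAt ℝ (f i) (ψ.symm z) := by
      have : f i = fun y => ψ y i := by ext y; rw [hψf]
      rw [this]
      exact (differentiableAt_piLp 2).1 (hψ _ hy).diff i
    have h4 := (h3.hasFDerivAt.comp z (hψ' z hz).diff.hasFDerivAt).fderiv
    rw [h2.fderiv_eq, ContinuousLinearMap.fderiv] at h4
    have h5 := DFunLike.congr_fun h4 v
    have h6 : EuclideanSpace.proj (𝕜 := ℝ) i v = 0 := hv
    rw [h6, ContinuousLinearMap.comp_apply] at h5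
    simp only [ContinuousLinearMap.comp_apply, smul_apply, ← h5, smul_zero]
  refine ⟨g ∘ ψ.symm ∘ l, fun y hy => ?_⟩
  have hz := ψ.map_source hy
  rw [← hψf]
  refine ⟨?_, ((hG _ (hlb _ hz)).comp (ψ y i) hl'.contDiffAt :)⟩
  set z := ψ y with hzdef
  set w := l (z i) with hw
  have hseg : ∀ t ∈ Icc (0 : ℝ) 1, w + t • (z - w) ∈ ψ.target := fun t ht' => by
    have hw' := hlb z hz
    rw [ht] at hz hw' ⊢
    exact (convex_ball c r).add_smul_sub_mem hw' hz ht'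
  have hd : ∀ t ∈ Icc (0 : ℝ) 1, HasDerivAt (fun t : ℝ => (g ∘ ψ.symm) (w + t • (z - w))) 0 t := by
    intro t ht'
    have h1 : HasDerivAt (fun t : ℝ => w + t • (z - w)) (z - w) t := by
      have := ((hasDerivAt_id t).smul_const (z - w)).const_add w
      rwa [one_smul] at this
    have h2 := (hG _ (hseg t ht')).diff.hasFDerivAt.comp_hasDerivAt t h1
    rwa [hdG _ (hseg t ht') (z - w) (by simp [hw, hli])] at h2
  have hconst := constant_of_has_deriv_right_zero (a := 0) (b := 1)
    (f := fun t : ℝ => (g ∘ ψ.symm) (w + t • (z - w)))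
    (fun t ht' => (hd t ht').continuousAt.continuousWithinAt)
    (fun t ht' => (hd t (Ico_subset_Icc_self ht')).hasDerivWithinAt) 1 (by simp)
  simp only [one_smul, add_sub_cancel, zero_smul, add_zero] at hconst
  rw [Function.comp_apply, hzdef, ψ.left_inv hy] at hconst
  rw [hconst]
  rfl

end Coordinates

/-! ### Combinations gα + kα' whose differential is ν ∧ (gα + kα'). -/

section Flat

variable {E : Type*} [NormedAddCommGroup E] [NormedSpace ℝ E]
variable {V : Set E} {ε : ℝ} {α α' β ν : E → E →L[ℝ] ℝ} {I J Λ : E → ℝ}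

/-- Local form of the Poincaré lemma for 1-forms. -/
lemma exists_primitive {θ : E → E →L[ℝ] ℝ} {x : E}
    (h : ∀ᶠ y in 𝓝 x, ContDiffAt ℝ ∞ θ y ∧ ∀ u v, fd θ y u v = 0) :
    ∃ f : E → ℝ, ∀ᶠ y in 𝓝 x, ContDiffAt ℝ ∞ f y ∧ fderiv ℝ f y = θ y := by
  obtain ⟨r, hr, hball⟩ := Metric.eventually_nhds_iff_ball.1 h
  obtain ⟨f, hf⟩ := (convex_ball x r).exists_forall_hasFDerivAt_of_fderiv_symmetric
    Metric.isOpen_ball (fun y hy => (hball y hy).1.diff.differentiableWithinAt)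
    (fun y hy u v => sub_eq_zero.1 ((hball y hy).2 u v))
  have hs : ContDiffOn ℝ ∞ f (Metric.ball x r) := by
    rw [contDiffOn_infty_iff_fderiv_of_isOpen Metric.isOpen_ball]
    refine ⟨fun y hy => (hf y hy).differentiableAt.differentiableWithinAt, ?_⟩
    refine ContDiffOn.congr (fun y hy => (hball y hy).1.contDiffWithinAt) fun y hy => (hf y hy).fderiv
  refine ⟨f, ?_⟩
  filter_upwards [Metric.ball_mem_nhds x hr] with y hy
  exact ⟨hs.contDiffAt (Metric.isOpen_ball.mem_nhds hy), (hf y hy).fderiv⟩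

/-- The equations for rows, dg = -εkβ and dk = (g + Ik)β, in the variable s = I: there β = ds/F(s),
whence the division by F. -/
lemma exists_scalar_system (ε : ℝ) {F : ℝ → ℝ} {s₀ : ℝ} (hF : ∀ᶠ s in 𝓝 s₀, ContDiffAt ℝ ∞ F s)
    (hF0 : F s₀ ≠ 0) (g₀ k₀ : ℝ) : ∃ g k : ℝ → ℝ, g s₀ = g₀ ∧ k s₀ = k₀ ∧
      ∀ᶠ s in 𝓝 s₀, ContDiffAt ℝ ∞ g s ∧ ContDiffAt ℝ ∞ k s ∧
        HasDerivAt g (-ε * k s / F s) s ∧ HasDerivAt k ((g s + s * k s) / F s) s := by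
  -- The system is made autonomous by adjoining s as the first component, with derivative 1; `hfst`
  -- later identifies this component with the parameter.
  set v : ℝ × ℝ × ℝ → ℝ × ℝ × ℝ := fun z =>
    (1, -ε * z.2.2 / F z.1, (z.2.1 + z.1 * z.2.2) / F z.1) with hv
  have hvs : ∀ z : ℝ × ℝ × ℝ, ContDiffAt ℝ ∞ F z.1 → F z.1 ≠ 0 → ContDiffAt ℝ ∞ v z := by
    intro z h1 h2
    have h3 : ContDiffAt ℝ ∞ (fun z : ℝ × ℝ × ℝ => F z.1) z := h1.comp z contDiffAt_fst
    exact contDiffAt_const.prodMk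
      ((ContDiffAt.div (by fun_prop) h3 h2).prodMk (ContDiffAt.div (by fun_prop) h3 h2))
  obtain ⟨O, hO, hOo, hs₀⟩ : ∃ O ⊆ {s | ContDiffAt ℝ ∞ F s ∧ F s ≠ 0}, IsOpen O ∧ s₀ ∈ O := by
    rw [← mem_nhds_iff]
    filter_upwards [hF, hF.self_of_nhds.continuousAt.eventually_ne hF0] with s h1 h2 using ⟨h1, h2⟩
  set u : Set (ℝ × ℝ × ℝ) := Prod.fst ⁻¹' O with hu
  have huo : IsOpen u := hOo.preimage continuous_fst
  have hvu : ContDiffOn ℝ ∞ v u := fun z hz =>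
    (hvs z (hO hz).1 (hO hz).2).contDiffWithinAt
  obtain ⟨γ, hγ0, δ, hδ, hγ⟩ := ((hvs (s₀, g₀, k₀) (hO hs₀).1 (hO hs₀).2).of_le
    (by exact_mod_cast le_top) : ContDiffAt ℝ 1 v (s₀, g₀, k₀))
      |>.exists_forall_mem_closedBall_exists_eq_forall_mem_Ioo_hasDerivAt₀ s₀
  have hγc : ContinuousAt γ s₀ := (hγ s₀ (by constructor <;> linarith)).continuousAt
  have hγu : ∀ᶠ s in 𝓝 s₀, γ s ∈ u := hγc.eventually (huo.mem_nhds (by rw [hγ0]; exact hs₀))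
  obtain ⟨r, hr, hball⟩ := Metric.eventually_nhds_iff_ball.1
    (hγu.and (Ioo_mem_nhds (by linarith : s₀ - δ < s₀) (by linarith : s₀ < s₀ + δ)))
  set tmin := s₀ - r / 2 with htmin
  set tmax := s₀ + r / 2 with htmax
  have hI : ∀ s ∈ Icc tmin tmax, γ s ∈ u ∧ s ∈ Ioo (s₀ - δ) (s₀ + δ) := by
    intro s hs
    refine hball s ?_
    rw [Real.ball_eq_Ioo]
    exact ⟨by linarith [hs.1], by linarith [hs.2]⟩
  have hsm : ContDiffOn ℝ ∞ γ (Icc tmin tmax) := by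
    refine ODE.contDiffOn_enat_Icc_of_hasDerivWithinAt (n := ⊤) (f := fun _ => v) (u := u) ?_
      (fun s hs => (hγ s (hI s hs).2).hasDerivWithinAt) (fun s hs => (hI s hs).1)
    exact hvu.comp contDiffOn_snd (fun z hz => hz.2)
  have hfst : ∀ s ∈ Icc tmin tmax, (γ s).1 = s := by
    have hd : ∀ s ∈ Icc tmin tmax, HasDerivAt (fun s => (γ s).1 - s) 0 s := by
      intro s hs
      have h1 : HasDerivAt (fun s => (γ s).1) (v (γ s)).1 s :=
        (ContinuousLinearMap.fst ℝ ℝ (ℝ × ℝ)).hasFDerivAt.comp_hasDerivAt s (hγ s (hI s hs).2)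
      exact (h1.sub (hasDerivAt_id s)).congr_deriv (by simp [hv])
    have hc := constant_of_has_deriv_right_zero (a := tmin) (b := tmax)
      (f := fun s => (γ s).1 - s) (fun s hs => (hd s hs).continuousAt.continuousWithinAt)
      (fun s hs => (hd s (Ico_subset_Icc_self hs)).hasDerivWithinAt)
    intro s hs
    have h1 := hc s hs
    have h2 := hc s₀ ⟨by linarith, by linarith⟩
    have h3 : (γ s₀).1 = s₀ := by rw [hγ0]
    rw [← h2, h3] at h1
    linarith
  refine ⟨fun s => (γ s).2.1, fun s => (γ s).2.2, by simp [hγ0], by simp [hγ0], ?_⟩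
  filter_upwards [Ioo_mem_nhds (by linarith : tmin < s₀) (by linarith : s₀ < tmax)] with s hs
  have hs' := Ioo_subset_Icc_self hs
  have h1 : ContDiffAt ℝ ∞ γ s := hsm.contDiffAt (Icc_mem_nhds hs.1 hs.2)
  have h2 := hγ s (hI s hs').2
  have h3 := (ContinuousLinearMap.snd ℝ ℝ (ℝ × ℝ)).hasFDerivAt.comp_hasDerivAt s h2
  have h4 := (ContinuousLinearMap.fst ℝ ℝ ℝ).hasFDerivAt.comp_hasDerivAt s h3
  have h5 := (ContinuousLinearMap.snd ℝ ℝ ℝ).hasFDerivAt.comp_hasDerivAt s h3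
  refine ⟨h1.snd.fst, h1.snd.snd, ?_, ?_⟩
  · exact HasDerivAt.congr_deriv h4 (by simp [hv, hfst s hs'])
  · exact HasDerivAt.congr_deriv h5 (by simp [hv, hfst s hs'])

/-- `(g, k)` is a row of a solution matrix of the linear system along the axis: then
`g α + k α'` has differential `ν ∧ (g α + k α')` . -/
structure IsRowAt (ε : ℝ) (β : E → E →L[ℝ] ℝ) (I : E → ℝ) (g k : E → ℝ) (y : E) : Prop where
  smooth_g : ContDiffAt ℝ ∞ g y
  smooth_k : ContDiffAt ℝ ∞ k y
  dg : fderiv ℝ g y = (-ε * k y) • β y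
  dk : fderiv ℝ k y = (g y + I y * k y) • β y

lemma BalancedCoframe.exists_row [CompleteSpace E] (h : BalancedCoframe V ε α α' β I J) {x : E}
    (hx : x ∈ V) (g₀ k₀ : ℝ) : ∃ g k : E → ℝ, g x = g₀ ∧ k x = k₀ ∧
      ∀ᶠ y in 𝓝 x, IsRowAt ε β I g k y := by
  obtain ⟨F, hF⟩ := h.exists_contDiffAt_comp
  obtain ⟨e₁, e₂, e₃, he, -⟩ := h.frame x hx
  -- `I` is a submersion, so all real numbers close to I(x) are values of I at points of V, and F is
  -- smooth at each of them.
  have hmap : map I (𝓝 x) = 𝓝 (I x) := by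
    refine ((h.smooth_I x hx).hasStrictFDerivAt (by simp)).map_nhds_eq_of_surj ?_
    rw [LinearMap.range_eq_top]
    intro t
    refine ⟨(t / J x) • e₃, ?_⟩
    have := h.J_ne x hx
    simp [h.dI x hx, he.c₃, this]
  have hFs : ∀ᶠ s in 𝓝 (I x), ContDiffAt ℝ ∞ F s := by
    rw [← hmap, eventually_map]
    filter_upwards [h.nhds_mem hx] with y hy using (hF y hy).2
  have hF0 : F (I x) ≠ 0 := by rw [← (hF x hx).1]; exact h.J_ne x hx
  obtain ⟨g, k, hg, hk, hgk⟩ := exists_scalar_system ε hFs hF0 g₀ k₀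
  refine ⟨g ∘ I, k ∘ I, hg, hk, ?_⟩
  filter_upwards [h.nhds_mem hx, (h.smooth_I x hx).continuousAt.eventually hgk] with y hy hgky
  obtain ⟨h1, h2, h3, h4⟩ := hgky
  have h5 := (h.smooth_I y hy).diff.hasFDerivAt
  have h6 : F (I y) ≠ 0 := by rw [← (hF y hy).1]; exact h.J_ne y hy
  refine ⟨h1.comp y (h.smooth_I y hy), h2.comp y (h.smooth_I y hy), ?_, ?_⟩
  · rw [(h3.comp_hasFDerivAt y h5).fderiv, h.dI y hy, (hF y hy).1, smul_smul]
    congr 1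
    rw [div_mul_cancel₀ _ h6]; rfl
  · rw [(h4.comp_hasFDerivAt y h5).fderiv, h.dI y hy, (hF y hy).1, smul_smul]
    congr 1
    rw [div_mul_cancel₀ _ h6]; rfl

/-- A basis of rows of solutions, with prescribed second row at `x`. -/
lemma BalancedCoframe.exists_rows [CompleteSpace E] (h : BalancedCoframe V ε α α' β I J) {x : E}
    (hx : x ∈ V) {g₀ k₀ : ℝ} (hg₀ : g₀ ≠ 0) (hk₀ : k₀ ≠ 0) :
    ∃ gA kA gB kB : E → ℝ, gB x = g₀ ∧ kB x = k₀ ∧ ∀ᶠ y in 𝓝 x, y ∈ V ∧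
      IsRowAt ε β I gA kA y ∧ IsRowAt ε β I gB kB y ∧ gA y * kB y - kA y * gB y ≠ 0 ∧
      gB y ≠ 0 ∧ kB y ≠ 0 := by
  -- With first row (1, 0) the determinant at x is k₀, which is nonzero.
  obtain ⟨gA, kA, hgA, hkA, hA⟩ := h.exists_row hx 1 0
  obtain ⟨gB, kB, hgB, hkB, hB⟩ := h.exists_row hx g₀ k₀
  refine ⟨gA, kA, gB, kB, hgB, hkB, ?_⟩
  have hA' := hA.self_of_nhds
  have hB' := hB.self_of_nhds
  have c1 := hA'.smooth_g.continuousAt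
  have c2 := hA'.smooth_k.continuousAt
  have c3 := hB'.smooth_g.continuousAt
  have c4 := hB'.smooth_k.continuousAt
  have c5 : ContinuousAt (fun y => gA y * kB y - kA y * gB y) x := (c1.mul c4).sub (c2.mul c3)
  filter_upwards [h.nhds_mem hx, hA, hB, c5.eventually_ne
      (show gA x * kB x - kA x * gB x ≠ 0 by simp [hgA, hkA, hkB, hk₀]),
    c3.eventually_ne (show gB x ≠ 0 by rwa [hgB]), c4.eventually_ne (show kB x ≠ 0 by rwa [hkB])]
    with y h1 h2 h3 h4 h5 h6 using ⟨h1, h2, h3, h4, h5, h6⟩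

lemma IsRowAt.smooth_row {g k : E → ℝ} {y : E} (hr : IsRowAt ε β I g k y)
    (h : BalancedCoframe V ε α α' β I J) (hy : y ∈ V) :
    ContDiffAt ℝ ∞ (fun z => g z • α z + k z • α' z) y :=
  (hr.smooth_g.smul (h.smooth_α y hy)).add (hr.smooth_k.smul (h.smooth_α' y hy))

/-- The row equations are designed so that dg ∧ α + dk ∧ α' cancels every term of g dα + k dα'
containing β explicitly. -/
lemma IsRowAt.fd_row {g k : E → ℝ} {y : E} (hr : IsRowAt ε β I g k y)
    (h : BalancedCoframe V ε α α' β I J) (hc : ConnectionForm V ε α α' β I ν Λ) (hy : y ∈ V)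
    (u v : E) : fd (fun z => g z • α z + k z • α' z) y u v =
      ν y u * (g y * α y v + k y * α' y v) - ν y v * (g y * α y u + k y * α' y u) := by
  have t1 := (h.smooth_α y hy).diff
  have t2 := (h.smooth_α' y hy).diff
  have t3 := hr.smooth_g.diff
  have t4 := hr.smooth_k.diff
  rw [fd_add (by fun_prop) (by fun_prop), fd_smul t3 t1, fd_smul t4 t2, hr.dg, hr.dk, hc.dα y hy,
    hc.dα' y hy]
  simp only [smul_apply, smul_eq_mul]
  ring

/-- The differential of `g a + k b`, the value of `g α + k α'` on a symmetry. -/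
lemma IsRowAt.fderiv_row {g k a b κ : E → ℝ} {y : E} (hr : IsRowAt ε β I g k y)
    (hs : SymmetrySystem V ε α α' β I ν Λ a b κ) (hy : y ∈ V) (v : E) :
    fderiv ℝ (fun z => g z * a z + k z * b z) y v =
      κ y * (g y * α y v + k y * α' y v) + (g y * a y + k y * b y) * ν y v := by
  have t1 := (hs.smooth_a y hy).diff
  have t2 := (hs.smooth_b y hy).diff
  have t3 := hr.smooth_g.diff
  have t4 := hr.smooth_k.diff
  rw [fderiv_fun_add (by fun_prop) (by fun_prop), fderiv_fun_mul t3 t1, fderiv_fun_mul t4 t2, hr.dg,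
    hr.dk, hs.da y hy, hs.db y hy]
  simp only [smul_apply, add_apply, sub_apply, smul_eq_mul]
  ring

/-- Where two symmetries are independent, `Λ` vanishes. -/
lemma eq_zero_of_two_systems {a₁ b₁ κ₁ a₂ b₂ κ₂ : E → ℝ} (h : BalancedCoframe V ε α α' β I J)
    (hc : ConnectionForm V ε α α' β I ν Λ) (h₁ : SymmetrySystem V ε α α' β I ν Λ a₁ b₁ κ₁)
    (h₂ : SymmetrySystem V ε α α' β I ν Λ a₂ b₂ κ₂) {x : E} (hx : x ∈ V)
    (hΔ : a₁ x * b₂ x - a₂ x * b₁ x ≠ 0) : Λ x = 0 := by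
  by_contra hΛ
  set Δ : E → ℝ := fun y => a₁ y * b₂ y - a₂ y * b₁ y with hΔdef
  have sΔ : ∀ y ∈ V, ContDiffAt ℝ ∞ Δ y := fun y hy =>
    ((h₁.smooth_a y hy).mul (h₂.smooth_b y hy)).sub ((h₂.smooth_a y hy).mul (h₁.smooth_b y hy))
  have sΛ : ∀ y ∈ V, ContDiffAt ℝ ∞ Λ y := fun y hy => hc.smooth_Λ h hy
  -- The two integrability conditions determine dΛ/Λ once Δ ≠ 0; adding 2 dΔ/Δ removes κ₁ and κ₂.
  -- `Real.log` is log of the absolute value, so the signs of Δ and Λ do not matter.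
  have key : ∀ᶠ y in 𝓝 x, fderiv ℝ (fun z => 2 * Real.log (Δ z) + Real.log (Λ z)) y =
      (2 : ℝ) • ν y - I y • β y := by
    filter_upwards [h.nhds_mem hx, (sΔ x hx).continuousAt.eventually_ne hΔ,
      (sΛ x hx).continuousAt.eventually_ne hΛ] with y hy hΔy hΛy
    have t1 := (h₁.smooth_a y hy).diff
    have t2 := (h₁.smooth_b y hy).diff
    have t3 := (h₂.smooth_a y hy).diff
    have t4 := (h₂.smooth_b y hy).diff
    obtain ⟨e₁, e₂, e₃, he, -⟩ := h.frame y hy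
    have d1 : HasFDerivAt (fun z => 2 * Real.log (Δ z) + Real.log (Λ z)) _ y :=
      (((sΔ y hy).diff.hasFDerivAt.log hΔy).const_mul 2).add ((sΛ y hy).diff.hasFDerivAt.log hΛy)
    have d2 : ∀ v, fderiv ℝ Δ y v = a₁ y * fderiv ℝ b₂ y v + b₂ y * fderiv ℝ a₁ y v -
        (a₂ y * fderiv ℝ b₁ y v + b₁ y * fderiv ℝ a₂ y v) := by
      intro v
      rw [hΔdef, fderiv_fun_sub (by fun_prop) (by fun_prop), fderiv_fun_mul t1 t4,
        fderiv_fun_mul t3 t2]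
      rfl
    have i1 := h₁.integrability h hc hy
    have i2 := h₂.integrability h hc hy
    have m1 := i1 e₁ e₂
    have m2 := i2 e₁ e₂
    have m3 := i1 e₃ e₂
    have m4 := i2 e₃ e₂
    simp only [he.a₁, he.a₂, he.a₃, he.b₁, he.b₂, he.b₃, he.c₁, he.c₂, he.c₃] at m1 m2 m3 m4
    have hΔe : Δ y = a₁ y * b₂ y - a₂ y * b₁ y := rfl
    have hΔy' : a₁ y * b₂ y - a₂ y * b₁ y ≠ 0 := hΔy
    rw [d1.fderiv]
    refine he.ext ?_ ?_ ?_ <;>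
      simp only [add_apply, sub_apply, smul_apply, smul_eq_mul, d2, h₁.da y hy, h₁.db y hy,
        h₂.da y hy, h₂.db y hy, he.a₁, he.a₂, he.a₃, he.b₁, he.b₂, he.b₃, he.c₁, he.c₂, he.c₃] <;>
      rw [hΔe]
    · field_simp
      linear_combination (b₂ y) * m1 - (b₁ y) * m2
    · field_simp
      linear_combination (a₁ y) * m2 - (a₂ y) * m1
    · have m7 : fderiv ℝ Λ y e₃ + 2 * Λ y * ν y e₃ - I y * Λ y = 0 := by
        have : (fderiv ℝ Λ y e₃ + 2 * Λ y * ν y e₃ - I y * Λ y) *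
            (a₁ y * b₂ y - a₂ y * b₁ y) = 0 := by
          linear_combination b₂ y * m3 - b₁ y * m4
        exact (mul_eq_zero.1 this).resolve_right hΔy'
      field_simp
      linear_combination (a₁ y * b₂ y - a₂ y * b₁ y) * m7
  obtain ⟨e₁, e₂, e₃, he, -⟩ := h.frame x hx
  have sm : ContDiffAt ℝ ∞ (fun z => 2 * Real.log (Δ z) + Real.log (Λ z)) x :=
    (contDiffAt_const.mul ((sΔ x hx).log hΔ)).add ((sΛ x hx).log hΛ)
  -- The form 2ν - Iβ is therefore closed; as d(Iβ) = Jβ ∧ β = 0, this says dν = 0, contrary to Λ ≠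
  -- 0.
  have q := fd_fderiv_eq_zero sm key e₁ e₂
  have tν := (hc.smooth x hx).diff
  have tβ := (h.smooth_β x hx).diff
  have tI := (h.smooth_I x hx).diff
  rw [fd_sub (by fun_prop) (by fun_prop), fd_smul (f := fun _ => (2 : ℝ)) (by fun_prop) tν,
    fd_smul tI tβ, h.dβ hx, h.dI x hx, hc.dν x hx] at q
  simp [he.a₁, he.a₂, he.b₁, he.b₂, he.c₁, he.c₂] at q
  exact hΛ q

end Flat

/-! ### The normal form III₂ when Λ vanishes. -/

section NormalForms

variable {V : Set E3} {ε : ℝ} {α α' β ν : E3 → E3 →L[ℝ] ℝ} {I J Λ : E3 → ℝ}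

/-- Coordinates of type III₂ for `(ker α, ker α')`. -/
def FlatTypeIII₂ (V : Set E3) (α α' : E3 → E3 →L[ℝ] ℝ) (m : E3) : Prop :=
  ∃ (ψ : OpenPartialHomeomorph E3 E3) (f : ℝ → ℝ), m ∈ ψ.source ∧ ψ.source ⊆ V ∧
    (∀ y ∈ ψ.source, ContDiffAt ℝ ∞ ψ y) ∧ (∀ z ∈ ψ.target, ContDiffAt ℝ ∞ ψ.symm z) ∧
    ∀ q ∈ ψ.source, ContDiffAt ℝ ∞ f (ψ q 2) ∧
      (∀ v, α q v = 0 ↔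
        fderiv ℝ (fun z => ψ z 1) q v = ψ q 2 * fderiv ℝ (fun z => ψ z 0) q v) ∧
      (∀ v, α' q v = 0 ↔
        fderiv ℝ (fun z => ψ z 1) q v = f (ψ q 2) * fderiv ℝ (fun z => ψ z 0) q v)

/-- Coordinates of type III₁ for `(ker α, ker α')`. -/
def FlatTypeIII₁ (V : Set E3) (α α' : E3 → E3 →L[ℝ] ℝ) (m : E3) : Prop :=
  ∃ (ψ : OpenPartialHomeomorph E3 E3) (a b f : ℝ → ℝ), m ∈ ψ.source ∧ ψ.source ⊆ V ∧
    (∀ y ∈ ψ.source, ContDiffAt ℝ ∞ ψ y) ∧ (∀ z ∈ ψ.target, ContDiffAt ℝ ∞ ψ.symm z) ∧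
    ∀ q ∈ ψ.source, ContDiffAt ℝ ∞ a (ψ q 1) ∧ ContDiffAt ℝ ∞ b (ψ q 1) ∧
      ContDiffAt ℝ ∞ f (ψ q 2) ∧ ψ q 2 + b (ψ q 1) ≠ 0 ∧ f (ψ q 2) + b (ψ q 1) ≠ 0 ∧
      (∀ v, α q v = 0 ↔ fderiv ℝ (fun z => ψ z 1) q v =
        (ψ q 2 + a (ψ q 1)) / (ψ q 2 + b (ψ q 1)) * fderiv ℝ (fun z => ψ z 0) q v) ∧
      (∀ v, α' q v = 0 ↔ fderiv ℝ (fun z => ψ z 1) q v =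
        (f (ψ q 2) + a (ψ q 1)) / (f (ψ q 2) + b (ψ q 1)) * fderiv ℝ (fun z => ψ z 0) q v)

lemma fderiv_neg_div_apply {E : Type*} [NormedAddCommGroup E] [NormedSpace ℝ E] {u w : E → ℝ}
    {y : E} (hu : DifferentiableAt ℝ u y) (hw : DifferentiableAt ℝ w y) (h0 : w y ≠ 0) (v : E) :
    fderiv ℝ (fun z => -(u z / w z)) y v =
      -((fderiv ℝ u y v * w y - u y * fderiv ℝ w y v) / w y ^ 2) := by
  have h1 := ((hasDerivAt_inv h0).comp_hasFDerivAt y hw.hasFDerivAt)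
  have h2 : HasFDerivAt (fun z => -(u z / w z)) _ y := (hu.hasFDerivAt.mul h1).neg
  rw [h2.fderiv]
  simp only [neg_apply, smul_apply, add_apply, smul_eq_mul, Function.comp_apply]
  field_simp
  ring

/-- The slopes `p` and `f(p)` of two contact structures with respect to a basis of rows. -/
lemma IsRowAt.fderiv_slopes {gA kA gB kB : E3 → ℝ} {y : E3} (hA : IsRowAt ε β I gA kA y)
    (hB : IsRowAt ε β I gB kB y) (hg : gB y ≠ 0) (hk : kB y ≠ 0) (v : E3) :
    fderiv ℝ (fun z => -(kA z / kB z)) y v =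
        -((gA y * kB y - kA y * gB y) / kB y ^ 2) * β y v ∧
      fderiv ℝ (fun z => -(gA z / gB z)) y v =
        -(ε * (gA y * kB y - kA y * gB y) / gB y ^ 2) * β y v := by
  rw [fderiv_neg_div_apply hA.smooth_k.diff hB.smooth_k.diff hk,
    fderiv_neg_div_apply hA.smooth_g.diff hB.smooth_g.diff hg, hA.dg, hA.dk, hB.dg, hB.dk]
  simp only [smul_apply, smul_eq_mul]
  constructor <;> (field_simp; ring)

/-- Here ν is closed, ν = dσ, and exp(-σ) is an integrating factor for both rows A, B: exp(-σ)A =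
dY, exp(-σ)B = dX. With D = g_A k_B - k_A g_B one has k_B A - k_A B = Dα and g_B A - g_A B = -Dα',
so in coordinates x = -X, y = Y the slopes dy/dx are -k_A/k_B and -g_A/g_B, two functions of I with
nonvanishing differential along β. -/
lemma flatTypeIII₂_of_eq_zero (h : BalancedCoframe V ε α α' β I J)
    (hc : ConnectionForm V ε α α' β I ν Λ) {m : E3} (hm : m ∈ V) (hΛ : ∀ᶠ y in 𝓝 m, Λ y = 0) :
    FlatTypeIII₂ V α α' m := by
  obtain ⟨gA, kA, gB, kB, -, -, hrows⟩ := h.exists_rows hm one_ne_zero one_ne_zero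
  obtain ⟨σ, hσ⟩ := exists_primitive (θ := ν) (x := m) (by
    filter_upwards [hΛ, h.nhds_mem hm] with y hy hyV
    exact ⟨hc.smooth y hyV, fun u v => by rw [hc.dν y hyV, hy, zero_mul]⟩)
  have hexp : ∀ y, ContDiffAt ℝ ∞ σ y → fderiv ℝ σ y = ν y →
      ContDiffAt ℝ ∞ (fun z => Real.exp (-σ z)) y ∧
      fderiv ℝ (fun z => Real.exp (-σ z)) y = (-Real.exp (-σ y)) • ν y := by
    intro y h1 h2
    refine ⟨h1.neg.exp, ?_⟩
    have := h1.diff.hasFDerivAt.neg.exp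
    have h3 : fderiv ℝ (fun z => Real.exp (-σ z)) y = _ := this.fderiv
    rw [h3, h2, smul_neg]
    exact (neg_smul _ _).symm
  have closed : ∀ y, y ∈ V → ContDiffAt ℝ ∞ σ y → fderiv ℝ σ y = ν y → ∀ g k : E3 → ℝ,
      IsRowAt ε β I g k y →
      ContDiffAt ℝ ∞ (fun z => Real.exp (-σ z) • (g z • α z + k z • α' z)) y ∧
      ∀ u v, fd (fun z => Real.exp (-σ z) • (g z • α z + k z • α' z)) y u v = 0 := by
    intro y hy h1 h2 g k hr
    obtain ⟨h3, h4⟩ := hexp y h1 h2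
    refine ⟨h3.smul (hr.smooth_row h hy), fun u v => ?_⟩
    rw [fd_smul h3.diff (hr.smooth_row h hy).diff, h4, hr.fd_row h hc hy]
    simp only [add_apply, smul_apply, smul_eq_mul]
    ring
  obtain ⟨X, hX⟩ := exists_primitive (x := m)
    (θ := fun z => Real.exp (-σ z) • (gB z • α z + kB z • α' z)) (by
      filter_upwards [hrows, hσ] with y h1 h2
      exact closed y h1.1 h2.1 h2.2 gB kB h1.2.2.1)
  obtain ⟨Y, hY⟩ := exists_primitive (x := m)
    (θ := fun z => Real.exp (-σ z) • (gA z • α z + kA z • α' z)) (by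
      filter_upwards [hrows, hσ] with y h1 h2
      exact closed y h1.1 h2.1 h2.2 gA kA h1.2.1)
  set p : E3 → ℝ := fun z => -(kA z / kB z) with hp
  set F : Fin 3 → E3 → ℝ := ![fun z => -X z, Y, p] with hF
  have dX : ∀ {y}, fderiv ℝ X y = Real.exp (-σ y) • (gB y • α y + kB y • α' y) → ∀ v,
      fderiv ℝ (F 0) y v = -(Real.exp (-σ y) * (gB y * α y v + kB y * α' y v)) := by
    intro y hy v
    have : F 0 = fun z => -X z := rfl
    rw [this, fderiv_fun_neg, hy]
    rfl
  have dY : ∀ {y}, fderiv ℝ Y y = Real.exp (-σ y) • (gA y • α y + kA y • α' y) → ∀ v,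
      fderiv ℝ (F 1) y v = Real.exp (-σ y) * (gA y * α y v + kA y * α' y v) := by
    intro y hy v
    have : F 1 = Y := rfl
    rw [this, hy]
    rfl
  set S : Set E3 := {y | (y ∈ V ∧ IsRowAt ε β I gA kA y ∧ IsRowAt ε β I gB kB y ∧
    gA y * kB y - kA y * gB y ≠ 0 ∧ gB y ≠ 0 ∧ kB y ≠ 0) ∧
    (ContDiffAt ℝ ∞ X y ∧ fderiv ℝ X y = Real.exp (-σ y) • (gB y • α y + kB y • α' y)) ∧
    (ContDiffAt ℝ ∞ Y y ∧ fderiv ℝ Y y = Real.exp (-σ y) • (gA y • α y + kA y • α' y))} with hSdef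
  have hS : S ∈ 𝓝 m := hrows.and (hX.and hY)
  obtain ⟨ψ, r, hmψ, hψS, ht, hψF, hψs, hψs'⟩ := exists_chart (f := F) hS (by
      intro i
      filter_upwards [hS] with y hy
      obtain ⟨⟨h1, hA, hB, hD, hg, hk⟩, hX, hY⟩ := hy
      fin_cases i
      · exact hX.1.neg
      · exact hY.1
      · exact (hA.smooth_k.div hB.smooth_k hk).neg) (by
    filter_upwards [hS] with y hy v hv
    obtain ⟨⟨h1, hA, hB, hD, hg, hk⟩, hX, hY⟩ := hy
    have v0 := hv 0
    have v1 := hv 1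
    have v2 : fderiv ℝ p y v = 0 := hv 2
    rw [dX hX.2] at v0
    rw [dY hY.2] at v1
    rw [(hA.fderiv_slopes hB hg hk v).1] at v2
    have hE := (Real.exp_pos (-σ y)).ne'
    have w0 : gB y * α y v + kB y * α' y v = 0 :=
      (mul_eq_zero.1 (neg_eq_zero.1 v0)).resolve_left hE
    have w1 : gA y * α y v + kA y * α' y v = 0 := (mul_eq_zero.1 v1).resolve_left hE
    have w2 : β y v = 0 := (mul_eq_zero.1 v2).resolve_left
      (neg_ne_zero.2 (div_ne_zero hD (pow_ne_zero 2 hk)))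
    have w3 : α y v = 0 := (mul_eq_zero.1 (show (gA y * kB y - kA y * gB y) * α y v = 0 by
      linear_combination kB y * w1 - kA y * w0)).resolve_left hD
    have w4 : α' y v = 0 := (mul_eq_zero.1 (show (gA y * kB y - kA y * gB y) * α' y v = 0 by
      linear_combination gA y * w0 - gB y * w1)).resolve_left hD
    obtain ⟨e₁, e₂, e₃, he, -⟩ := h.frame y h1
    rw [he.span v, w2, w3, w4]
    simp)
  obtain ⟨f, hf⟩ := exists_comp_coordinate hmψ ht hψF hψs hψs' (g := fun z => -(gA z / gB z))
    (fun y hy => by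
      obtain ⟨⟨h1, hA, hB, hD, hg, hk⟩, hX, hY⟩ := hψS hy
      exact (hA.smooth_g.div hB.smooth_g hg).neg) 2 (fun y hy => by
      obtain ⟨⟨h1, hA, hB, hD, hg, hk⟩, hX, hY⟩ := hψS hy
      refine ⟨ε * kB y ^ 2 / gB y ^ 2, ?_⟩
      ext v
      have : F 2 = p := rfl
      rw [this, smul_apply, (hA.fderiv_slopes hB hg hk v).1, (hA.fderiv_slopes hB hg hk v).2,
        smul_eq_mul]
      field_simp)
  refine ⟨ψ, f, hmψ, fun y hy => (hψS hy).1.1, hψs, hψs', fun q hq => ?_⟩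
  obtain ⟨⟨h1, hA, hB, hD, hg, hk⟩, hX, hY⟩ := hψS hq
  obtain ⟨hfq, hfs⟩ := hf q hq
  have hE := (Real.exp_pos (-σ q)).ne'
  have k0 : (fun z => ψ z 0) = F 0 := by ext z; rw [hψF]
  have k1 : (fun z => ψ z 1) = F 1 := by ext z; rw [hψF]
  have k2 : ψ q 2 = -(kA q / kB q) := by rw [hψF]; rfl
  refine ⟨by rw [hψF]; exact hfs, fun v => ?_, fun v => ?_⟩
  · rw [k0, k1, k2, dX hX.2, dY hY.2]
    have key : Real.exp (-σ q) * (gA q * α q v + kA q * α' q v) -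
        -(kA q / kB q) * -(Real.exp (-σ q) * (gB q * α q v + kB q * α' q v)) =
        (Real.exp (-σ q) * (gA q * kB q - kA q * gB q) / kB q) * α q v := by
      field_simp; ring
    rw [← sub_eq_zero (b := -(kA q / kB q) * _), key, mul_eq_zero]
    exact ⟨fun h => .inr h, fun h => h.resolve_left (div_ne_zero (mul_ne_zero hE hD) hk)⟩
  · rw [k0, k1, hψF, ← hfq, dX hX.2, dY hY.2]
    have key : Real.exp (-σ q) * (gA q * α q v + kA q * α' q v) -
        -(gA q / gB q) * -(Real.exp (-σ q) * (gB q * α q v + kB q * α' q v)) =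
        (-(Real.exp (-σ q) * (gA q * kB q - kA q * gB q)) / gB q) * α' q v := by
      field_simp; ring
    rw [← sub_eq_zero (b := -(gA q / gB q) * _), key, mul_eq_zero]
    exact ⟨fun h => .inr h, fun h => h.resolve_left
      (div_ne_zero (neg_ne_zero.2 (mul_ne_zero hE hD)) hg)⟩

end NormalForms

/-! ### The normal form III₁, and symmetries with a zero. -/

section NormalForms

variable {V : Set E3} {ε : ℝ} {α α' β ν : E3 → E3 →L[ℝ] ℝ} {I J Λ : E3 → ℝ}

/-- Initial values for the row B: both entries must be nonzero, since they are denominators of the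
slopes, and B(Y) must be nonzero at m. -/
lemma exists_nonzero_combination {a b : ℝ} (hab : a ≠ 0 ∨ b ≠ 0) :
    ∃ g k : ℝ, g ≠ 0 ∧ k ≠ 0 ∧ g * a + k * b ≠ 0 := by
  by_cases h : a + b = 0
  · refine ⟨1, 2, one_ne_zero, two_ne_zero, fun h2 => ?_⟩
    have hb : b = 0 := by linarith
    have ha : a = 0 := by linarith
    exact hab.elim (fun h => h ha) (fun h => h hb)
  · exact ⟨1, 1, one_ne_zero, one_ne_zero, by simpa using h⟩

/-- The value P = B(Y) satisfies dP = κB + Pν, so 1/P replaces the integrating factor exp(-σ): B/P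
is closed. A/P need not be, but its defect is that of RB/P with R = Q/P, because dR = κ(A - RB)/P.
-/
lemma flatTypeIII₁_of_symmetry {a b κ : E3 → ℝ} (h : BalancedCoframe V ε α α' β I J)
    (hc : ConnectionForm V ε α α' β I ν Λ) (hs : SymmetrySystem V ε α α' β I ν Λ a b κ) {m : E3}
    (hm : m ∈ V) (hab : a m ≠ 0 ∨ b m ≠ 0) : FlatTypeIII₁ V α α' m := by
  obtain ⟨g₀, k₀, hg₀, hk₀, hgk⟩ := exists_nonzero_combination hab
  obtain ⟨gA, kA, gB, kB, hgB, hkB, hrows⟩ := h.exists_rows hm hg₀ hk₀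
  set P : E3 → ℝ := fun z => gB z * a z + kB z * b z with hPdef
  set Q : E3 → ℝ := fun z => gA z * a z + kA z * b z with hQdef
  set R : E3 → ℝ := fun z => Q z * (P z)⁻¹ with hRdef
  set A : E3 → E3 →L[ℝ] ℝ := fun z => gA z • α z + kA z • α' z with hAdef
  set B : E3 → E3 →L[ℝ] ℝ := fun z => gB z • α z + kB z • α' z with hBdef
  have sRow : ∀ {y}, y ∈ V → ∀ {g k : E3 → ℝ}, IsRowAt ε β I g k y →
      ContDiffAt ℝ ∞ (fun z => g z * a z + k z * b z) y := fun hy g k hr =>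
    (hr.smooth_g.mul (hs.smooth_a _ hy)).add (hr.smooth_k.mul (hs.smooth_b _ hy))
  have sP : ∀ {y}, y ∈ V → IsRowAt ε β I gB kB y → ContDiffAt ℝ ∞ P y := fun hy hr => sRow hy hr
  have sQ : ∀ {y}, y ∈ V → IsRowAt ε β I gA kA y → ContDiffAt ℝ ∞ Q y := fun hy hr => sRow hy hr
  have siP : ∀ {y}, y ∈ V → IsRowAt ε β I gB kB y → P y ≠ 0 →
      ContDiffAt ℝ ∞ (fun z => (P z)⁻¹) y := fun hy hr h0 => (sP hy hr).inv h0
  have hPm : P m ≠ 0 := by simpa [hPdef, hgB, hkB] using hgk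
  have hrow₀ := hrows.self_of_nhds
  have hP0 : ∀ᶠ y in 𝓝 m, P y ≠ 0 :=
    (sP hm hrow₀.2.2.1).continuousAt.eventually_ne hPm
  have dP : ∀ {y}, y ∈ V → IsRowAt ε β I gB kB y → ∀ v,
      fderiv ℝ P y v = κ y * B y v + P y * ν y v := fun hy hr v => hr.fderiv_row hs hy v
  have dQ : ∀ {y}, y ∈ V → IsRowAt ε β I gA kA y → ∀ v,
      fderiv ℝ Q y v = κ y * A y v + Q y * ν y v := fun hy hr v => hr.fderiv_row hs hy v
  have diP : ∀ {y}, y ∈ V → IsRowAt ε β I gB kB y → P y ≠ 0 → ∀ v,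
      fderiv ℝ (fun z => (P z)⁻¹) y v = -(κ y * B y v + P y * ν y v) / P y ^ 2 := by
    intro y hy hr h0 v
    have := (hasDerivAt_inv h0).comp_hasFDerivAt y (sP hy hr).diff.hasFDerivAt
    have h2 : fderiv ℝ (fun z => (P z)⁻¹) y = _ := this.fderiv
    rw [h2, smul_apply, dP hy hr, smul_eq_mul]
    field_simp
  have sR : ∀ {y}, y ∈ V → IsRowAt ε β I gA kA y → IsRowAt ε β I gB kB y → P y ≠ 0 →
      ContDiffAt ℝ ∞ R y := fun hy hA hB h0 => (sQ hy hA).mul (siP hy hB h0)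
  have dR : ∀ {y}, y ∈ V → IsRowAt ε β I gA kA y → IsRowAt ε β I gB kB y → P y ≠ 0 → ∀ v,
      fderiv ℝ R y v = κ y * (A y v - R y * B y v) / P y := by
    intro y hy hA hB h0 v
    have h1 : fderiv ℝ R y = _ := fderiv_fun_mul (sQ hy hA).diff (siP hy hB h0).diff
    have h2 : R y = Q y * (P y)⁻¹ := rfl
    rw [h1]
    simp only [add_apply, smul_apply, smul_eq_mul]
    rw [diP hy hB h0, dQ hy hA, h2]
    field_simp
    ring
  obtain ⟨x₁, hx₁⟩ := exists_primitive (x := m) (θ := fun z => (P z)⁻¹ • B z) (by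
    filter_upwards [hrows, hP0] with y ⟨hy, hA, hB, hD, hg, hk⟩ h0
    have sB := hB.smooth_row h hy
    refine ⟨(siP hy hB h0).smul sB, fun u v => ?_⟩
    rw [fd_smul (f := fun z => (P z)⁻¹) (siP hy hB h0).diff sB.diff, hB.fd_row h hc hy,
      diP hy hB h0, diP hy hB h0]
    simp only [hBdef, add_apply, smul_apply, smul_eq_mul]
    field_simp
    ring)
  obtain ⟨w, hw⟩ := exists_primitive (x := m)
    (θ := fun z => (P z)⁻¹ • A z - (R z * (P z)⁻¹) • B z) (by
    filter_upwards [hrows, hP0] with y ⟨hy, hA, hB, hD, hg, hk⟩ h0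
    have sA := hA.smooth_row h hy
    have sB := hB.smooth_row h hy
    have si := siP hy hB h0
    have sR' := sR hy hA hB h0
    have sRi : ContDiffAt ℝ ∞ (fun z => R z * (P z)⁻¹) y := sR'.mul si
    refine ⟨(si.smul sA).sub (sRi.smul sB), fun u v => ?_⟩
    have dRi : ∀ v, fderiv ℝ (fun z => R z * (P z)⁻¹) y v =
        R y * (-(κ y * B y v + P y * ν y v) / P y ^ 2) +
          κ y * (A y v - R y * B y v) / P y * (P y)⁻¹ := by
      intro v
      rw [fderiv_fun_mul sR'.diff si.diff]
      simp only [add_apply, smul_apply, smul_eq_mul]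
      rw [diP hy hB h0, dR hy hA hB h0]
      ring
    rw [fd_sub (θ := fun z => (P z)⁻¹ • A z) (η := fun z => (R z * (P z)⁻¹) • B z)
        (si.smul sA).diff (sRi.smul sB).diff, fd_smul (f := fun z => (P z)⁻¹) si.diff sA.diff,
      fd_smul sRi.diff sB.diff, hA.fd_row h hc hy, hB.fd_row h hc hy, diP hy hB h0, diP hy hB h0,
      dRi, dRi]
    simp only [hAdef, hBdef, add_apply, smul_apply, smul_eq_mul]
    field_simp
    ring)
  set p : E3 → ℝ := fun z => -(kA z / kB z) with hp
  set f₀ : E3 → ℝ := fun z => -(gA z / gB z) with hf₀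
  -- Large enough that the denominators p + R + k and f₀ + R + k are positive at m.
  set k : ℝ := 1 + |p m + R m| + |f₀ m + R m| with hkdef
  have hk1 := neg_abs_le (p m + R m)
  have hk2 := neg_abs_le (f₀ m + R m)
  have hk3 := abs_nonneg (p m + R m)
  have hk4 := abs_nonneg (f₀ m + R m)
  have hk0 : k ≠ 0 := by positivity
  have sp : ∀ {y}, IsRowAt ε β I gA kA y → IsRowAt ε β I gB kB y → kB y ≠ 0 →
      ContDiffAt ℝ ∞ p y := fun hA hB hk => (hA.smooth_k.div hB.smooth_k hk).neg
  have sf : ∀ {y}, IsRowAt ε β I gA kA y → IsRowAt ε β I gB kB y → gB y ≠ 0 →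
      ContDiffAt ℝ ∞ f₀ y := fun hA hB hk => (hA.smooth_g.div hB.smooth_g hk).neg
  obtain ⟨-, hA₀, hB₀, -, hg₁, hk₁⟩ := hrow₀
  have cR := (sR hm hA₀ hB₀ hPm).continuousAt
  have hden1 : ∀ᶠ y in 𝓝 m, p y + (R y + k) ≠ 0 :=
    ((sp hA₀ hB₀ hk₁).continuousAt.add (cR.add continuousAt_const)).eventually_ne
      (show p m + (R m + k) ≠ 0 from ne_of_gt (by linarith))
  have hden2 : ∀ᶠ y in 𝓝 m, f₀ y + (R y + k) ≠ 0 :=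
    ((sf hA₀ hB₀ hg₁).continuousAt.add (cR.add continuousAt_const)).eventually_ne
      (show f₀ m + (R m + k) ≠ 0 from ne_of_gt (by linarith))
  -- The plane A + pB = 0 is dw + (p + R)dx₁ = 0. Substituting w = ky and x₁ = y - x gives (p + R +
  -- k)dy = (p + R)dx, which is III₁ with a = R and b = R + k; likewise for f₀.
  set F : Fin 3 → E3 → ℝ := ![fun z => k⁻¹ * w z - x₁ z, fun z => k⁻¹ * w z, p] with hF
  set S : Set E3 := {y | (y ∈ V ∧ IsRowAt ε β I gA kA y ∧ IsRowAt ε β I gB kB y ∧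
    gA y * kB y - kA y * gB y ≠ 0 ∧ gB y ≠ 0 ∧ kB y ≠ 0) ∧ P y ≠ 0 ∧
    (ContDiffAt ℝ ∞ x₁ y ∧ fderiv ℝ x₁ y = (P y)⁻¹ • B y) ∧
    (ContDiffAt ℝ ∞ w y ∧ fderiv ℝ w y = (P y)⁻¹ • A y - (R y * (P y)⁻¹) • B y) ∧
    p y + (R y + k) ≠ 0 ∧ f₀ y + (R y + k) ≠ 0} with hSdef
  have hS : S ∈ 𝓝 m := hrows.and (hP0.and (hx₁.and (hw.and (hden1.and hden2))))
  have d1 : ∀ {y}, y ∈ S → ∀ v, fderiv ℝ (F 1) y v = k⁻¹ * ((A y v - R y * B y v) / P y) := by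
    intro y hy v
    obtain ⟨-, -, -, hw, -⟩ := hy
    have : F 1 = fun z => k⁻¹ * w z := rfl
    rw [this, fderiv_const_mul hw.1.diff, hw.2]
    simp only [smul_apply, sub_apply, smul_eq_mul]
    ring
  have d0 : ∀ {y}, y ∈ S → ∀ v,
      fderiv ℝ (F 0) y v = k⁻¹ * ((A y v - R y * B y v) / P y) - B y v / P y := by
    intro y hy v
    rw [← d1 hy]
    obtain ⟨-, -, hx, hw, -⟩ := hy
    have : F 0 = fun z => F 1 z - x₁ z := rfl
    have h1 : DifferentiableAt ℝ (F 1) y := hw.1.diff.const_mul _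
    rw [this, fderiv_fun_sub h1 hx.1.diff, hx.2]
    simp only [smul_apply, sub_apply, smul_eq_mul]
    ring
  obtain ⟨ψ, r, hmψ, hψS, ht, hψF, hψs, hψs'⟩ := exists_chart (f := F) hS (by
      intro i
      filter_upwards [hS] with y hy
      obtain ⟨⟨h1, hA, hB, hD, hg, hk⟩, -, hX, hW, -⟩ := hy
      fin_cases i
      · exact (contDiffAt_const.mul hW.1).sub hX.1
      · exact contDiffAt_const.mul hW.1
      · exact sp hA hB hk) (by
    filter_upwards [hS] with y hy v hv
    have v0 := hv 0
    have v1 := hv 1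
    have v2 : fderiv ℝ p y v = 0 := hv 2
    rw [d0 hy] at v0
    rw [d1 hy] at v1
    obtain ⟨⟨h1, hA, hB, hD, hg, hk⟩, h0, hX, hW, -⟩ := hy
    rw [(hA.fderiv_slopes hB hg hk v).1] at v2
    have w0 : B y v = 0 := by
      rw [v1, zero_sub, neg_eq_zero] at v0
      exact (div_eq_zero_iff.1 v0).resolve_right h0
    have w1 : A y v = 0 := by
      rw [w0, mul_zero, sub_zero] at v1
      exact (div_eq_zero_iff.1 ((mul_eq_zero.1 v1).resolve_left (inv_ne_zero hk0))).resolve_right h0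
    have w0' : gB y * α y v + kB y * α' y v = 0 := w0
    have w1' : gA y * α y v + kA y * α' y v = 0 := w1
    have w2 : β y v = 0 := (mul_eq_zero.1 v2).resolve_left
      (neg_ne_zero.2 (div_ne_zero hD (pow_ne_zero 2 hk)))
    have w3 : α y v = 0 := (mul_eq_zero.1 (show (gA y * kB y - kA y * gB y) * α y v = 0 by
      linear_combination kB y * w1' - kA y * w0')).resolve_left hD
    have w4 : α' y v = 0 := (mul_eq_zero.1 (show (gA y * kB y - kA y * gB y) * α' y v = 0 by
      linear_combination gA y * w0' - gB y * w1')).resolve_left hD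
    obtain ⟨e₁, e₂, e₃, he, -⟩ := h.frame y h1
    rw [he.span v, w2, w3, w4]
    simp)
  obtain ⟨f, hf⟩ := exists_comp_coordinate hmψ ht hψF hψs hψs' (g := f₀)
    (fun y hy => by
      obtain ⟨⟨h1, hA, hB, hD, hg, hk⟩, -⟩ := hψS hy
      exact sf hA hB hg) 2 (fun y hy => by
      obtain ⟨⟨h1, hA, hB, hD, hg, hk⟩, -⟩ := hψS hy
      refine ⟨ε * kB y ^ 2 / gB y ^ 2, ?_⟩
      ext v
      have : F 2 = p := rfl
      rw [this, smul_apply, (hA.fderiv_slopes hB hg hk v).1, (hA.fderiv_slopes hB hg hk v).2,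
        smul_eq_mul]
      field_simp)
  obtain ⟨ρ, hρ⟩ := exists_comp_coordinate hmψ ht hψF hψs hψs' (g := R)
    (fun y hy => by
      obtain ⟨⟨h1, hA, hB, hD, hg, hk⟩, h0, -⟩ := hψS hy
      exact sR h1 hA hB h0) 1 (fun y hy => by
      have hy' := hψS hy
      obtain ⟨⟨h1, hA, hB, hD, hg, hk⟩, h0, -⟩ := hψS hy
      refine ⟨κ y * k, ?_⟩
      ext v
      rw [smul_apply, d1 hy', dR h1 hA hB h0, smul_eq_mul]
      field_simp)
  refine ⟨ψ, ρ, fun t => ρ t + k, f, hmψ, fun y hy => (hψS hy).1.1, hψs, hψs', fun q hq => ?_⟩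
  have hq' := hψS hq
  obtain ⟨⟨h1, hA, hB, hD, hg, hk⟩, h0, hX, hW, hd1, hd2⟩ := hψS hq
  obtain ⟨hfq, hfs⟩ := hf q hq
  obtain ⟨hρq, hρs⟩ := hρ q hq
  have k0 : (fun z => ψ z 0) = F 0 := by ext z; rw [hψF]
  have k1 : (fun z => ψ z 1) = F 1 := by ext z; rw [hψF]
  have k2 : ψ q 2 = p q := by rw [hψF]; rfl
  have k2' : F 2 q = p q := rfl
  rw [k2'] at hfq hfs
  have hρk : (fun t => ρ t + k) (F 1 q) = R q + k := by rw [hρq]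
  rw [k0, k1, hψF q 1, k2, ← hfq, hρk, ← hρq]
  refine ⟨hρs, hρs.add contDiffAt_const, hfs, hd1, hd2, fun v => ?_, fun v => ?_⟩
  · rw [d0 hq', d1 hq']
    have key : k⁻¹ * ((A q v - R q * B q v) / P q) - (p q + R q) / (p q + (R q + k)) *
        (k⁻¹ * ((A q v - R q * B q v) / P q) - B q v / P q) =
        ((gA q * kB q - kA q * gB q) / (kB q * P q * (p q + (R q + k)))) * α q v := by
      have e1 : p q = -(kA q / kB q) := rfl
      have e2 : A q v + p q * B q v = (gA q * kB q - kA q * gB q) / kB q * α q v := by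
        simp only [e1, hAdef, hBdef, add_apply, smul_apply, smul_eq_mul]
        field_simp
        ring
      have e3 : ((gA q * kB q - kA q * gB q) / (kB q * P q * (p q + (R q + k)))) * α q v =
          (A q v + p q * B q v) / (P q * (p q + (R q + k))) := by
        rw [e2]; field_simp
      rw [e3]
      field_simp
      ring
    refine Iff.trans ?_ sub_eq_zero
    rw [key, mul_eq_zero]
    exact ⟨fun h => .inr h, fun h => h.resolve_left
      (div_ne_zero hD (mul_ne_zero (mul_ne_zero hk h0) hd1))⟩
  · rw [d0 hq', d1 hq']
    have key : k⁻¹ * ((A q v - R q * B q v) / P q) - (f₀ q + R q) / (f₀ q + (R q + k)) *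
        (k⁻¹ * ((A q v - R q * B q v) / P q) - B q v / P q) =
        (-(gA q * kB q - kA q * gB q) / (gB q * P q * (f₀ q + (R q + k)))) * α' q v := by
      have e1 : f₀ q = -(gA q / gB q) := rfl
      have e2 : A q v + f₀ q * B q v = -(gA q * kB q - kA q * gB q) / gB q * α' q v := by
        simp only [e1, hAdef, hBdef, add_apply, smul_apply, smul_eq_mul]
        field_simp
        ring
      have e3 : (-(gA q * kB q - kA q * gB q) / (gB q * P q * (f₀ q + (R q + k)))) * α' q v =
          (A q v + f₀ q * B q v) / (P q * (f₀ q + (R q + k))) := by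
        rw [e2]; field_simp
      rw [e3]
      field_simp
      ring
    refine Iff.trans ?_ sub_eq_zero
    rw [key, mul_eq_zero]
    exact ⟨fun h => .inr h, fun h => h.resolve_left
      (div_ne_zero (neg_ne_zero.2 hD) (mul_ne_zero (mul_ne_zero hg h0) hd2))⟩

/-- A symmetry which vanishes at a point, but not near it, forces `Λ` to vanish near this point. -/
lemma eventually_eq_zero_of_fixed_point {κ : E3 → ℝ} {Y : E3 → E3}
    (h : BalancedCoframe V ε α α' β I J) (hc : ConnectionForm V ε α α' β I ν Λ)
    (hs : SymmetrySystem V ε α α' β I ν Λ (fun x => α x (Y x)) (fun x => α' x (Y x)) κ)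
    (hY : ∀ x ∈ V, β x (Y x) = 0) {m : E3} (hm : m ∈ V) (hYm : Y m = 0) (hκ : κ m ≠ 0)
    (hYs : ContinuousAt Y m) : ∀ᶠ y in 𝓝 m, Λ y = 0 := by
  set a : E3 → ℝ := fun x => α x (Y x) with ha
  set b : E3 → ℝ := fun x => α' x (Y x) with hb
  -- As β(Y) = 0, the system gives Y(a) = μa, Y(b) = μb and Y(I) = 0.
  set μ : E3 → ℝ := fun x => κ x + ν x (Y x) with hμ
  have cκ := (hs.smooth_κ m hm).continuousAt
  have cμ : ContinuousAt μ m := cκ.add ((hc.smooth m hm).continuousAt.clm_apply hYs)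
  have hμm : μ m ≠ 0 := by simpa [hμ, hYm] using hκ
  set S : Set E3 := {y | y ∈ V ∧ κ y ≠ 0 ∧ μ y ≠ 0} with hSdef
  have hS : S ∈ 𝓝 m := (h.nhds_mem hm).and ((cκ.eventually_ne hκ).and (cμ.eventually_ne hμm))
  have da : ∀ {y}, y ∈ V → ∀ v, fderiv ℝ a y v = κ y * α y v + a y * ν y v - b y * β y v :=
    fun hy v => by rw [hs.da _ hy]; rfl
  have db : ∀ {y}, y ∈ V → ∀ v, fderiv ℝ b y v =
      κ y * α' y v + b y * ν y v - (I y * b y - ε * a y) * β y v :=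
    fun hy v => by rw [hs.db _ hy]; rfl
  have dI : ∀ {y}, y ∈ V → ∀ v, fderiv ℝ I y v = J y * β y v :=
    fun hy v => by rw [h.dI _ hy]; rfl
  set F : Fin 3 → E3 → ℝ := ![a, b, I] with hF
  have hinj : ∀ y ∈ S, ∀ v, (∀ i, fderiv ℝ (F i) y v = 0) → v = 0 := by
    intro y ⟨hy, hκy, hμy⟩ v hv
    have v0 : fderiv ℝ a y v = 0 := hv 0
    have v1 : fderiv ℝ b y v = 0 := hv 1
    have v2 : fderiv ℝ I y v = 0 := hv 2
    rw [dI hy] at v2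
    have w2 : β y v = 0 := (mul_eq_zero.1 v2).resolve_left (h.J_ne y hy)
    rw [da hy, w2] at v0
    rw [db hy, w2] at v1
    obtain ⟨e₁, e₂, e₃, he, -⟩ := h.frame y hy
    have n1 := he.apply (ν y) v
    have n2 := he.apply (ν y) (Y y)
    rw [w2] at n1
    rw [hY y hy] at n2
    -- With β(v) = 0 the equations say κα(v) = -aν(v) and κα'(v) = -bν(v); weighting them by ν(e₁),
    -- ν(e₂) and summing gives (κ + ν(Y))ν(v) = 0.
    have hν : ν y v = 0 := by
      have : μ y * ν y v = 0 := by
        have hμy' : μ y = κ y + ν y (Y y) := rfl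
        have ha' : α y (Y y) = a y := rfl
        have hb' : α' y (Y y) = b y := rfl
        rw [ha', hb'] at n2
        rw [hμy', n2]
        linear_combination κ y * n1 + ν y e₁ * v0 + ν y e₂ * v1
      exact (mul_eq_zero.1 this).resolve_left hμy
    rw [hν] at v0 v1
    have w0 : α y v = 0 := (mul_eq_zero.1 (show κ y * α y v = 0 by linear_combination v0)).resolve_left
      hκy
    have w1 : α' y v = 0 :=
      (mul_eq_zero.1 (show κ y * α' y v = 0 by linear_combination v1)).resolve_left hκy
    rw [he.span v, w0, w1, w2]
    simp
  obtain ⟨ψ, r, hmψ, hψS, ht, hψF, hψs, hψs'⟩ := exists_chart (f := F) hS (by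
      intro i
      filter_upwards [hS] with y hy
      fin_cases i
      · exact hs.smooth_a y hy.1
      · exact hs.smooth_b y hy.1
      · exact h.smooth_I y hy.1) (by filter_upwards [hS] with y hy using hinj y hy)
  filter_upwards [ψ.open_source.mem_nhds hmψ] with y hy
  have hyS := hψS hy
  have hyV := hyS.1
  -- On the curve a = b = 0 the integrability condition reduces at once to Λκ = 0.
  by_cases hab : a y = 0 ∧ b y = 0
  · obtain ⟨e₁, e₂, e₃, he, -⟩ := h.frame y hyV
    have := hs.integrability h hc hyV e₁ e₂
    simp only [hab.1, hab.2, he.a₁, he.a₂, he.b₁, he.b₂] at this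
    exact (mul_eq_zero.1 (show Λ y * κ y = 0 by linear_combination this / 2)).resolve_right hyS.2.1
  set z := ψ y with hz
  have hzt : z ∈ Metric.ball (ψ m) r := ht ▸ ψ.map_source hy
  have z0 : z 0 = a y := hψF y 0
  have z1 : z 1 = b y := hψF y 1
  set d : E3 := a y • EuclideanSpace.single 0 1 + b y • EuclideanSpace.single 1 1 with hd
  have d0 : d 0 = a y := by simp [hd]
  have d1 : d 1 = b y := by simp [hd]
  have d2 : d 2 = 0 := by simp [hd]
  -- The point of the curve a = b = 0 with the same I as y. Because a and b vanish at m, it lies no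
  -- farther from the centre ψ(m) than z, so the ray γ from c to z stays in the ball.
  set c : E3 := z - d with hcdef
  have m0 : ψ m 0 = 0 := by rw [hψF]; simp [hF, ha, hYm]
  have m1 : ψ m 1 = 0 := by rw [hψF]; simp [hF, hb, hYm]
  have hct : c ∈ Metric.ball (ψ m) r := by
    rw [Metric.mem_ball, EuclideanSpace.dist_eq] at hzt ⊢
    refine lt_of_le_of_lt (Real.sqrt_le_sqrt ?_) hzt
    simp only [Fin.sum_univ_three, hcdef, PiLp.sub_apply, d0, d1, d2, m0, m1, z0, z1]
    simp only [sub_self, dist_self, sub_zero]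
    norm_num
    positivity
  set γ : ℝ → E3 := fun s => c + s • d with hγ
  have hγt : ∀ s ∈ Icc (0 : ℝ) 1, γ s ∈ ψ.target := fun s hs' => by
    rw [ht]
    have := (convex_ball (ψ m) r).add_smul_sub_mem hct hzt hs'
    rwa [hcdef, sub_sub_cancel] at this
  have hγ' : ∀ s, HasDerivAt γ d s := fun s => by
    have := ((hasDerivAt_id s).smul_const d).const_add c
    rwa [one_smul] at this
  have hγV : ∀ s ∈ Icc (0 : ℝ) 1, ψ.symm (γ s) ∈ S := fun s hs' => hψS (ψ.map_target (hγt s hs'))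
  -- Along the ray Y = sμ d/ds. Inserting Y into the integrability condition, where aα'(Y) - bα(Y) =
  -- 0, gives μ(s dΛ/ds + 2Λ) = 0 for s ≠ 0, hence s²Λ is constant. Its value at s = 0 is 0 and at s
  -- = 1 is Λ(y).
  have key : ∀ s ∈ Icc (0 : ℝ) 1, HasDerivAt (fun s => s ^ 2 * Λ (ψ.symm (γ s))) 0 s := by
    intro s hs'
    set q := ψ.symm (γ s) with hq
    have hqS : q ∈ S := hγV s hs'
    have hqs : q ∈ ψ.source := ψ.map_target (hγt s hs')
    have hqV := hqS.1
    set w := fderiv ℝ ψ.symm (γ s) d with hw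
    have h1 : HasDerivAt (fun s => ψ.symm (γ s)) w s :=
      (hψs' _ (hγt s hs')).diff.hasFDerivAt.comp_hasDerivAt s (hγ' s)
    have h2 : HasDerivAt (fun s => Λ (ψ.symm (γ s))) (fderiv ℝ Λ q w) s :=
      (hc.smooth_Λ h hqV).diff.hasFDerivAt.comp_hasDerivAt s h1
    have hFi : ∀ i, DifferentiableAt ℝ (F i) q := fun i => by
      have : F i = fun y => ψ y i := by ext y; rw [hψF]
      rw [this]
      exact (differentiableAt_piLp 2).1 (hψs q hqs).diff i
    have hev : ∀ᶠ t in 𝓝 s, γ t ∈ ψ.target :=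
      (hγ' s).continuousAt.eventually (ψ.open_target.mem_nhds (hγt s hs'))
    have h3 : ∀ i, fderiv ℝ (F i) q w = d i := fun i => by
      have k1 : HasDerivAt (fun s => F i (ψ.symm (γ s))) (fderiv ℝ (F i) q w) s :=
        (hFi i).hasFDerivAt.comp_hasDerivAt s h1
      have k2 : HasDerivAt (fun s => γ s i) (d i) s :=
        (EuclideanSpace.proj (𝕜 := ℝ) i).hasFDerivAt.comp_hasDerivAt s (hγ' s)
      refine k1.unique (k2.congr_of_eventuallyEq ?_)
      filter_upwards [hev] with t ht'
      rw [← hψF, ψ.right_inv ht']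
    have hFq : ∀ i, F i q = γ s i := fun i => by rw [← hψF, hq, ψ.right_inv (hγt s hs')]
    have aq : a q = s * a y := by
      refine (hFq 0).trans ?_
      simp [hγ, hcdef, d0, z0]
    have bq : b q = s * b y := by
      refine (hFq 1).trans ?_
      simp [hγ, hcdef, d1, z1]
    have w0 : fderiv ℝ a q w = a y := (h3 0).trans d0
    have w1 : fderiv ℝ b q w = b y := (h3 1).trans d1
    have w2 : fderiv ℝ I q w = 0 := (h3 2).trans d2
    have hμq : μ q = κ q + ν q (Y q) := rfl
    have haq : α q (Y q) = a q := rfl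
    have hbq : α' q (Y q) = b q := rfl
    have hYq : Y q = (s * μ q) • w := by
      refine sub_eq_zero.1 (hinj q hqS _ fun i => ?_)
      rw [map_sub, map_smul, smul_eq_mul, sub_eq_zero]
      fin_cases i
      · refine (da hqV _).trans ?_
        change _ = s * μ q * fderiv ℝ a q w
        rw [w0, hY q hqV, haq, hμq, aq]
        ring
      · refine (db hqV _).trans ?_
        change _ = s * μ q * fderiv ℝ b q w
        rw [w1, hY q hqV, hbq, hμq, bq]
        ring
      · refine (dI hqV _).trans ?_
        change _ = s * μ q * fderiv ℝ I q w
        rw [w2, hY q hqV]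
        ring
    obtain ⟨e₁, e₂, e₃, he, -⟩ := h.frame q hqV
    have i1 := hs.integrability h hc hqV (Y q) e₁
    have i2 := hs.integrability h hc hqV (Y q) e₂
    rw [haq, hbq, hY q hqV] at i1 i2
    simp only [he.a₁, he.a₂, he.b₁, he.b₂, he.c₁, he.c₂] at i1 i2
    have hdΛ : fderiv ℝ Λ q (Y q) = s * μ q * fderiv ℝ Λ q w := by
      conv_lhs => rw [hYq]
      rw [map_smul, smul_eq_mul]
    rw [hdΛ, aq, bq] at i1 i2
    have j1 : (μ q * b y) * (s * (s * fderiv ℝ Λ q w + 2 * Λ q)) = 0 := by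
      rw [hμq] at i1 ⊢
      linear_combination -i1
    have j2 : (μ q * a y) * (s * (s * fderiv ℝ Λ q w + 2 * Λ q)) = 0 := by
      rw [hμq] at i2 ⊢
      linear_combination i2
    have j3 : s * (s * fderiv ℝ Λ q w + 2 * Λ q) = 0 := by
      by_cases hay : a y = 0
      · have hby : b y ≠ 0 := fun hby => hab ⟨hay, hby⟩
        exact (mul_eq_zero.1 j1).resolve_left (mul_ne_zero hqS.2.2 hby)
      · exact (mul_eq_zero.1 j2).resolve_left (mul_ne_zero hqS.2.2 hay)
    refine (((hasDerivAt_id s).pow 2).mul h2).congr_deriv ?_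
    simp only [Pi.pow_apply, id]
    push_cast
    linear_combination j3
  have hconst := constant_of_has_deriv_right_zero (a := 0) (b := 1)
    (f := fun s : ℝ => s ^ 2 * Λ (ψ.symm (γ s)))
    (fun t ht' => (key t ht').continuousAt.continuousWithinAt)
    (fun t ht' => (key t (Ico_subset_Icc_self ht')).hasDerivWithinAt) 1 (by simp)
  have hγ1 : γ 1 = z := by simp [hγ, hcdef]
  simp only [hγ1, hz, ψ.left_inv hy] at hconst
  simpa using hconst

end NormalForms

/-! ### The conclusions in coordinates. -/

section FlatConclusions

section

variable {E : Type*} [NormedAddCommGroup E] [NormedSpace ℝ E]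
  {V : Set E} {ε : ℝ} {α α' β ν : E → E →L[ℝ] ℝ} {I J Λ : E → ℝ}

lemma BalancedCoframe.eq_zero_of_apply (h : BalancedCoframe V ε α α' β I J) {x u : E} (hx : x ∈ V)
    (h₁ : α x u = 0) (h₂ : α' x u = 0) (h₃ : β x u = 0) : u = 0 := by
  obtain ⟨e₁, e₂, e₃, he, -⟩ := h.frame x hx
  rw [he.span u, h₁, h₂, h₃]
  simp

lemma FlatSymmetry.combination {Y₁ Y₂ : E → E} (h₁ : FlatSymmetry V α α' Y₁)
    (h₂ : FlatSymmetry V α α' Y₂) (c₁ c₂ : ℝ) :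
    FlatSymmetry V α α' (fun y => c₁ • Y₁ y + c₂ • Y₂ y) := by
  have hd : ∀ x ∈ V, ∀ w, fderiv ℝ (fun y => c₁ • Y₁ y + c₂ • Y₂ y) x w =
      c₁ • fderiv ℝ Y₁ x w + c₂ • fderiv ℝ Y₂ x w := fun x hx w => by
    have t₁ := (h₁.smooth x hx).diff
    have t₂ := (h₂.smooth x hx).diff
    have : HasFDerivAt (fun y => c₁ • Y₁ y + c₂ • Y₂ y) (c₁ • fderiv ℝ Y₁ x + c₂ • fderiv ℝ Y₂ x) x :=
      (t₁.hasFDerivAt.const_smul c₁).add (t₂.hasFDerivAt.const_smul c₂)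
    rw [this.fderiv]
    rfl
  refine ⟨fun x hx => ((h₁.smooth x hx).const_smul c₁).add ((h₂.smooth x hx).const_smul c₂),
    fun x hx w hw => ?_, fun x hx w hw => ?_⟩
  · rw [hd x hx]
    simp only [map_add, map_smul, add_apply, smul_apply, smul_eq_mul]
    linear_combination c₁ * h₁.lie x hx w hw + c₂ * h₂.lie x hx w hw
  · rw [hd x hx]
    simp only [map_add, map_smul, add_apply, smul_apply, smul_eq_mul]
    linear_combination c₁ * h₁.lie' x hx w hw + c₂ * h₂.lie' x hx w hw

/-- A symmetry which is tangent to the axis to the first order at a point is trivial. -/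
lemma FlatSymmetry.eventually_eq_zero {Y : E → E} {κ : E → ℝ} (h : BalancedCoframe V ε α α' β I J)
    (hc : ConnectionForm V ε α α' β I ν Λ) (hY : FlatSymmetry V α α' Y)
    (hs : SymmetrySystem V ε α α' β I ν Λ (fun x => α x (Y x)) (fun x => α' x (Y x)) κ) {x : E}
    (hx : x ∈ V) (ha : α x (Y x) = 0) (hb : α' x (Y x) = 0) (hκ : κ x = 0) :
    ∀ᶠ y in 𝓝 x, Y y = 0 := by
  filter_upwards [hs.eventually_eq_zero h hc hx ha hb hκ, h.nhds_mem hx] with y hy hyV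
  exact h.eq_zero_of_apply hyV hy.1 hy.2 ((hY.exists_system h hc).1 y hyV)

/-- Where `Λ ≠ 0`, any two symmetries are proportional. -/
lemma exists_combination_eq_zero {Y₁ Y₂ : E → E} (h : BalancedCoframe V ε α α' β I J)
    (hc : ConnectionForm V ε α α' β I ν Λ) (h₁ : FlatSymmetry V α α' Y₁)
    (h₂ : FlatSymmetry V α α' Y₂) {m : E} (hm : m ∈ V) (hΛ : Λ m ≠ 0) :
    ∃ c₁ c₂ : ℝ, (c₁ ≠ 0 ∨ c₂ ≠ 0) ∧ ∀ᶠ y in 𝓝 m, c₁ • Y₁ y + c₂ • Y₂ y = 0 := by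
  obtain ⟨-, κ₁, hs₁⟩ := h₁.exists_system h hc
  obtain ⟨-, κ₂, hs₂⟩ := h₂.exists_system h hc
  have hΔ : α m (Y₁ m) * α' m (Y₂ m) - α m (Y₂ m) * α' m (Y₁ m) = 0 := by
    by_contra hne
    exact hΛ (eq_zero_of_two_systems h hc hs₁ hs₂ hm hne)
  obtain ⟨c₁, c₂, hne, ha, hb⟩ : ∃ c₁ c₂ : ℝ, (c₁ ≠ 0 ∨ c₂ ≠ 0) ∧
      c₁ * α m (Y₁ m) + c₂ * α m (Y₂ m) = 0 ∧ c₁ * α' m (Y₁ m) + c₂ * α' m (Y₂ m) = 0 := by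
    by_cases h1 : α m (Y₁ m) = 0 ∧ α m (Y₂ m) = 0
    · by_cases h2 : α' m (Y₁ m) = 0 ∧ α' m (Y₂ m) = 0
      · exact ⟨1, 0, .inl one_ne_zero, by simp [h1.1], by simp [h2.1]⟩
      · refine ⟨α' m (Y₂ m), -α' m (Y₁ m), ?_, by simp [h1.1, h1.2], by ring⟩
        by_contra! hcon
        exact h2 ⟨neg_eq_zero.1 hcon.2, hcon.1⟩
    · refine ⟨α m (Y₂ m), -α m (Y₁ m), ?_, by ring, by linear_combination -hΔ⟩
      by_contra! hcon
      exact h1 ⟨neg_eq_zero.1 hcon.2, hcon.1⟩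
  have hY := h₁.combination h₂ c₁ c₂
  obtain ⟨-, κ, hs⟩ := hY.exists_system h hc
  refine ⟨c₁, c₂, hne, hY.eventually_eq_zero h hc hs hm (by simpa using ha) (by simpa using hb) ?_⟩
  -- For the combination, a = b = 0 at m, so integrability leaves Λκ = 0 there and κ(m) = 0 because
  -- Λ(m) ≠ 0.
  obtain ⟨e₁, e₂, e₃, he, -⟩ := h.frame m hm
  have hint := hs.integrability h hc hm e₁ e₂
  simp only [map_add, map_smul, smul_eq_mul, ha, hb, he.a₁, he.a₂, he.b₁, he.b₂] at hint
  exact (mul_eq_zero.1 (show Λ m * κ m = 0 by linear_combination hint / 2)).resolve_left hΛ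

end

variable {V : Set E3} {ε : ℝ} {α α' β ν : E3 → E3 →L[ℝ] ℝ} {I J Λ : E3 → ℝ}

/-- Normal forms of a pair with a symmetry. -/
lemma FlatSymmetry.flatType {Y : E3 → E3} (h : BalancedCoframe V ε α α' β I J)
    (hc : ConnectionForm V ε α α' β I ν Λ) (hY : FlatSymmetry V α α' Y) {m : E3} (hm : m ∈ V)
    (hne : ¬ ∀ᶠ y in 𝓝 m, Y y = 0) : FlatTypeIII₂ V α α' m ∨ FlatTypeIII₁ V α α' m := by
  obtain ⟨hβ, κ, hs⟩ := hY.exists_system h hc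
  -- As β(Y) = 0, this separates the symmetries with a zero at m from the others. For a zero with
  -- nontrivial germ, κ(m) cannot vanish.
  by_cases hab : α m (Y m) = 0 ∧ α' m (Y m) = 0
  · have hκ : κ m ≠ 0 := fun hκ => hne (hY.eventually_eq_zero h hc hs hm hab.1 hab.2 hκ)
    exact .inl (flatTypeIII₂_of_eq_zero h hc hm (eventually_eq_zero_of_fixed_point h hc hs hβ hm
      (h.eq_zero_of_apply hm hab.1 hab.2 (hβ m hm)) hκ (hY.smooth m hm).continuousAt))
  · refine .inr (flatTypeIII₁_of_symmetry h hc hs hm ?_)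
    by_contra! hcon
    exact hab hcon

/-- A constant vector field whose trajectories leave `ker α` and `ker α'` invariant. -/
lemma flatSymmetry_const (h : BalancedCoframe V ε α α' β I J) {c : E3}
    (hα : ∀ x ∈ V, ∀ w, α x w = 0 → ∀ᶠ t in 𝓝 (0 : ℝ), α (x + t • c) w = 0)
    (hα' : ∀ x ∈ V, ∀ w, α' x w = 0 → ∀ᶠ t in 𝓝 (0 : ℝ), α' (x + t • c) w = 0) :
    FlatSymmetry V α α' (fun _ => c) := by
  have key : ∀ {θ : E3 → E3 →L[ℝ] ℝ} {x w : E3}, DifferentiableAt ℝ θ x →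
      (∀ᶠ t in 𝓝 (0 : ℝ), θ (x + t • c) w = 0) →
      fderiv ℝ θ x c w + θ x (fderiv ℝ (fun _ => c) x w) = 0 := by
    intro θ x w hθ hev
    have h1 : HasDerivAt (fun t : ℝ => x + t • c) c 0 := by
      simpa using ((hasDerivAt_id (0 : ℝ)).smul_const c).const_add x
    have h2 : HasFDerivAt (fun y => θ y w) ((fderiv ℝ θ x).flip w) (x + (0 : ℝ) • c) := by
      rw [zero_smul, add_zero]
      exact (ContinuousLinearMap.apply ℝ ℝ w).hasFDerivAt.comp x hθ.hasFDerivAt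
    have h3 := h2.comp_hasDerivAt 0 h1
    have h4 : HasDerivAt (fun _ : ℝ => (0 : ℝ)) ((fderiv ℝ θ x).flip w c) 0 :=
      h3.congr_of_eventuallyEq (by filter_upwards [hev] with t ht using ht.symm)
    have h5 := h4.unique (hasDerivAt_const (0 : ℝ) (0 : ℝ))
    rw [ContinuousLinearMap.flip_apply] at h5
    simp [h5]
  exact ⟨fun _ _ => contDiffAt_const, fun x hx w hw => key (h.smooth_α x hx).diff (hα x hx w hw),
    fun x hx w hw => key (h.smooth_α' x hx).diff (hα' x hx w hw)⟩

/-- The function `Λ` vanishes for a pair in the form III₂. -/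
lemma eq_zero_of_typeIII₂ (h : BalancedCoframe V ε α α' β I J)
    (hc : ConnectionForm V ε α α' β I ν Λ) {f : ℝ → ℝ}
    (hα : ∀ x ∈ V, ∀ w, α x w = 0 ↔ w 1 = x 2 * w 0)
    (hα' : ∀ x ∈ V, ∀ w, α' x w = 0 ↔ w 1 = f (x 2) * w 0) {x : E3} (hx : x ∈ V) : Λ x = 0 := by
  -- The slopes depend on the third coordinate only, so translations in x and y preserve both
  -- planes.
  have sym : ∀ c : E3, c 2 = 0 → FlatSymmetry V α α' (fun _ => c) := by
    intro c hc2
    have hV : ∀ x ∈ V, ∀ᶠ t in 𝓝 (0 : ℝ), x + t • c ∈ V := fun x hx => by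
      have : ContinuousAt (fun t : ℝ => x + t • c) 0 := by fun_prop
      exact this (by simpa using h.nhds_mem hx)
    refine flatSymmetry_const h (fun x hx w hw => ?_) (fun x hx w hw => ?_)
    · filter_upwards [hV x hx] with t ht
      rw [hα _ ht]
      simpa [hc2] using (hα x hx w).1 hw
    · filter_upwards [hV x hx] with t ht
      rw [hα' _ ht]
      simpa [hc2] using (hα' x hx w).1 hw
  set c₀ : E3 := EuclideanSpace.single 0 1 with hc₀
  set c₁ : E3 := EuclideanSpace.single 1 1 with hc₁
  obtain ⟨z₀, κ₀, s₀⟩ := (sym c₀ (by simp [hc₀])).exists_system h hc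
  obtain ⟨z₁, κ₁, s₁⟩ := (sym c₁ (by simp [hc₁])).exists_system h hc
  refine eq_zero_of_two_systems h hc s₀ s₁ hx fun hΔ => ?_
  have hne : α x c₁ ≠ 0 := fun h0 => by
    have := (hα x hx c₁).1 h0
    simp [hc₁] at this
  -- If Δ were zero, this combination would be killed by α, α' and also β, since β vanishes on
  -- symmetries; but ∂/∂x, ∂/∂y are independent and α(∂/∂y) ≠ 0.
  have h0 := h.eq_zero_of_apply hx (u := α x c₁ • c₀ - α x c₀ • c₁)
    (by simp only [map_sub, map_smul, smul_eq_mul]; ring)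
    (by simp only [map_sub, map_smul, smul_eq_mul]; linear_combination -hΔ)
    (by simp only [map_sub, map_smul, z₀ x hx, z₁ x hx]; simp)
  have h1 : (α x c₁ • c₀ - α x c₀ • c₁ : E3) 0 = 0 := by rw [h0]; rfl
  simp [hc₀, hc₁] at h1
  exact hne h1

end FlatConclusions

/-! ### Pullbacks of 1-forms. -/

section FlatPullback

variable {E F : Type*} [NormedAddCommGroup E] [NormedSpace ℝ E] [NormedAddCommGroup F]
  [NormedSpace ℝ F]

lemma contDiffAt_pullback {θ : F → F →L[ℝ] ℝ} {τ : E → F} {y : E} (hθ : ContDiffAt ℝ ∞ θ (τ y))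
    (hτ : ContDiffAt ℝ ∞ τ y) : ContDiffAt ℝ ∞ (fun z => (θ (τ z)).comp (fderiv ℝ τ z)) y :=
  (hθ.comp y hτ).clm_comp (hτ.fderiv_right (by simp))

/-- The exterior derivative commutes with pullbacks. -/
lemma fd_pullback {θ : F → F →L[ℝ] ℝ} {τ : E → F} {y : E} (hθ : DifferentiableAt ℝ θ (τ y))
    (hτ : ContDiffAt ℝ ∞ τ y) (u v : E) :
    fd (fun z => (θ (τ z)).comp (fderiv ℝ τ z)) y u v =
      fd θ (τ y) (fderiv ℝ τ y u) (fderiv ℝ τ y v) := by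
  have h1 : ContDiffAt ℝ ∞ (fderiv ℝ τ) y := hτ.fderiv_right (by simp)
  have h2 : IsSymmSndFDerivAt ℝ τ y := hτ.isSymmSndFDerivAt (by simpa using two_le_infty)
  have h3 : HasFDerivAt (fun z => θ (τ z)) _ y := hθ.hasFDerivAt.comp y hτ.diff.hasFDerivAt
  have h4 := h3.clm_comp h1.diff.hasFDerivAt
  rw [fd, h4.fderiv, fd]
  simp only [add_apply, ContinuousLinearMap.comp_apply, ContinuousLinearMap.compL_apply,
    ContinuousLinearMap.flip_apply]
  rw [h2.eq u v]
  ring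

end FlatPullback

/-! ### Coordinate expressions on the manifold. -/

section Charts

variable {M : Type*} [TopologicalSpace M] [ChartedSpace E3 M] [IsManifold 𝓘(ℝ, E3) ∞ M]
  {e e' : OpenPartialHomeomorph M E3}

/-- The differential of a chart. -/
noncomputable def dchart (e : OpenPartialHomeomorph M E3) (x : M) : E3 →L[ℝ] E3 :=
  mfderiv 𝓘(ℝ, E3) 𝓘(ℝ, E3) e x

/-- The differential of the inverse of a chart. -/
noncomputable def dchartSymm (e : OpenPartialHomeomorph M E3) (y : E3) : E3 →L[ℝ] E3 :=
  mfderiv 𝓘(ℝ, E3) 𝓘(ℝ, E3) e.symm y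

/-- The value of a 1-form, as a linear form on the model space. -/
noncomputable def OneForm.val (α : OneForm M) (x : M) : E3 →L[ℝ] ℝ := α x

/-- The exterior derivative of a 1-form, as a function on the model space. -/
noncomputable def OneForm.dval (α : OneForm M) (x : M) (u v : E3) : ℝ := α.d x u v

/-- The coordinate expression of a 1-form in a chart. -/
noncomputable def OneForm.pull (α : OneForm M) (e : OpenPartialHomeomorph M E3) (y : E3) :
    E3 →L[ℝ] ℝ :=
  (α.val (e.symm y)).comp (dchartSymm e y)

lemma OneForm.pull_apply (α : OneForm M) (e : OpenPartialHomeomorph M E3) (y u : E3) :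
    α.pull e y u = α.val (e.symm y) (dchartSymm e y u) := rfl

lemma infty_ne_zero : (∞ : WithTop ℕ∞) ≠ 0 := by simp

lemma mdifferentiable_chart (he : e ∈ IsManifold.maximalAtlas 𝓘(ℝ, E3) ∞ M) :
    e.MDifferentiable 𝓘(ℝ, E3) 𝓘(ℝ, E3) :=
  ⟨(contMDiffOn_of_mem_maximalAtlas he).mdifferentiableOn infty_ne_zero,
    (contMDiffOn_symm_of_mem_maximalAtlas he).mdifferentiableOn infty_ne_zero⟩

lemma dchart_dchartSymm (he : e ∈ IsManifold.maximalAtlas 𝓘(ℝ, E3) ∞ M) {y : E3}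
    (hy : y ∈ e.target) (u : E3) : dchart e (e.symm y) (dchartSymm e y u) = u :=
  DFunLike.congr_fun ((mdifferentiable_chart he).comp_symm_deriv hy) u

lemma dchartSymm_dchart (he : e ∈ IsManifold.maximalAtlas 𝓘(ℝ, E3) ∞ M) {x : M}
    (hx : x ∈ e.source) (u : E3) : dchartSymm e (e x) (dchart e x u) = u :=
  DFunLike.congr_fun ((mdifferentiable_chart he).symm_comp_deriv hx) u

lemma dchartSymm_dchart' (he : e ∈ IsManifold.maximalAtlas 𝓘(ℝ, E3) ∞ M) {y : E3}
    (hy : y ∈ e.target) (u : E3) : dchartSymm e y (dchart e (e.symm y) u) = u := by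
  have := dchartSymm_dchart he (e.map_target hy) u
  rwa [e.right_inv hy] at this

lemma contDiffAt_transition (he : e ∈ IsManifold.maximalAtlas 𝓘(ℝ, E3) ∞ M)
    (he' : e' ∈ IsManifold.maximalAtlas 𝓘(ℝ, E3) ∞ M) {y : E3} (hy : y ∈ e.target)
    (hy' : e.symm y ∈ e'.source) : ContDiffAt ℝ ∞ (fun z => e' (e.symm z)) y :=
  contMDiffAt_iff_contDiffAt.1 ((contMDiffAt_of_mem_maximalAtlas he' hy').comp y
    (contMDiffAt_symm_of_mem_maximalAtlas he hy))

lemma eventually_mem_source {y : E3} (hy : y ∈ e.target) {s : Set M} (hs : s ∈ 𝓝 (e.symm y)) :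
    ∀ᶠ z in 𝓝 y, z ∈ e.target ∧ e.symm z ∈ s :=
  Filter.inter_mem (e.open_target.mem_nhds hy) ((e.continuousAt_symm hy) hs)

lemma dchartSymm_comp (he : e ∈ IsManifold.maximalAtlas 𝓘(ℝ, E3) ∞ M)
    (he' : e' ∈ IsManifold.maximalAtlas 𝓘(ℝ, E3) ∞ M) {y : E3} (hy : y ∈ e.target)
    (hy' : e.symm y ∈ e'.source) (u : E3) :
    dchartSymm e y u = dchartSymm e' (e' (e.symm y)) (fderiv ℝ (fun z => e' (e.symm z)) y u) := by
  have h1 : e.symm =ᶠ[𝓝 y] e'.symm ∘ fun z => e' (e.symm z) := by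
    filter_upwards [eventually_mem_source hy (e'.open_source.mem_nhds hy')] with z hz
    exact (e'.left_inv hz.2).symm
  have h2 : HasMFDerivAt 𝓘(ℝ, E3) 𝓘(ℝ, E3) (fun z => e' (e.symm z)) y
      (fderiv ℝ (fun z => e' (e.symm z)) y) :=
    (contDiffAt_transition he he' hy hy').diff.hasFDerivAt.hasMFDerivAt
  have h3 : HasMFDerivAt 𝓘(ℝ, E3) 𝓘(ℝ, E3) e'.symm (e' (e.symm y))
      (dchartSymm e' (e' (e.symm y))) :=
    ((mdifferentiable_chart he').mdifferentiableAt_symm (e'.map_source hy')).hasMFDerivAt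
  have h4 := ((h3.comp y h2).congr_of_eventuallyEq h1).mfderiv
  exact DFunLike.congr_fun h4 u

lemma OneForm.pull_eventuallyEq (α : OneForm M) (he : e ∈ IsManifold.maximalAtlas 𝓘(ℝ, E3) ∞ M)
    (he' : e' ∈ IsManifold.maximalAtlas 𝓘(ℝ, E3) ∞ M) {y : E3} (hy : y ∈ e.target)
    (hy' : e.symm y ∈ e'.source) : α.pull e =ᶠ[𝓝 y] fun z =>
      (α.pull e' (e' (e.symm z))).comp (fderiv ℝ (fun z => e' (e.symm z)) z) := by
  filter_upwards [eventually_mem_source hy (e'.open_source.mem_nhds hy')] with z hz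
  ext u
  rw [ContinuousLinearMap.comp_apply, pull_apply, pull_apply, dchartSymm_comp he he' hz.1 hz.2,
    e'.left_inv hz.2]

/-- The manifold derivative into M is by construction computed in the preferred chart at the image
point. This matches the choice of chart in `OneForm.d`. -/
lemma fderiv_transition (he : e ∈ IsManifold.maximalAtlas 𝓘(ℝ, E3) ∞ M) {y : E3}
    (hy : y ∈ e.target) (u : E3) :
    fderiv ℝ (fun z => chartAt E3 (e.symm y) (e.symm z)) y u = dchartSymm e y u := by
  have h : MDifferentiableAt 𝓘(ℝ, E3) 𝓘(ℝ, E3) e.symm y :=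
    (mdifferentiable_chart he).mdifferentiableAt_symm hy
  have h2 : HasFDerivWithinAt (fun z => chartAt E3 (e.symm y) (e.symm z)) (dchartSymm e y)
    (range (id : E3 → E3)) y := h.hasMFDerivAt.2
  rw [range_id, hasFDerivWithinAt_univ] at h2
  rw [h2.fderiv]

lemma OneForm.SmoothOn.contDiffAt_pull {α : OneForm M} {U : Set M} (hα : α.SmoothOn U)
    (he : e ∈ IsManifold.maximalAtlas 𝓘(ℝ, E3) ∞ M) {y : E3} (hy : y ∈ e.target)
    (hyU : e.symm y ∈ U) : ContDiffAt ℝ ∞ (α.pull e) y := by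
  have hc : chartAt E3 (e.symm y) ∈ IsManifold.maximalAtlas 𝓘(ℝ, E3) ∞ M :=
    IsManifold.chart_mem_maximalAtlas _
  have hs := mem_chart_source E3 (e.symm y)
  refine ContDiffAt.congr_of_eventuallyEq ?_ (α.pull_eventuallyEq he hc hy hs)
  exact contDiffAt_pullback (hα _ hyU) (contDiffAt_transition he hc hy hs)

/-- `OneForm.d` changes chart from point to point; since d commutes with the transition maps, any
one chart of the maximal atlas computes it on its whole target. -/
lemma OneForm.SmoothOn.fd_pull {α : OneForm M} {U : Set M} (hα : α.SmoothOn U)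
    (he : e ∈ IsManifold.maximalAtlas 𝓘(ℝ, E3) ∞ M) {y : E3} (hy : y ∈ e.target)
    (hyU : e.symm y ∈ U) (u v : E3) :
    fd (α.pull e) y u v = α.dval (e.symm y) (dchartSymm e y u) (dchartSymm e y v) := by
  have hc : chartAt E3 (e.symm y) ∈ IsManifold.maximalAtlas 𝓘(ℝ, E3) ∞ M :=
    IsManifold.chart_mem_maximalAtlas _
  have hs := mem_chart_source E3 (e.symm y)
  have hd : DifferentiableAt ℝ (α.pull (chartAt E3 (e.symm y))) (chartAt E3 (e.symm y) (e.symm y)) :=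
    (hα _ hyU).diff
  rw [fd_congr (α.pull_eventuallyEq he hc hy hs),
    fd_pullback (τ := fun z => chartAt E3 (e.symm y) (e.symm z)) hd (contDiffAt_transition he hc hy hs), fderiv_transition he hy,
    fderiv_transition he hy]
  rfl

lemma fderiv_comp_chart_symm {f : M → ℝ} (he : e ∈ IsManifold.maximalAtlas 𝓘(ℝ, E3) ∞ M) {y : E3}
    (hy : y ∈ e.target) (hf : DifferentiableAt ℝ (fun z => f (e.symm z)) y) (u : E3) :
    fderiv ℝ (fun z => f (e.symm z)) y u = (dfun f).val (e.symm y) (dchartSymm e y u) := by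
  have h1 : HasMFDerivAt 𝓘(ℝ, E3) 𝓘(ℝ, ℝ) (fun z => f (e.symm z)) (e (e.symm y))
      (fderiv ℝ (fun z => f (e.symm z)) y) := by
    rw [e.right_inv hy]
    exact hf.hasFDerivAt.hasMFDerivAt
  have hx := e.map_target hy
  have h2 : HasMFDerivAt 𝓘(ℝ, E3) 𝓘(ℝ, E3) e (e.symm y) (dchart e (e.symm y)) :=
    ((mdifferentiable_chart he).mdifferentiableAt hx).hasMFDerivAt
  have h3 : f =ᶠ[𝓝 (e.symm y)] (fun z => f (e.symm z)) ∘ e := by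
    filter_upwards [e.open_source.mem_nhds hx] with z hz
    rw [Function.comp_apply, e.left_inv hz]
  have h4 := DFunLike.congr_fun ((h1.comp (e.symm y) h2).congr_of_eventuallyEq h3).mfderiv
    (dchartSymm e y u)
  refine Eq.trans ?_ h4.symm
  change _ = fderiv ℝ (fun z => f (e.symm z)) y (dchart e (e.symm y) (dchartSymm e y u))
  rw [dchart_dchartSymm he hy]

end Charts

/-! ### The coframe of balanced contact forms, and Lie derivatives from flows. -/

section Construction

/-- The value `(θ ∧ dη)(u, v, w)`. -/
noncomputable def fwedged {E : Type*} [NormedAddCommGroup E] [NormedSpace ℝ E]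
    (θ η : E → E →L[ℝ] ℝ) (x u v w : E) : ℝ :=
  θ x u * fd η x v w - θ x v * fd η x u w + θ x w * fd η x u v

lemma contDiffAt_fwedged {E : Type*} [NormedAddCommGroup E] [NormedSpace ℝ E]
    {θ η : E → E →L[ℝ] ℝ} {x : E} (hθ : ContDiffAt ℝ ∞ θ x) (hη : ContDiffAt ℝ ∞ η x) (u v w : E) :
    ContDiffAt ℝ ∞ (fun y => fwedged θ η y u v w) x :=
  (((hθ.clm_apply contDiffAt_const).mul (contDiffAt_fd hη v w)).sub
    ((hθ.clm_apply contDiffAt_const).mul (contDiffAt_fd hη u w))).add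
    ((hθ.clm_apply contDiffAt_const).mul (contDiffAt_fd hη u v))

lemma isDualFrame_of_apply {a b c : E3 →L[ℝ] ℝ} {e₁ e₂ e₃ : E3} (a₁ : a e₁ = 1) (a₂ : a e₂ = 0)
    (a₃ : a e₃ = 0) (b₁ : b e₁ = 0) (b₂ : b e₂ = 1) (b₃ : b e₃ = 0) (c₁ : c e₁ = 0) (c₂ : c e₂ = 0)
    (c₃ : c e₃ = 1) : IsDualFrame a b c e₁ e₂ e₃ := by
  refine ⟨a₁, a₂, a₃, b₁, b₂, b₃, c₁, c₂, c₃, fun u => ?_⟩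
  set L : E3 →ₗ[ℝ] (Fin 3 → ℝ) := LinearMap.pi ![a.toLinearMap, b.toLinearMap, c.toLinearMap]
  have hL : ∀ v, L v = ![a v, b v, c v] := fun v => by ext i; fin_cases i <;> rfl
  have hs : Function.Surjective L := fun z => by
    refine ⟨z 0 • e₁ + z 1 • e₂ + z 2 • e₃, ?_⟩
    rw [hL]
    ext i
    fin_cases i <;> simp [a₁, a₂, a₃, b₁, b₂, b₃, c₁, c₂, c₃]
  have hi : Function.Injective L :=
    (LinearMap.injective_iff_surjective_of_finrank_eq_finrank (by simp)).2 hs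
  apply hi
  rw [hL, hL]
  simp [a₁, a₂, a₃, b₁, b₂, b₃, c₁, c₂, c₃]

lemma IsDualFrame.fwedged_self {E : Type*} [NormedAddCommGroup E] [NormedSpace ℝ E]
    {θ θ' : E → E →L[ℝ] ℝ} {β : E →L[ℝ] ℝ} {y e₁ e₂ e₃ : E}
    (h : IsDualFrame (θ y) (θ' y) β e₁ e₂ e₃) (h1 : fd θ y e₂ e₃ = 1) (u v w : E) :
    fwedged θ θ y u v w = θ y u * (θ' y v * β w - θ' y w * β v) -
      θ y v * (θ' y u * β w - θ' y w * β u) + θ y w * (θ' y u * β v - θ' y v * β u) := by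
  rw [fwedged, h.fd_apply θ y v w, h.fd_apply θ y u w, h.fd_apply θ y u v, h1]
  ring

/-- The coframe of a pair of balanced contact forms with normalized field `X`. -/
lemma exists_dualFrame {θ θ' : E3 → E3 →L[ℝ] ℝ} {ε i : ℝ} {x : E3} {y : E3} {β : E3 →L[ℝ] ℝ}
    (hε : ε * ε = 1) (hβ : β x = 1) (hind : ∃ u v, θ y u * θ' y v - θ y v * θ' y u ≠ 0)
    (hbal : ∀ u v w, fwedged θ θ y u v w = ε * fwedged θ' θ' y u v w)
    (hX : ∀ v w, fwedged θ θ y x v w = θ y v * θ' y w - θ y w * θ' y v)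
    (hI : ∀ u v w, i * fwedged θ θ y u v w = fwedged θ θ' y u v w + fwedged θ' θ y u v w) :
    ∃ e₁ e₂, IsDualFrame (θ y) (θ' y) β e₁ e₂ x ∧ fd θ y e₂ x = 1 ∧ fd θ' y x e₁ = ε ∧
      i = fd θ' y e₂ x + fd θ y x e₁ := by
  obtain ⟨u, v, hD⟩ := hind
  set D := θ y u * θ' y v - θ y v * θ' y u with hDdef
  -- Inserting the normalized vector twice into θ ∧ dθ gives zero; with θ, θ' independent, this
  -- places it on the axis.
  have hXX : ∀ w, θ y x * θ' y w - θ y w * θ' y x = 0 := fun w => by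
    rw [← hX, fwedged, fd_self]; ring
  have x0 : θ y x = 0 := (mul_eq_zero.1 (show θ y x * D = 0 by
    rw [hDdef]; linear_combination θ y u * hXX v - θ y v * hXX u)).resolve_right hD
  have x1 : θ' y x = 0 := (mul_eq_zero.1 (show θ' y x * D = 0 by
    rw [hDdef]; linear_combination θ' y u * hXX v - θ' y v * hXX u)).resolve_right hD
  obtain ⟨f₁, hf₁, hf₁'⟩ : ∃ f, θ y f = 1 ∧ θ' y f = 0 := by
    refine ⟨D⁻¹ • (θ' y v • u - θ' y u • v), ?_, ?_⟩
    · simp only [map_sub, map_smul, smul_eq_mul]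
      rw [inv_mul_eq_one₀ hD, hDdef]
      ring
    · simp only [map_sub, map_smul, smul_eq_mul]
      ring
  obtain ⟨f₂, hf₂, hf₂'⟩ : ∃ f, θ y f = 0 ∧ θ' y f = 1 := by
    refine ⟨D⁻¹ • (θ y u • v - θ y v • u), ?_, ?_⟩
    · simp only [map_sub, map_smul, smul_eq_mul]
      ring
    · simp only [map_sub, map_smul, smul_eq_mul]
      rw [inv_mul_eq_one₀ hD, hDdef]
  -- Subtracting multiples of the axis vector adjusts β without changing θ and θ'.
  have hfr : IsDualFrame (θ y) (θ' y) β (f₁ - β f₁ • x) (f₂ - β f₂ • x) x :=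
    isDualFrame_of_apply (by simp [hf₁, x0]) (by simp [hf₂, x0]) x0 (by simp [hf₁', x1])
      (by simp [hf₂', x1]) x1 (by simp [hβ]) (by simp [hβ]) hβ
  set e₁ := f₁ - β f₁ • x
  set e₂ := f₂ - β f₂ • x
  have k1 : fd θ y e₂ x = 1 := by
    have := hX e₁ e₂
    simp only [fwedged, hfr.a₁, hfr.a₂, hfr.b₁, hfr.b₂, x0] at this
    rw [fd_swap]
    linear_combination this
  have hvol : fwedged θ θ y e₁ e₂ x = 1 := by
    simp only [fwedged, hfr.a₁, hfr.a₂, x0, k1]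
    ring
  refine ⟨e₁, e₂, hfr, k1, ?_, ?_⟩
  · have := hbal e₁ e₂ x
    rw [hvol] at this
    simp only [fwedged, hfr.b₁, hfr.b₂, x1] at this
    rw [fd_swap]
    linear_combination -ε * this + fd θ' y e₁ x * hε
  · have := hI e₁ e₂ x
    rw [hvol] at this
    simp only [fwedged, hfr.a₁, hfr.a₂, x0, hfr.b₁, hfr.b₂, x1] at this
    rw [fd_swap θ y x]
    linear_combination this

/-- Balanced contact forms whose generating invariant satisfies `I' = F(I) ≠ 0`, in coordinates. -/
lemma BalancedCoframe.of_normalized {V : Set E3} {ε : ℝ} {θ θ' : E3 → E3 →L[ℝ] ℝ} {X : E3 → E3}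
    {I : E3 → ℝ} (hV : IsOpen V) (hε : ε * ε = 1) (hθ : ∀ y ∈ V, ContDiffAt ℝ ∞ θ y)
    (hθ' : ∀ y ∈ V, ContDiffAt ℝ ∞ θ' y)
    (hI : ∀ y ∈ V, ContDiffAt ℝ ∞ I y)
    (hind : ∀ y ∈ V, ∃ u v, θ y u * θ' y v - θ y v * θ' y u ≠ 0)
    (hbal : ∀ y ∈ V, ∀ u v w, fwedged θ θ y u v w = ε * fwedged θ' θ' y u v w)
    (hX : ∀ y ∈ V, ∀ v w, fwedged θ θ y (X y) v w = θ y v * θ' y w - θ y w * θ' y v)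
    (hgen : ∀ y ∈ V, ∀ u v w,
      I y * fwedged θ θ y u v w = fwedged θ θ' y u v w + fwedged θ' θ y u v w)
    (hJ : ∀ y ∈ V, fderiv ℝ I y (X y) ≠ 0)
    (hdep : ∃ F : ℝ → ℝ, ∀ y ∈ V, fderiv ℝ I y (X y) = F (I y)) :
    BalancedCoframe V ε θ θ' (fun y => (fderiv ℝ I y (X y))⁻¹ • fderiv ℝ I y) I
      (fun y => fderiv ℝ I y (X y)) := by
  have hfr : ∀ y ∈ V, ∃ e₁ e₂, IsDualFrame (θ y) (θ' y) ((fderiv ℝ I y (X y))⁻¹ • fderiv ℝ I y)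
      e₁ e₂ (X y) ∧ fd θ y e₂ (X y) = 1 ∧ fd θ' y (X y) e₁ = ε ∧
      I y = fd θ' y e₂ (X y) + fd θ y (X y) e₁ := fun y hy =>
    exists_dualFrame hε (by simp [hJ y hy]) (hind y hy) (hbal y hy) (hX y hy) (hgen y hy)
  have hdI : ∀ y ∈ V, ContDiffAt ℝ ∞ (fderiv ℝ I) y := fun y hy => (hI y hy).fderiv_right (by simp)
  -- No smoothness of X is assumed: J is the ratio of θ ∧ θ' ∧ dI to θ ∧ dθ = θ ∧ θ' ∧ β.
  have smooth_J : ∀ y ∈ V, ContDiffAt ℝ ∞ (fun y => fderiv ℝ I y (X y)) y := by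
    intro y hy
    obtain ⟨e₁, e₂, he, h1, -⟩ := hfr y hy
    have s1 : ∀ u, ContDiffAt ℝ ∞ (fun z => fderiv ℝ I z u) y :=
      fun u => (hdI y hy).clm_apply contDiffAt_const
    have s2 : ∀ u, ContDiffAt ℝ ∞ (fun z => θ z u) y := fun u => (hθ y hy).clm_apply contDiffAt_const
    have s3 : ∀ u, ContDiffAt ℝ ∞ (fun z => θ' z u) y :=
      fun u => (hθ' y hy).clm_apply contDiffAt_const
    have s4 : ∀ u v w : E3, ContDiffAt ℝ ∞ (fun z => θ z u * (θ' z v * fderiv ℝ I z w -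
        θ' z w * fderiv ℝ I z v)) y :=
      fun u v w => (s2 u).mul (((s3 v).mul (s1 w)).sub ((s3 w).mul (s1 v)))
    refine contDiffAt_of_mul_eq (contDiffAt_fwedged (hθ y hy) (hθ y hy) e₁ e₂ (X y))
      (((s4 e₁ e₂ (X y)).sub (s4 e₂ e₁ (X y))).add (s4 (X y) e₁ e₂)) ?_ ?_
    · rw [he.fwedged_self h1]
      simp only [he.a₁, he.a₂, he.a₃, he.b₁, he.b₂, he.b₃, he.c₁, he.c₂, he.c₃]
      norm_num
    · filter_upwards [hV.mem_nhds hy] with z hz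
      obtain ⟨e₁', e₂', he', h1', -⟩ := hfr z hz
      rw [he'.fwedged_self h1']
      simp only [smul_apply, smul_eq_mul]
      field_simp [hJ z hz]
  refine ⟨hV, fun h => by simp [h] at hε, hθ, hθ', fun y hy => ?_, hI, smooth_J, hJ, fun y hy => ?_,
    hdep, fun y hy => ?_⟩
  · exact ((smooth_J y hy).inv (hJ y hy)).smul (hdI y hy)
  · rw [smul_smul, mul_inv_cancel₀ (hJ y hy), one_smul]
  · obtain ⟨e₁, e₂, h⟩ := hfr y hy
    exact ⟨e₁, e₂, X y, h⟩

lemma contDiffAt_generatingInvariant {θ θ' : E3 → E3 →L[ℝ] ℝ} {I : E3 → ℝ} {y u v w : E3}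
    (hθ : ContDiffAt ℝ ∞ θ y) (hθ' : ContDiffAt ℝ ∞ θ' y) (h0 : fwedged θ θ y u v w ≠ 0)
    (hgen : ∀ᶠ z in 𝓝 y, I z * fwedged θ θ z u v w = fwedged θ θ' z u v w + fwedged θ' θ z u v w) :
    ContDiffAt ℝ ∞ I y :=
  contDiffAt_of_mul_eq (contDiffAt_fwedged hθ hθ u v w)
    ((contDiffAt_fwedged hθ hθ' u v w).add (contDiffAt_fwedged hθ' hθ u v w)) h0 hgen

/-- ν ∧ α determines ν modulo α and ν ∧ α' determines it modulo α', so together they determine ν.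
This is what glues the local connection forms. -/
lemma BalancedCoframe.connection_unique {E : Type*} [NormedAddCommGroup E] [NormedSpace ℝ E]
    {V : Set E} {ε : ℝ} {α α' β : E → E →L[ℝ] ℝ} {I J : E → ℝ}
    (h : BalancedCoframe V ε α α' β I J) {x : E} (hx : x ∈ V) {n n' : E →L[ℝ] ℝ}
    (h₁ : ∀ u v, n u * α x v - n v * α x u = n' u * α x v - n' v * α x u)
    (h₂ : ∀ u v, n u * α' x v - n v * α' x u = n' u * α' x v - n' v * α' x u) : n = n' := by
  obtain ⟨e₁, e₂, e₃, he, -⟩ := h.frame x hx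
  have k1 := h₁ e₂ e₁
  have k2 := h₂ e₁ e₂
  have k3 := h₁ e₃ e₁
  simp only [he.a₁, he.a₂, he.b₁, he.b₂, he.a₃] at k1 k2 k3
  exact he.ext (by linear_combination k2) (by linear_combination k1) (by linear_combination k3)

lemma BalancedCoframe.mono {E : Type*} [NormedAddCommGroup E] [NormedSpace ℝ E]
    {V V' : Set E} {ε : ℝ} {α α' β : E → E →L[ℝ] ℝ} {I J : E → ℝ}
    (h : BalancedCoframe V ε α α' β I J) (hV : IsOpen V') (hs : V' ⊆ V) :
    BalancedCoframe V' ε α α' β I J :=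
  ⟨hV, h.sign, fun x hx => h.smooth_α x (hs hx), fun x hx => h.smooth_α' x (hs hx),
    fun x hx => h.smooth_β x (hs hx), fun x hx => h.smooth_I x (hs hx),
    fun x hx => h.smooth_J x (hs hx), fun x hx => h.J_ne x (hs hx), fun x hx => h.dI x (hs hx),
    h.dep.imp fun _ hF x hx => hF x (hs hx), fun x hx => h.frame x (hs hx)⟩

lemma ConnectionForm.mono {E : Type*} [NormedAddCommGroup E] [NormedSpace ℝ E]
    {V V' : Set E} {ε : ℝ} {α α' β ν : E → E →L[ℝ] ℝ} {I Λ : E → ℝ}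
    (h : ConnectionForm V ε α α' β I ν Λ) (hs : V' ⊆ V) : ConnectionForm V' ε α α' β I ν Λ :=
  ⟨fun x hx => h.smooth x (hs hx), fun x hx => h.dα x (hs hx), fun x hx => h.dα' x (hs hx),
    fun x hx => h.dν x (hs hx)⟩

/-- A vector field whose flow `Ψ` preserves the field of planes `ker θ`. -/
lemma lie_eq_zero_of_flow {E : Type*} [NormedAddCommGroup E] [NormedSpace ℝ E]
    {θ : E → E →L[ℝ] ℝ} {Y : E → E} {Ψ : ℝ × E → E} {y w : E} (hθ : DifferentiableAt ℝ θ y)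
    (hΨ : ContDiffAt ℝ ∞ Ψ (0, y)) (h0 : ∀ᶠ z in 𝓝 y, Ψ (0, z) = z)
    (hY : ∀ᶠ z in 𝓝 y, fderiv ℝ Ψ (0, z) (1, 0) = Y z)
    (hker : ∀ᶠ t in 𝓝 (0 : ℝ), θ (Ψ (t, y)) (fderiv ℝ Ψ (t, y) (0, w)) = 0) :
    fderiv ℝ θ y (Y y) w + θ y (fderiv ℝ Y y w) = 0 := by
  have e0 : Ψ (0, y) = y := h0.self_of_nhds
  have eY : fderiv ℝ Ψ (0, y) (1, 0) = Y y := hY.self_of_nhds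
  have hd : ContDiffAt ℝ ∞ (fderiv ℝ Ψ) (0, y) := hΨ.fderiv_right (by simp)
  have hsymm : IsSymmSndFDerivAt ℝ Ψ (0, y) := hΨ.isSymmSndFDerivAt (by simpa using two_le_infty)
  have i1 : HasDerivAt (fun t : ℝ => (t, y)) ((1 : ℝ), (0 : E)) 0 :=
    (hasDerivAt_id (0 : ℝ)).prodMk (hasDerivAt_const _ _)
  have i2 : HasFDerivAt (fun z : E => ((0 : ℝ), z)) (ContinuousLinearMap.inr ℝ ℝ E) y :=
    (hasFDerivAt_const _ _).prodMk (hasFDerivAt_id y)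
  have w1 : fderiv ℝ Ψ (0, y) (0, w) = w := by
    have h1 : HasFDerivAt (fun z : E => Ψ (0, z)) _ y := hΨ.diff.hasFDerivAt.comp y i2
    have h2 : HasFDerivAt (fun z : E => Ψ (0, z)) (ContinuousLinearMap.id ℝ E) y :=
      (hasFDerivAt_id y).congr_of_eventuallyEq h0
    exact DFunLike.congr_fun (h1.unique h2) w
  have w2 : fderiv ℝ Y y w = fderiv ℝ (fderiv ℝ Ψ) (0, y) (0, w) (1, 0) := by
    have h1 : HasFDerivAt (fun z : E => fderiv ℝ Ψ (0, z)) _ y := hd.diff.hasFDerivAt.comp y i2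
    have h2 := h1.clm_apply (hasFDerivAt_const ((1 : ℝ), (0 : E)) y)
    have h3 := h2.congr_of_eventuallyEq (show Y =ᶠ[𝓝 y] _ from hY.mono fun z hz => hz.symm)
    rw [h3.fderiv]
    simp
  have g1 : HasDerivAt (fun t : ℝ => Ψ (t, y)) (Y y) 0 := by
    rw [← eY]
    exact hΨ.diff.hasFDerivAt.comp_hasDerivAt 0 i1
  -- Symmetry of the mixed second derivative: the time derivative of the differential of the flow is
  -- the differential of Y. The claim is then the product rule for θ(Ψ_t(y))(DΨ_t w) = 0.
  have g2 : HasDerivAt (fun t : ℝ => fderiv ℝ Ψ (t, y) (0, w)) (fderiv ℝ Y y w) 0 := by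
    have h1 : HasDerivAt (fun t : ℝ => fderiv ℝ Ψ (t, y)) _ 0 :=
      hd.diff.hasFDerivAt.comp_hasDerivAt 0 i1
    have h2 := h1.clm_apply (hasDerivAt_const (0 : ℝ) ((0 : ℝ), w))
    rw [w2, ← hsymm.eq]
    simpa using h2
  have g3 : HasDerivAt (fun t : ℝ => θ (Ψ (t, y))) (fderiv ℝ θ y (Y y)) 0 :=
    (show HasFDerivAt θ _ (Ψ (0, y)) from e0.symm ▸ hθ.hasFDerivAt).comp_hasDerivAt 0 g1
  have g4 := (g3.clm_apply g2).congr_of_eventuallyEq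
    (show (fun _ : ℝ => (0 : ℝ)) =ᶠ[𝓝 0] _ from hker.mono fun t ht => ht.symm)
  have g5 := g4.unique (hasDerivAt_const (0 : ℝ) (0 : ℝ))
  rwa [w1, e0] at g5

end Construction

/-! ### From the manifold to coordinates, and gluing of ν. -/

section Transfer

variable {M : Type*} [TopologicalSpace M] [ChartedSpace E3 M] [IsManifold 𝓘(ℝ, E3) ∞ M]
  {P : ContactPair M} {e : OpenPartialHomeomorph M E3} {U : Set M} {ε : ℝ} {α α' ν : OneForm M}
  {X : VField M} {I Λ : M → ℝ}

/-- The coordinate expression of a vector field in a chart. -/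
noncomputable def VField.push (X : VField M) (e : OpenPartialHomeomorph M E3) (y : E3) : E3 :=
  dchart e (e.symm y) (X (e.symm y))

/-- The coordinate expression of the 1-form `dI / I'`. -/
noncomputable def logForm (X : VField M) (I : M → ℝ) (e : OpenPartialHomeomorph M E3) (y : E3) :
    E3 →L[ℝ] ℝ :=
  (fderiv ℝ (fun z => I (e.symm z)) y (X.push e y))⁻¹ • fderiv ℝ (fun z => I (e.symm z)) y

lemma dchartSymm_push (he : e ∈ IsManifold.maximalAtlas 𝓘(ℝ, E3) ∞ M) {y : E3}
    (hy : y ∈ e.target) : dchartSymm e y (X.push e y) = X (e.symm y) :=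
  dchartSymm_dchart' he hy _

lemma IsContact.ne_top {ξ : PlaneField M} (h : IsContact ξ) (x : M) : ξ x ≠ ⊤ := fun ht => by
  obtain ⟨U, -, hx, α, -, hα⟩ := h x
  obtain ⟨hker, u, v, w, hne⟩ := hα x hx
  have h0 : ∀ v, α x v = 0 := fun v => (hker v).1 (ht ▸ Submodule.mem_top)
  exact hne (by simp [wedged, h0])

/-- Both planes are proper and together span the tangent space, so each contains a vector outside
the other; such a pair of vectors detects α ∧ α'. -/
lemma ContactPair.IsBalancedOn.exists_wedge_ne_zero (h : P.IsBalancedOn U ε α α' X) {x : M}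
    (hx : x ∈ U) : ∃ u v, wedge α α' x u v ≠ 0 := by
  have key : ∀ v, ∃ s ∈ P.ξ x, ∃ s' ∈ P.ξ' x, s + s' = v := fun v =>
    Submodule.mem_sup.1 (P.transverse x ▸ Submodule.mem_top)
  obtain ⟨u, -, hu⟩ := SetLike.exists_of_lt (P.contact.ne_top x).lt_top
  obtain ⟨v, -, hv⟩ := SetLike.exists_of_lt (P.contact'.ne_top x).lt_top
  obtain ⟨s, hs, s', hs', rfl⟩ := key u
  obtain ⟨t, ht, t', ht', rfl⟩ := key v
  have h1 : s' ∉ P.ξ x := fun h => hu (add_mem hs h)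
  have h2 : t ∉ P.ξ' x := fun h => hv (add_mem h ht')
  rw [h.ker x hx] at h1 ht
  rw [h.ker' x hx] at h2 hs'
  exact ⟨s', t, by simp [wedge, ht, h1, h2]⟩

lemma fwedged_pull {θ η : OneForm M} (hη : η.SmoothOn U)
    (he : e ∈ IsManifold.maximalAtlas 𝓘(ℝ, E3) ∞ M) {y : E3} (hy : y ∈ e.target)
    (hyU : e.symm y ∈ U) (u v w : E3) : fwedged (θ.pull e) (η.pull e) y u v w =
      wedged θ η (e.symm y) (dchartSymm e y u) (dchartSymm e y v) (dchartSymm e y w) := by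
  simp only [fwedged, hη.fd_pull he hy hyU]
  rfl

lemma deriv_eq_fderiv_push (he : e ∈ IsManifold.maximalAtlas 𝓘(ℝ, E3) ∞ M) {y : E3}
    (hy : y ∈ e.target) (hf : DifferentiableAt ℝ (fun z => I (e.symm z)) y) :
    fderiv ℝ (fun z => I (e.symm z)) y (X.push e y) = X.deriv I (e.symm y) := by
  rw [fderiv_comp_chart_symm he hy hf, dchartSymm_push he hy]
  rfl

lemma logForm_apply (he : e ∈ IsManifold.maximalAtlas 𝓘(ℝ, E3) ∞ M) {y : E3}
    (hy : y ∈ e.target) (hf : DifferentiableAt ℝ (fun z => I (e.symm z)) y) (u : E3) :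
    logForm X I e y u = OneForm.val (fun x => (X.deriv I x)⁻¹ • dfun I x) (e.symm y)
      (dchartSymm e y u) := by
  rw [logForm, deriv_eq_fderiv_push he hy hf, smul_apply, fderiv_comp_chart_symm he hy hf]
  rfl

/-- The coordinate expression of the balanced forms in a chart. -/
lemma ContactPair.IsBalancedOn.balancedCoframe (h : P.IsBalancedOn U ε α α' X) (hU : IsOpen U)
    (hI : IsGeneratingInvariantOn U α α' I) (hI' : ∀ x ∈ U, X.deriv I x ≠ 0)
    (hdep : ∃ F : ℝ → ℝ, ∀ x ∈ U, X.deriv I x = F (I x))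
    (he : e ∈ IsManifold.maximalAtlas 𝓘(ℝ, E3) ∞ M) :
    BalancedCoframe (e.target ∩ e.symm ⁻¹' U) ε (α.pull e) (α'.pull e) (logForm X I e)
      (fun y => I (e.symm y)) (fun y => fderiv ℝ (fun z => I (e.symm z)) y (X.push e y)) := by
  have hV : IsOpen (e.target ∩ e.symm ⁻¹' U) := e.isOpen_inter_preimage_symm hU
  have hε : ε * ε = 1 := by rcases h.sign with rfl | rfl <;> norm_num
  have sα : ∀ y ∈ e.target ∩ e.symm ⁻¹' U, ContDiffAt ℝ ∞ (α.pull e) y := fun y hy =>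
    h.smooth.contDiffAt_pull he hy.1 hy.2
  have sα' : ∀ y ∈ e.target ∩ e.symm ⁻¹' U, ContDiffAt ℝ ∞ (α'.pull e) y := fun y hy =>
    h.smooth'.contDiffAt_pull he hy.1 hy.2
  have hind : ∀ y ∈ e.target ∩ e.symm ⁻¹' U, ∃ u v,
      α.pull e y u * α'.pull e y v - α.pull e y v * α'.pull e y u ≠ 0 := fun y hy => by
    obtain ⟨u, v, huv⟩ : ∃ u v : E3, α.val (e.symm y) u * α'.val (e.symm y) v -
      α.val (e.symm y) v * α'.val (e.symm y) u ≠ 0 := h.exists_wedge_ne_zero hy.2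
    refine ⟨dchart e (e.symm y) u, dchart e (e.symm y) v, ?_⟩
    simp only [OneForm.pull_apply, dchartSymm_dchart' he hy.1]
    exact huv
  have hX : ∀ y ∈ e.target ∩ e.symm ⁻¹' U, ∀ v w, fwedged (α.pull e) (α.pull e) y (X.push e y) v w =
      α.pull e y v * α'.pull e y w - α.pull e y w * α'.pull e y v := fun y hy v w => by
    rw [fwedged_pull h.smooth he hy.1 hy.2, dchartSymm_push he hy.1]
    exact h.normalized _ hy.2 _ _
  have hgen : ∀ y ∈ e.target ∩ e.symm ⁻¹' U, ∀ u v w,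
      I (e.symm y) * fwedged (α.pull e) (α.pull e) y u v w =
        fwedged (α.pull e) (α'.pull e) y u v w + fwedged (α'.pull e) (α.pull e) y u v w :=
    fun y hy u v w => by
      rw [fwedged_pull h.smooth he hy.1 hy.2, fwedged_pull h.smooth' he hy.1 hy.2,
        fwedged_pull h.smooth he hy.1 hy.2]
      exact hI _ hy.2 _ _ _
  have sI : ∀ y ∈ e.target ∩ e.symm ⁻¹' U, ContDiffAt ℝ ∞ (fun y => I (e.symm y)) y :=
    fun y hy => by
      obtain ⟨u, v, huv⟩ := hind y hy
      refine contDiffAt_generatingInvariant (sα y hy) (sα' y hy)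
        (u := X.push e y) (v := u) (w := v) (by rwa [hX y hy]) ?_
      filter_upwards [hV.mem_nhds hy] with z hz using hgen z hz _ _ _
  have hJ : ∀ y ∈ e.target ∩ e.symm ⁻¹' U,
      fderiv ℝ (fun z => I (e.symm z)) y (X.push e y) = X.deriv I (e.symm y) := fun y hy =>
    deriv_eq_fderiv_push he hy.1 (sI y hy).diff
  refine BalancedCoframe.of_normalized hV hε sα sα' sI hind (fun y hy u v w => ?_) hX hgen
    (fun y hy => ?_) ?_
  · rw [fwedged_pull h.smooth he hy.1 hy.2, fwedged_pull h.smooth' he hy.1 hy.2]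
    exact h.balanced _ hy.2 _ _ _
  · rw [hJ y hy]
    exact hI' _ hy.2
  · obtain ⟨F, hF⟩ := hdep
    exact ⟨F, fun y hy => by rw [hJ y hy]; exact hF _ hy.2⟩

/-- The coordinate expression of the connection form in a chart. -/
lemma IsLambdaOn.connectionForm (h : IsLambdaOn U ε α α' X I ν Λ) (hα : α.SmoothOn U)
    (hα' : α'.SmoothOn U) (he : e ∈ IsManifold.maximalAtlas 𝓘(ℝ, E3) ∞ M)
    (hI : ∀ y ∈ e.target ∩ e.symm ⁻¹' U, DifferentiableAt ℝ (fun y => I (e.symm y)) y) :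
    ConnectionForm (e.target ∩ e.symm ⁻¹' U) ε (α.pull e) (α'.pull e) (logForm X I e)
      (fun y => I (e.symm y)) (ν.pull e) (fun y => Λ (e.symm y)) := by
  refine ⟨fun y hy => h.smooth.contDiffAt_pull he hy.1 hy.2, fun y hy u v => ?_,
    fun y hy u v => ?_, fun y hy u v => ?_⟩
  · rw [hα.fd_pull he hy.1 hy.2, logForm_apply he hy.1 (hI y hy), logForm_apply he hy.1 (hI y hy)]
    exact h.d_form _ hy.2 _ _
  · rw [hα'.fd_pull he hy.1 hy.2, logForm_apply he hy.1 (hI y hy), logForm_apply he hy.1 (hI y hy)]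
    exact h.d_form' _ hy.2 _ _
  · rw [h.smooth.fd_pull he hy.1 hy.2]
    exact h.d_conn _ hy.2 _ _

/-- Existence of the connection form and of `Λ`. -/
lemma ContactPair.IsBalancedOn.exists_isLambdaOn (h : P.IsBalancedOn U ε α α' X) (hU : IsOpen U)
    (hI : IsGeneratingInvariantOn U α α' I) (hI' : ∀ x ∈ U, X.deriv I x ≠ 0)
    (hdep : ∃ F : ℝ → ℝ, ∀ x ∈ U, X.deriv I x = F (I x)) :
    ∃ (ν : OneForm M) (Λ : M → ℝ), IsLambdaOn U ε α α' X I ν Λ := by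
  set β : OneForm M := fun y => (X.deriv I y)⁻¹ • dfun I y with hβ
  -- A chart-free pointwise condition on the value of ν at x. Having a unique solution, it defines ν
  -- by choice, and near each point this choice coincides with the smooth form built in a chart.
  set C : M → (E3 →L[ℝ] ℝ) → Prop := fun x n =>
    (∀ u v, α.dval x u v = n u * α.val x v - n v * α.val x u +
      (α'.val x u * β.val x v - α'.val x v * β.val x u)) ∧
    (∀ u v, α'.dval x u v = n u * α'.val x v - n v * α'.val x u +
      I x * (α'.val x u * β.val x v - α'.val x v * β.val x u) +
        ε * (β.val x u * α.val x v - β.val x v * α.val x u)) with hC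
  have local_form : ∀ x ∈ U, ∃ η : E3 → E3 →L[ℝ] ℝ,
      (∀ y ∈ (chartAt E3 x).target ∩ (chartAt E3 x).symm ⁻¹' U, ContDiffAt ℝ ∞ η y ∧
        C ((chartAt E3 x).symm y) ((η y).comp (dchart (chartAt E3 x) ((chartAt E3 x).symm y))) ∧
        (∀ n, C ((chartAt E3 x).symm y) n → n.comp (dchartSymm (chartAt E3 x) y) = η y) ∧
        ∃ l, ∀ u v, fd η y u v =
          l * (α.pull (chartAt E3 x) y u * α'.pull (chartAt E3 x) y v -
            α.pull (chartAt E3 x) y v * α'.pull (chartAt E3 x) y u)) := by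
    intro x hx
    set e := chartAt E3 x
    have he : e ∈ IsManifold.maximalAtlas 𝓘(ℝ, E3) ∞ M := IsManifold.chart_mem_maximalAtlas _
    have hb := h.balancedCoframe hU hI hI' hdep he
    obtain ⟨η, sη, h1, h2⟩ := hb.exists_connection
    refine ⟨η, fun y hy => ⟨sη y hy, ⟨fun u v => ?_, fun u v => ?_⟩, fun n hn => ?_,
      hb.fd_connection sη h1 h2 hy⟩⟩
    · have := h1 y hy (dchart e (e.symm y) u) (dchart e (e.symm y) v)
      rw [h.smooth.fd_pull he hy.1 hy.2, logForm_apply he hy.1 (hb.smooth_I y hy).diff,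
        logForm_apply he hy.1 (hb.smooth_I y hy).diff] at this
      simp only [OneForm.pull_apply, dchartSymm_dchart' he hy.1] at this
      exact this
    · have := h2 y hy (dchart e (e.symm y) u) (dchart e (e.symm y) v)
      rw [h.smooth'.fd_pull he hy.1 hy.2, logForm_apply he hy.1 (hb.smooth_I y hy).diff,
        logForm_apply he hy.1 (hb.smooth_I y hy).diff] at this
      simp only [OneForm.pull_apply, dchartSymm_dchart' he hy.1] at this
      exact this
    · refine hb.connection_unique hy (fun u v => ?_) (fun u v => ?_)
      · have k1 := h1 y hy u v
        have k2 := hn.1 (dchartSymm e y u) (dchartSymm e y v)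
        rw [h.smooth.fd_pull he hy.1 hy.2, logForm_apply he hy.1 (hb.smooth_I y hy).diff,
          logForm_apply he hy.1 (hb.smooth_I y hy).diff, k2] at k1
        exact add_right_cancel k1
      · have k1 := h2 y hy u v
        have k2 := hn.2 (dchartSymm e y u) (dchartSymm e y v)
        rw [h.smooth'.fd_pull he hy.1 hy.2, logForm_apply he hy.1 (hb.smooth_I y hy).diff,
          logForm_apply he hy.1 (hb.smooth_I y hy).diff, k2] at k1
        exact add_right_cancel (add_right_cancel k1)
  have exC : ∀ x ∈ U, ∃ n, C x n := fun x hx => by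
    obtain ⟨η, hη⟩ := local_form x hx
    have hs := mem_chart_source E3 x
    have := (hη (chartAt E3 x x) ⟨(chartAt E3 x).map_source hs, by
      rwa [mem_preimage, (chartAt E3 x).left_inv hs]⟩).2.1
    rw [(chartAt E3 x).left_inv hs] at this
    exact ⟨_, this⟩
  classical
  set ν : OneForm M := fun x => if hx : x ∈ U then (exC x hx).choose else 0 with hν
  have Cν : ∀ x ∈ U, C x (ν.val x) := fun x hx => by
    have : ν.val x = (exC x hx).choose := dif_pos hx
    rw [this]
    exact (exC x hx).choose_spec
  have key : ∀ x ∈ U, ContDiffAt ℝ ∞ (ν.pull (chartAt E3 x)) (chartAt E3 x x) ∧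
      ∃ l, ∀ u v, fd (ν.pull (chartAt E3 x)) (chartAt E3 x x) u v =
        l * (α.pull (chartAt E3 x) (chartAt E3 x x) u * α'.pull (chartAt E3 x) (chartAt E3 x x) v -
          α.pull (chartAt E3 x) (chartAt E3 x x) v *
            α'.pull (chartAt E3 x) (chartAt E3 x x) u) := by
    intro x hx
    obtain ⟨η, hη⟩ := local_form x hx
    have hs := mem_chart_source E3 x
    have hy : chartAt E3 x x ∈ (chartAt E3 x).target ∩ (chartAt E3 x).symm ⁻¹' U :=
      ⟨(chartAt E3 x).map_source hs, by rwa [mem_preimage, (chartAt E3 x).left_inv hs]⟩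
    have hev : ν.pull (chartAt E3 x) =ᶠ[𝓝 (chartAt E3 x x)] η := by
      filter_upwards [((chartAt E3 x).isOpen_inter_preimage_symm hU).mem_nhds hy] with z hz
      exact (hη z hz).2.2.1 _ (Cν _ hz.2)
    obtain ⟨l, hl⟩ := (hη _ hy).2.2.2
    exact ⟨(hη _ hy).1.congr_of_eventuallyEq hev, l, fun u v => by rw [fd_congr hev, hl]⟩
  have sν : ν.SmoothOn U := fun x hx => (key x hx).1
  have exΛ : ∀ x ∈ U, ∃ l, ∀ u v,
      ν.dval x u v = l * (α.val x u * α'.val x v - α.val x v * α'.val x u) := fun x hx => by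
    obtain ⟨-, l, hl⟩ := key x hx
    have he : chartAt E3 x ∈ IsManifold.maximalAtlas 𝓘(ℝ, E3) ∞ M :=
      IsManifold.chart_mem_maximalAtlas _
    have hs := mem_chart_source E3 x
    refine ⟨l, fun u v => ?_⟩
    have h1 := hl (dchart (chartAt E3 x) x u) (dchart (chartAt E3 x) x v)
    rw [sν.fd_pull he ((chartAt E3 x).map_source hs) (by rwa [(chartAt E3 x).left_inv hs])] at h1
    simp only [OneForm.pull_apply, dchartSymm_dchart he hs] at h1
    rw [(chartAt E3 x).left_inv hs] at h1
    exact h1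
  refine ⟨ν, fun x => if hx : x ∈ U then (exΛ x hx).choose else 0, sν, fun x hx => (Cν x hx).1,
    fun x hx => (Cν x hx).2, fun x hx u v => ?_⟩
  simp only [dif_pos hx]
  exact (exΛ x hx).choose_spec u v

end Transfer

/-! ### Symmetries and normal forms in charts. -/

section Symmetries

variable {M : Type*} [TopologicalSpace M] [ChartedSpace E3 M] [IsManifold 𝓘(ℝ, E3) ∞ M]
  {P : ContactPair M} {e : OpenPartialHomeomorph M E3} {U W : Set M} {ε : ℝ} {α α' ν : OneForm M}
  {X Y : VField M} {I Λ : M → ℝ} {m : M}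

/-- The coordinate expression of a local flow. -/
def flowInChart (e : OpenPartialHomeomorph M E3) (Φ : ℝ → M → M) (q : ℝ × E3) : E3 :=
  e (Φ q.1 (e.symm q.2))

lemma IsLocalFlow.contMDiffAt_comp_symm {δ : ℝ} {V : Set M} {Φ : ℝ → M → M}
    (h : IsLocalFlow Y W δ V Φ) (he : e ∈ IsManifold.maximalAtlas 𝓘(ℝ, E3) ∞ M) {t : ℝ} {y : E3}
    (ht : t ∈ Ioo (-δ) δ) (hy : y ∈ e.target) (hyV : e.symm y ∈ V) :
    ContMDiffAt 𝓘(ℝ, ℝ × E3) 𝓘(ℝ, E3) ∞ (fun q : ℝ × E3 => Φ q.1 (e.symm q.2)) (t, y) := by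
  have h1 : ContMDiffAt (𝓘(ℝ, ℝ).prod 𝓘(ℝ, E3)) 𝓘(ℝ, E3) ∞ (fun q : ℝ × M => Φ q.1 q.2)
      (t, e.symm y) :=
    h.smooth.contMDiffAt ((isOpen_Ioo.prod h.isOpen).mem_nhds ⟨ht, hyV⟩)
  have h2 : ContMDiffAt 𝓘(ℝ, ℝ × E3) 𝓘(ℝ, ℝ) ∞ (fun q : ℝ × E3 => q.1) (t, y) :=
    contDiff_fst.contMDiff.contMDiffAt
  have h3 : ContMDiffAt 𝓘(ℝ, ℝ × E3) 𝓘(ℝ, E3) ∞ (fun q : ℝ × E3 => q.2) (t, y) :=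
    contDiff_snd.contMDiff.contMDiffAt
  have h4 : ContMDiffAt 𝓘(ℝ, ℝ × E3) 𝓘(ℝ, E3) ∞ (fun q : ℝ × E3 => e.symm q.2) (t, y) :=
    (contMDiffAt_symm_of_mem_maximalAtlas he hy).comp (t, y) h3
  exact ContMDiffAt.comp (t, y) (g := fun q : ℝ × M => Φ q.1 q.2) h1 (h2.prodMk h4)

lemma IsLocalFlow.contDiffAt_flowInChart {δ : ℝ} {V : Set M} {Φ : ℝ → M → M}
    (h : IsLocalFlow Y W δ V Φ) (he : e ∈ IsManifold.maximalAtlas 𝓘(ℝ, E3) ∞ M) {t : ℝ} {y : E3}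
    (ht : t ∈ Ioo (-δ) δ) (hy : y ∈ e.target) (hyV : e.symm y ∈ V)
    (hs : Φ t (e.symm y) ∈ e.source) : ContDiffAt ℝ ∞ (flowInChart e Φ) (t, y) :=
  contMDiffAt_iff_contDiffAt.1 (ContMDiffAt.comp (t, y) (g := e)
    (contMDiffAt_of_mem_maximalAtlas he hs) (h.contMDiffAt_comp_symm he ht hy hyV))

lemma IsLocalFlow.flowInChart_zero {δ : ℝ} {V : Set M} {Φ : ℝ → M → M}
    (h : IsLocalFlow Y W δ V Φ) {y : E3} (hy : y ∈ e.target) (hyV : e.symm y ∈ V) :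
    flowInChart e Φ (0, y) = y := by
  rw [flowInChart, h.zero _ hyV, e.right_inv hy]

lemma IsLocalFlow.fderiv_flowInChart_zero {δ : ℝ} {V : Set M} {Φ : ℝ → M → M}
    (h : IsLocalFlow Y W δ V Φ) (he : e ∈ IsManifold.maximalAtlas 𝓘(ℝ, E3) ∞ M) {y : E3}
    (hy : y ∈ e.target) (hyV : e.symm y ∈ V) :
    fderiv ℝ (flowInChart e Φ) (0, y) (1, 0) = Y.push e y := by
  have h0 : (0 : ℝ) ∈ Ioo (-δ) δ := ⟨neg_lt_zero.2 h.pos, h.pos⟩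
  have hz : Φ 0 (e.symm y) = e.symm y := h.zero _ hyV
  have hs : Φ 0 (e.symm y) ∈ e.source := by rw [hz]; exact e.map_target hy
  have i1 : HasDerivAt (fun t : ℝ => (t, y)) ((1 : ℝ), (0 : E3)) 0 :=
    (hasDerivAt_id (0 : ℝ)).prodMk (hasDerivAt_const _ _)
  have i2 : HasFDerivAt (flowInChart e Φ) (fderiv ℝ (flowInChart e Φ) (0, y))
      ((fun t : ℝ => (t, y)) 0) := (h.contDiffAt_flowInChart he h0 hy hyV hs).diff.hasFDerivAt
  have h1 : HasDerivAt (flowInChart e Φ ∘ fun t => (t, y)) _ 0 := i2.comp_hasDerivAt 0 i1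
  have h2 := (h.integral _ hyV 0 h0).hasMFDerivAt (Ioo_mem_nhds h0.1 h0.2)
  have h3 : HasMFDerivAt 𝓘(ℝ, E3) 𝓘(ℝ, E3) e (Φ 0 (e.symm y)) (dchart e (Φ 0 (e.symm y))) :=
    ((mdifferentiable_chart he).mdifferentiableAt hs).hasMFDerivAt
  have h4 := (h3.comp (0 : ℝ) h2).hasFDerivAt
  have h5 := DFunLike.congr_fun (h1.hasFDerivAt.unique h4) (1 : ℝ)
  have h6 : (1 : ℝ) • fderiv ℝ (flowInChart e Φ) (0, y) (1, 0) =
    dchart e (Φ 0 (e.symm y)) ((1 : ℝ) • Y (Φ 0 (e.symm y))) := h5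
  rw [one_smul, one_smul, hz] at h6
  exact h6

/-- If the flow maps `ξ` to `ξ`, its coordinate expression preserves the kernel of `α`. -/
lemma IsLocalFlow.pull_apply_eq_zero {ξ : PlaneField M} {δ : ℝ} {V : Set M} {Φ : ℝ → M → M}
    (h : IsLocalFlow Y W δ V Φ) (he : e ∈ IsManifold.maximalAtlas 𝓘(ℝ, E3) ∞ M) {y w : E3}
    (hξ : ∀ x ∈ U, ∀ v, v ∈ ξ x ↔ α x v = 0)
    (hinv : ∀ t ∈ Ioo (-δ) δ, ∀ x ∈ V,
      (ξ x).map (mfderiv 𝓘(ℝ, E3) 𝓘(ℝ, E3) (Φ t) x).toLinearMap = ξ (Φ t x))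
    (hy : y ∈ e.target) (hyV : e.symm y ∈ V) (hyU : e.symm y ∈ U) (hw : α.pull e y w = 0) {t : ℝ}
    (ht : t ∈ Ioo (-δ) δ) (hs : Φ t (e.symm y) ∈ e.source) (hsU : Φ t (e.symm y) ∈ U) :
    α.pull e (flowInChart e Φ (t, y)) (fderiv ℝ (flowInChart e Φ) (t, y) (0, w)) = 0 := by
  have hw' : (dchartSymm e y w : E3) ∈ ξ (e.symm y) := (hξ _ hyU _).2 hw
  have hm : mfderiv 𝓘(ℝ, E3) 𝓘(ℝ, E3) (Φ t) (e.symm y) (dchartSymm e y w) ∈ ξ (Φ t (e.symm y)) := by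
    rw [← hinv t ht _ hyV]
    exact Submodule.mem_map_of_mem hw'
  have hα := (hξ _ hsU _).1 hm
  have k1 : MDifferentiableAt 𝓘(ℝ, E3) 𝓘(ℝ, E3) (Φ t) (e.symm y) := by
    have h1 : ContMDiffAt (𝓘(ℝ, ℝ).prod 𝓘(ℝ, E3)) 𝓘(ℝ, E3) ∞ (fun q : ℝ × M => Φ q.1 q.2)
        (t, e.symm y) :=
      h.smooth.contMDiffAt ((isOpen_Ioo.prod h.isOpen).mem_nhds ⟨ht, hyV⟩)
    have h2 : ContMDiffAt 𝓘(ℝ, E3) (𝓘(ℝ, ℝ).prod 𝓘(ℝ, E3)) ∞ (fun x : M => (t, x)) (e.symm y) :=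
      contMDiffAt_const.prodMk contMDiffAt_id
    exact (ContMDiffAt.comp (e.symm y) (g := fun q : ℝ × M => Φ q.1 q.2) h1 h2).mdifferentiableAt
      infty_ne_zero
  have k2 : HasMFDerivAt 𝓘(ℝ, E3) 𝓘(ℝ, E3) e.symm y (dchartSymm e y) :=
    ((mdifferentiable_chart he).mdifferentiableAt_symm hy).hasMFDerivAt
  have k3 : HasMFDerivAt 𝓘(ℝ, E3) 𝓘(ℝ, E3) e (Φ t (e.symm y)) (dchart e (Φ t (e.symm y))) :=
    ((mdifferentiable_chart he).mdifferentiableAt hs).hasMFDerivAt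
  have k4 := (k3.comp y (k1.hasMFDerivAt.comp y k2)).hasFDerivAt
  have i2 : HasFDerivAt (fun z : E3 => (t, z)) (ContinuousLinearMap.inr ℝ ℝ E3) y :=
    (hasFDerivAt_const _ _).prodMk (hasFDerivAt_id y)
  have k5 : HasFDerivAt (fun z : E3 => flowInChart e Φ (t, z)) _ y :=
    (h.contDiffAt_flowInChart he ht hy hyV hs).diff.hasFDerivAt.comp y i2
  obtain ⟨w', k6, k7⟩ : ∃ w' : E3, fderiv ℝ (flowInChart e Φ) (t, y) (0, w) =
      dchart e (Φ t (e.symm y)) w' ∧ α.val (Φ t (e.symm y)) w' = 0 :=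
    ⟨_, DFunLike.congr_fun (k5.unique k4) w, hα⟩
  have k8 : flowInChart e Φ (t, y) = e (Φ t (e.symm y)) := rfl
  rw [OneForm.pull_apply, k6, k8, dchartSymm_dchart he hs, e.left_inv hs, k7]

/-- The coordinate expression of an infinitesimal symmetry. -/
lemma ContactPair.IsInfinitesimalSymmetryOn.flatSymmetry (hY : P.IsInfinitesimalSymmetryOn Y W)
    (hb : P.IsBalancedOn U ε α α' X) (hU : IsOpen U)
    (he : e ∈ IsManifold.maximalAtlas 𝓘(ℝ, E3) ∞ M) :
    FlatSymmetry (e.target ∩ e.symm ⁻¹' (U ∩ W)) (α.pull e) (α'.pull e) (Y.push e) := by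
  have key : ∀ y ∈ e.target ∩ e.symm ⁻¹' (U ∩ W), ∃ Ψ : ℝ × E3 → E3, ContDiffAt ℝ ∞ Ψ (0, y) ∧
      (∀ᶠ z in 𝓝 y, Ψ (0, z) = z) ∧ (∀ᶠ z in 𝓝 y, fderiv ℝ Ψ (0, z) (1, 0) = Y.push e z) ∧
      (∀ w, α.pull e y w = 0 →
        ∀ᶠ t in 𝓝 (0 : ℝ), α.pull e (Ψ (t, y)) (fderiv ℝ Ψ (t, y) (0, w)) = 0) ∧
      (∀ w, α'.pull e y w = 0 →
        ∀ᶠ t in 𝓝 (0 : ℝ), α'.pull e (Ψ (t, y)) (fderiv ℝ Ψ (t, y) (0, w)) = 0) := by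
    intro y ⟨hy, hyU, hyW⟩
    obtain ⟨δ, V, Φ, hyV, hΦ, hinv⟩ := hY.flow _ hyW
    have h0 : (0 : ℝ) ∈ Ioo (-δ) δ := ⟨neg_lt_zero.2 hΦ.pos, hΦ.pos⟩
    have hz : Φ 0 (e.symm y) = e.symm y := hΦ.zero _ hyV
    have hs : Φ 0 (e.symm y) ∈ e.source := by rw [hz]; exact e.map_target hy
    have hev := eventually_mem_source hy (hΦ.isOpen.mem_nhds hyV)
    have hct : ContinuousAt (fun t => Φ t (e.symm y)) 0 :=
      ((hΦ.integral _ hyV 0 h0).hasMFDerivAt (Ioo_mem_nhds h0.1 h0.2)).continuousAt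
    have ht : ∀ᶠ t in 𝓝 (0 : ℝ), t ∈ Ioo (-δ) δ ∧ Φ t (e.symm y) ∈ e.source ∧
        Φ t (e.symm y) ∈ U := by
      have hsU : Φ 0 (e.symm y) ∈ U := by rwa [hz]
      filter_upwards [Ioo_mem_nhds h0.1 h0.2, hct (e.open_source.mem_nhds hs),
        hct (hU.mem_nhds hsU)] with t h1 h2 h3 using ⟨h1, h2, h3⟩
    refine ⟨flowInChart e Φ, hΦ.contDiffAt_flowInChart he h0 hy hyV hs, ?_, ?_, fun w hw => ?_,
      fun w hw => ?_⟩
    · filter_upwards [hev] with z hz using hΦ.flowInChart_zero hz.1 hz.2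
    · filter_upwards [hev] with z hz using hΦ.fderiv_flowInChart_zero he hz.1 hz.2
    · filter_upwards [ht] with t ht
      exact hΦ.pull_apply_eq_zero he hb.ker (fun t ht x hx => (hinv t ht x hx).1) hy hyV hyU hw ht.1
        ht.2.1 ht.2.2
    · filter_upwards [ht] with t ht
      exact hΦ.pull_apply_eq_zero he hb.ker' (fun t ht x hx => (hinv t ht x hx).2) hy hyV hyU hw ht.1
        ht.2.1 ht.2.2
  -- In the chart Y is the time derivative at 0 of the smooth flow; this gives its smoothness, and
  -- differentiating the invariance of the kernels gives the two Lie conditions.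
  refine ⟨fun y hy => ?_, fun y hy w hw => ?_, fun y hy w hw => ?_⟩
  · obtain ⟨Ψ, hΨ, -, hd, -⟩ := key y hy
    have h1 : ContDiffAt ℝ ∞ (fderiv ℝ Ψ) (0, y) := hΨ.fderiv_right (by simp)
    have h2 : ContDiffAt ℝ ∞ (fun z : E3 => ((0 : ℝ), z)) y := contDiffAt_const.prodMk contDiffAt_id
    have h3 : ContDiffAt ℝ ∞ (fun z : E3 => fderiv ℝ Ψ (0, z)) y := h1.comp y h2
    exact (h3.clm_apply contDiffAt_const).congr_of_eventuallyEq (hd.mono fun z hz => hz.symm)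
  · obtain ⟨Ψ, hΨ, h0, hd, hk, -⟩ := key y hy
    exact lie_eq_zero_of_flow (hb.smooth.contDiffAt_pull he hy.1 hy.2.1).diff hΨ h0 hd (hk w hw)
  · obtain ⟨Ψ, hΨ, h0, hd, -, hk⟩ := key y hy
    exact lie_eq_zero_of_flow (hb.smooth'.contDiffAt_pull he hy.1 hy.2.1).diff hΨ h0 hd (hk w hw)

lemma trans_mem_maximalAtlas (he : e ∈ IsManifold.maximalAtlas 𝓘(ℝ, E3) ∞ M)
    {ψ : OpenPartialHomeomorph E3 E3} (h : ∀ y ∈ ψ.source, ContDiffAt ℝ ∞ ψ y)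
    (h' : ∀ z ∈ ψ.target, ContDiffAt ℝ ∞ ψ.symm z) :
    e.trans ψ ∈ IsManifold.maximalAtlas 𝓘(ℝ, E3) ∞ M := by
  refine OpenPartialHomeomorph.mem_maximalAtlas_of_contMDiffOn _ (fun x hx => ?_) (fun z hz => ?_)
  · rw [OpenPartialHomeomorph.trans_source] at hx
    exact ((h _ hx.2).contMDiffAt.comp x
      (contMDiffAt_of_mem_maximalAtlas he hx.1)).contMDiffWithinAt
  · rw [OpenPartialHomeomorph.trans_target] at hz
    exact ((contMDiffAt_symm_of_mem_maximalAtlas he hz.2).comp z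
      (h' _ hz.1).contMDiffAt).contMDiffWithinAt

lemma dcoord_trans (he : e ∈ IsManifold.maximalAtlas 𝓘(ℝ, E3) ∞ M)
    {ψ : OpenPartialHomeomorph E3 E3} (h : ∀ y ∈ ψ.source, ContDiffAt ℝ ∞ ψ y) {q : M}
    (hq : q ∈ e.source) (hq' : e q ∈ ψ.source) (i : Fin 3) (v : E3) :
    (dcoord (e.trans ψ) i).val q v = fderiv ℝ (fun z => ψ z i) (e q) (dchart e q v) := by
  have h1 : HasMFDerivAt 𝓘(ℝ, E3) 𝓘(ℝ, ℝ) (fun z => ψ z i) (e q)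
      (fderiv ℝ (fun z => ψ z i) (e q)) :=
    ((differentiableAt_piLp 2).1 (h _ hq').diff i).hasFDerivAt.hasMFDerivAt
  have h2 : HasMFDerivAt 𝓘(ℝ, E3) 𝓘(ℝ, E3) e q (dchart e q) :=
    ((mdifferentiable_chart he).mdifferentiableAt hq).hasMFDerivAt
  exact DFunLike.congr_fun (h1.comp q h2).mfderiv v

lemma dcoord_dchartSymm (he : e ∈ IsManifold.maximalAtlas 𝓘(ℝ, E3) ∞ M) {y : E3}
    (hy : y ∈ e.target) (i : Fin 3) (w : E3) :
    (dcoord e i).val (e.symm y) (dchartSymm e y w) = w i := by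
  have h1 : (fun z => e (e.symm z) i) =ᶠ[𝓝 y] fun z : E3 => z i := by
    filter_upwards [e.open_target.mem_nhds hy] with z hz
    rw [e.right_inv hz]
  have h2 : HasFDerivAt (fun z : E3 => z i) (EuclideanSpace.proj i : E3 →L[ℝ] ℝ) y :=
    (EuclideanSpace.proj i : E3 →L[ℝ] ℝ).hasFDerivAt
  have h3 := h2.congr_of_eventuallyEq h1
  rw [dcoord, ← fderiv_comp_chart_symm (f := fun q => e q i) he hy h3.differentiableAt, h3.fderiv]
  rfl

lemma OneForm.pull_dchart (α : OneForm M) (he : e ∈ IsManifold.maximalAtlas 𝓘(ℝ, E3) ∞ M) {q : M}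
    (hq : q ∈ e.source) (v : E3) : α.pull e (e q) (dchart e q v) = α.val q v := by
  rw [OneForm.pull_apply, dchartSymm_dchart he hq, e.left_inv hq]

lemma FlatTypeIII₂.hasTypeIII₂At (hb : P.IsBalancedOn U ε α α' X)
    (he : e ∈ IsManifold.maximalAtlas 𝓘(ℝ, E3) ∞ M) (hm : m ∈ e.source) {V : Set E3}
    (hV : V ⊆ e.target ∩ e.symm ⁻¹' U) (h : FlatTypeIII₂ V (α.pull e) (α'.pull e) (e m)) :
    P.HasTypeIII₂At m := by
  obtain ⟨ψ, f, hmψ, hψV, hψ, hψ', hf⟩ := h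
  refine ⟨e.trans ψ, trans_mem_maximalAtlas he hψ hψ', ?_, f, fun q hq => ?_⟩
  · rw [OpenPartialHomeomorph.trans_source]
    exact ⟨hm, hmψ⟩
  · rw [OpenPartialHomeomorph.trans_source] at hq
    have hqU : q ∈ U := by
      have := (hV (hψV hq.2)).2
      rwa [mem_preimage, e.left_inv hq.1] at this
    obtain ⟨h1, h2, h3⟩ := hf _ hq.2
    refine ⟨h1, fun v => ?_, fun v => ?_⟩
    · have key : ∀ v : E3, _ := fun v => h2 (dchart e q v)
      simp only [OneForm.pull_dchart _ he hq.1, ← dcoord_trans he hψ hq.1 hq.2] at key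
      exact (hb.ker q hqU v).trans (key v)
    · have key : ∀ v : E3, _ := fun v => h3 (dchart e q v)
      simp only [OneForm.pull_dchart _ he hq.1, ← dcoord_trans he hψ hq.1 hq.2] at key
      exact (hb.ker' q hqU v).trans (key v)

lemma FlatTypeIII₁.hasTypeIII₁At (hb : P.IsBalancedOn U ε α α' X)
    (he : e ∈ IsManifold.maximalAtlas 𝓘(ℝ, E3) ∞ M) (hm : m ∈ e.source) {V : Set E3}
    (hV : V ⊆ e.target ∩ e.symm ⁻¹' U) (h : FlatTypeIII₁ V (α.pull e) (α'.pull e) (e m)) :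
    P.HasTypeIII₁At m := by
  obtain ⟨ψ, a, b, f, hmψ, hψV, hψ, hψ', hf⟩ := h
  refine ⟨e.trans ψ, trans_mem_maximalAtlas he hψ hψ', ?_, a, b, f, fun q hq => ?_⟩
  · rw [OpenPartialHomeomorph.trans_source]
    exact ⟨hm, hmψ⟩
  · rw [OpenPartialHomeomorph.trans_source] at hq
    have hqU : q ∈ U := by
      have := (hV (hψV hq.2)).2
      rwa [mem_preimage, e.left_inv hq.1] at this
    obtain ⟨h1, h2, h3, h4, h5, h6, h7⟩ := hf _ hq.2
    refine ⟨h1, h2, h3, h4, h5, fun v => ?_, fun v => ?_⟩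
    · have key : ∀ v : E3, _ := fun v => h6 (dchart e q v)
      simp only [OneForm.pull_dchart _ he hq.1, ← dcoord_trans he hψ hq.1 hq.2] at key
      exact (hb.ker q hqU v).trans (key v)
    · have key : ∀ v : E3, _ := fun v => h7 (dchart e q v)
      simp only [OneForm.pull_dchart _ he hq.1, ← dcoord_trans he hψ hq.1 hq.2] at key
      exact (hb.ker' q hqU v).trans (key v)

lemma eventually_eq_zero_of_push {Z : M → E3} (he : e ∈ IsManifold.maximalAtlas 𝓘(ℝ, E3) ∞ M)
    (hm : m ∈ e.source)
    (h : ∀ᶠ y in 𝓝 (e m), dchart e (e.symm y) (Z (e.symm y)) = 0) : ∀ᶠ x in 𝓝 m, Z x = 0 := by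
  filter_upwards [(e.continuousAt hm).eventually h, e.open_source.mem_nhds hm] with x hx hxs
  rw [e.left_inv hxs] at hx
  rw [← dchartSymm_dchart he hxs (Z x), hx, map_zero]

end Symmetries

end ContactPairs

/-! ### The theorem on the manifold. -/

open ContactPairs in
theorem mainTheorem7 {M : Type*} [TopologicalSpace M] [T2Space M] [ChartedSpace ContactPairs.E3 M]
    [IsManifold 𝓘(ℝ, ContactPairs.E3) ∞ M] (P : ContactPairs.ContactPair M)
    (m : M) (U : Set M) (hU : IsOpen U) (hm : m ∈ U)
    (ε : ℝ) (α α' : ContactPairs.OneForm M) (X : ContactPairs.VField M) (I : M → ℝ)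
    (hbal : P.IsBalancedOn U ε α α' X)
    (hI : ContactPairs.IsGeneratingInvariantOn U α α' I)
    (hS : ∀ x ∈ U, P.SchwarzianNeZeroAt x)
    (hI' : ∀ x ∈ U, X.deriv I x ≠ 0)
    (hdep : ∃ F : ℝ → ℝ, ∀ x ∈ U, X.deriv I x = F (I x)) :
    (P.AdmitsSymmetryAt m → P.HasTypeIII₂At m ∨ P.HasTypeIII₁At m) ∧
    (∃ (ν : ContactPairs.OneForm M) (Λ : M → ℝ),
      ContactPairs.IsLambdaOn U ε α α' X I ν Λ) ∧
    ∀ (ν : ContactPairs.OneForm M) (Λ : M → ℝ),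
      ContactPairs.IsLambdaOn U ε α α' X I ν Λ →
      (P.HasTypeIII₂At m ↔ ∀ᶠ x in 𝓝 m, Λ x = 0) ∧
      (Λ m ≠ 0 → P.SymmetryDimLEOneAt m) := by
  obtain ⟨ν₀, Λ₀, hΛ₀⟩ := hbal.exists_isLambdaOn hU hI hI' hdep
  have coframe := fun {e} => hbal.balancedCoframe (e := e) hU hI hI' hdep
  have conn := fun {e ν Λ} (he : e ∈ IsManifold.maximalAtlas 𝓘(ℝ, E3) ∞ M)
    (hΛ : IsLambdaOn U ε α α' X I ν Λ) => hΛ.connectionForm (e := e) hbal.smooth hbal.smooth' he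
      fun y hy => ((coframe he).smooth_I y hy).diff
  set e := chartAt E3 m
  have he : e ∈ IsManifold.maximalAtlas 𝓘(ℝ, E3) ∞ M := IsManifold.chart_mem_maximalAtlas _
  have hs : m ∈ e.source := mem_chart_source E3 m
  have mem : ∀ {e : OpenPartialHomeomorph M E3} {S : Set M}, m ∈ e.source → m ∈ S →
      e m ∈ e.target ∩ e.symm ⁻¹' S := fun {e S} h1 h2 =>
    ⟨e.map_source h1, by rwa [mem_preimage, e.left_inv h1]⟩
  refine ⟨?_, ⟨ν₀, Λ₀, hΛ₀⟩, fun ν Λ hΛ => ⟨⟨?_, fun hz => ?_⟩, fun hne W Y₁ Y₂ hW hmW h₁ h₂ => ?_⟩⟩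
  · rintro ⟨W, Y, hW, hmW, hY, hne⟩
    have hV : e.target ∩ e.symm ⁻¹' (U ∩ W) ⊆ e.target ∩ e.symm ⁻¹' U :=
      fun y hy => ⟨hy.1, hy.2.1⟩
    refine (FlatSymmetry.flatType
      ((coframe he).mono (e.isOpen_inter_preimage_symm (hU.inter hW)) hV) ((conn he hΛ₀).mono hV)
      (hY.flatSymmetry hbal hU he) (mem hs ⟨hm, hmW⟩)
      fun h0 => hne (eventually_eq_zero_of_push (Z := Y) he hs h0)).imp ?_ ?_
    · exact FlatTypeIII₂.hasTypeIII₂At hbal he hs hV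
    · exact FlatTypeIII₁.hasTypeIII₁At hbal he hs hV
  -- The coframe is read in the chart `e'` of the normal form itself, where the translation
  -- symmetries are visible; Λ is a function on U, so its vanishing does not depend on the chart.
  · rintro ⟨e', he', hme', f, hf⟩
    filter_upwards [e'.open_source.mem_nhds hme', hU.mem_nhds hm] with x hx hxU
    have hy : e' x ∈ e'.target ∩ e'.symm ⁻¹' U :=
      ⟨e'.map_source hx, by rwa [mem_preimage, e'.left_inv hx]⟩
    have := eq_zero_of_typeIII₂ (coframe he') (conn he' hΛ) (f := f) (fun y hy w => ?_)
      (fun y hy w => ?_) hy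
    · rwa [e'.left_inv hx] at this
    · have h1 := ((hbal.ker _ hy.2 (dchartSymm e' y w)).symm.trans
        ((hf _ (e'.map_target hy.1)).2.1 (dchartSymm e' y w)))
      have h2 : α.pull e' y w = 0 ↔ (dcoord e' 1).val (e'.symm y) (dchartSymm e' y w) =
        e' (e'.symm y) 2 * (dcoord e' 0).val (e'.symm y) (dchartSymm e' y w) := h1
      rwa [dcoord_dchartSymm he' hy.1, dcoord_dchartSymm he' hy.1, e'.right_inv hy.1] at h2
    · have h1 := ((hbal.ker' _ hy.2 (dchartSymm e' y w)).symm.trans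
        ((hf _ (e'.map_target hy.1)).2.2 (dchartSymm e' y w)))
      have h2 : α'.pull e' y w = 0 ↔ (dcoord e' 1).val (e'.symm y) (dchartSymm e' y w) =
        f (e' (e'.symm y) 2) * (dcoord e' 0).val (e'.symm y) (dchartSymm e' y w) := h1
      rwa [dcoord_dchartSymm he' hy.1, dcoord_dchartSymm he' hy.1, e'.right_inv hy.1] at h2
  · refine FlatTypeIII₂.hasTypeIII₂At hbal he hs subset_rfl
      (flatTypeIII₂_of_eq_zero (coframe he) (conn he hΛ) (mem hs hm) ?_)
    have hc := e.continuousAt_symm (e.map_source hs)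
    rw [ContinuousAt, e.left_inv hs] at hc
    exact hc.eventually hz
  · have hV : e.target ∩ e.symm ⁻¹' (U ∩ W) ⊆ e.target ∩ e.symm ⁻¹' U :=
      fun y hy => ⟨hy.1, hy.2.1⟩
    obtain ⟨c₁, c₂, hc, hev⟩ := exists_combination_eq_zero
      ((coframe he).mono (e.isOpen_inter_preimage_symm (hU.inter hW)) hV) ((conn he hΛ).mono hV)
      (h₁.flatSymmetry hbal hU he) (h₂.flatSymmetry hbal hU he) (mem hs ⟨hm, hmW⟩)
      (by rwa [e.left_inv hs])
    refine ⟨c₁, c₂, hc, eventually_eq_zero_of_push (Z := fun x => c₁ • Y₁ x + c₂ • Y₂ x) he hs ?_⟩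
    filter_upwards [hev] with y hy
    rw [← hy]
    exact ((dchart e (e.symm y)).map_add _ _).trans (congrArg₂ _ ((dchart e (e.symm y)).map_smul _ _)
      ((dchart e (e.symm y)).map_smul _ _))
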